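/- **Conventions.** All composites are written in diagrammatic order. *True Gray categories.* For 2-categories $\mathcal X,\mathcal Y,\mathcal Z$, a Gray functor of two variables $H:\mathcal X\times\mathcal Y\to\mathcal Z$ consists of 2-functors $H(X,-):\mathcal Y\to\mathcal Z$ and $H(-,Y):\mathcal X\to\mathcal Z$ which agree on objects, and 2-cells $$\gamma(f,g):H(X,g)\cdot H(f,Y')\to H(f,Y)\cdot H(X',g)\qquad (f:X\to X',\ g:Y\to Y')$$ which are identities if $f$ or $g$ is an identity, are compatible with composition of the $f$'s and of the $g$'s, and are natural with respect to 2-cells in $f$ and in $g$. These classify the 2-functors $\mathcal X\otimes\mathcal Y\to\mathcal Z$ on Gray's original (lax) tensor product. A *true Gray category* $\mathcal A$ is a category enriched in 2-$\mathbf{Cat}$ with this tensor product: it has objects, hom 2-categories $\mathcal A(A,B)$ (whose objects, arrows and 2-cells are the 1-, 2- and 3-cells of $\mathcal A$), identity 1-cells, and composition given by Gray functors of two variables $\mathcal A(A,B)\times\mathcal A(B,C)\to\mathcal A(A,C)$, strictly unitary and associative. So 2- and 3-cells are whiskered by 1-cells, and for 2-cells $\alpha:f\to g$ in $\mathcal A(A,B)$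 and $\beta:h\to k$ in $\mathcal A(B,C)$ there is a 3-cell $\gamma(\alpha,\beta):f\beta\cdot\alpha k\to\alpha h\cdot g\beta$. *Intercategories.* An intercategory has objects, transversal, horizontal and vertical arrows, horizontal and vertical cells, basic cells and cubes. Objects and transversal arrows, horizontal arrows and cells, vertical arrows and cells, basic cells and cubes form four categories under transversal composition. Horizontal composition $\circ$ (also written $|$), with identities $\mathrm{id}$, and vertical composition $\bullet$ (also written as a fraction), with identities $\mathrm{Id}$, are functorial for transversal composition, and associative and unitary up to coherent special transversal isomorphisms. Horizontal sources and targets strictly preserve the vertical structure and conversely. There are natural special cubes, the interchangers $$\chi:\frac{\alpha|\beta}{\bar\alpha|\bar\beta}\to\left.\frac{\alpha}{\bar\alpha}\right|\frac{\beta}{\bar\beta},\quad \delta:\mathrm{Id}_{h\circ h'}\to\mathrm{Id}_h|\mathrm{Id}_{h'},\quad \mu:\frac{\mathrm{id}_v}{\mathrm{id}_{v'}}\to\mathrm{id}_{v\bullet v'},\quad \tau:\mathrm{Id}_{\mathrm{id}_A}\to\mathrm{id}_{\mathrm{Id}_A},$$ such that the horizontal composition and identities become lax functors for the vertical structure, and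 the horizontal associativity and unit constraints become transformations between these lax functors. (A cube is special if its horizontal and vertical faces are transversal identities.) **Theorem.** For every true Gray category $\mathcal A$, the following three constructions $\mathsf A_l,\mathsf A_c,\mathsf A_s$ are intercategories. In all three, the objects are those of $\mathcal A$, transversal arrows and horizontal and vertical cells are identities, and transversal composition of cubes is composition of 3-cells in the homs along 2-cells. * $\mathsf A_l$ (lax): horizontal arrows are the 1-cells, vertical arrows are identities, basic cells are the 2-cells, cubes are the 3-cells. Vertical composition is composition in the homs. Horizontal composition is $\alpha\circ\beta=\alpha h\cdot g\beta$ for $\alpha:f\to g$, $\beta:h\to k$, and likewise for cubes. For $\alpha:f\to g$, $\bar\alpha:g\to l$, $\beta:h\to k$, $\bar\beta:k\to m$, $\chi=\alpha h\cdot\gamma(\bar\alpha,\beta)\cdot l\bar\beta$. * $\mathsf A_c$ (colax): vertical arrows are the 1-cells, horizontal arrows are identities, basic cells are the 2-cells, cubes are the 3-cells. Horizontal composition is composition in the homs. Vertical composition is $\alpha\bullet\beta=f\beta\cdot\alpha k$ for $\alpha:f\to g$, $\beta:h\to k$, and likewise for cubes. For horizontally adjacent $\alpha:f\to g$, $\beta:g\to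 l$ above $\bar\alpha:h\to k$, $\bar\beta:k\to m$, $\chi=f\bar\alpha\cdot\gamma(\alpha,\bar\beta)\cdot\beta m$. * $\mathsf A_s$ (symmetric): horizontal and vertical arrows are the 1-cells; basic cells with top $f$, left side $k$, right side $k'$ and bottom $g$ are the 2-cells $\alpha:kg\to fk'$ (quintets); cubes are the 3-cells between quintets with the same boundary. Horizontal composition is $\alpha\circ\alpha'=\alpha g'\cdot f\alpha'$ for $\alpha':k'g'\to f'k''$. Vertical composition is $\alpha\bullet\beta=k\beta\cdot\alpha l'$ for $\beta:lh\to gl'$. The same formulas apply to cubes. With moreover $\beta':l'h'\to g'l''$, $$\chi=k\beta h'\cdot\gamma(\alpha,\beta')\cdot f\alpha'l'' :\ \frac{\alpha|\alpha'}{\beta|\beta'}\to\left.\frac{\alpha}{\beta}\right|\frac{\alpha'}{\beta'}.$$ All three satisfy: (a) transversal arrows and horizontal and vertical cells are identities; (b) all composites are strictly unitary and associative (and the associativity and unit constraints are identities); (c) the degenerate interchangers $\delta,\mu,\tau$ are identities, i.e. the intercategory is chiral. Moreover, for $\chi:\frac{\alpha|\beta}{\bar\alpha|\bar\beta}\to\left.\frac{\alpha}{\bar\alpha}\right|\frac{\beta}{\bar\beta}$: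 (1) In $\mathsf A_l$: (d) vertical arrows are identities; (e) $\chi$ is an identity if $\beta$ or $\bar\alpha$ is a vertical identity $\mathrm{Id}$. (2) In $\mathsf A_c$: (d) horizontal arrows are identities; (e) $\chi$ is an identity if $\alpha$ or $\bar\beta$ is a horizontal identity $\mathrm{id}$. (3) In $\mathsf A_s$: (d) there is a bijection $v\mapsto v_*$ from vertical to horizontal arrows, preserving source and target (it is the identity on 1-cells of $\mathcal A$), and for each vertical $v:A\to B$ there are basic cells (given by the identity 2-cell of $v$) $\epsilon_v$, with top $v_*$, left $v$, right $\mathrm{Id}_B$, bottom $\mathrm{id}_B$, and $\eta_v$, with top $\mathrm{id}_A$, left $\mathrm{Id}_A$, right $v$, bottom $v_*$, such that (i) $\eta_v|\epsilon_v=\mathrm{Id}_{v_*}$; (ii) $\dfrac{\eta_v}{\epsilon_v}=\mathrm{id}_v$; (iii) $(\mathrm{Id}_A)_*=\mathrm{id}_A$ and $\epsilon_{\mathrm{Id}_A}=\eta_{\mathrm{Id}_A}=\mathrm{Id}_{\mathrm{id}_A}$; (iv) $(v\bullet w)_*=v_*\circ w_*$, $\ \dfrac{\epsilon_v|\mathrm{Id}_{w_*}}{\mathrm{id}_w|\epsilon_w}=\epsilon_{v\bullet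 w}$ and $\dfrac{\eta_v|\mathrm{id}_v}{\mathrm{Id}_{v_*}|\eta_w}=\eta_{v\bullet w}$; (e) $\chi$ is an identity if $\alpha$ or $\bar\beta$ is a commutativity cell. Here a basic cell $\alpha$ with top $f$, left $v$, right $w$, bottom $g$ is a *commutativity cell* if $f\circ w_*=v_*\circ g$ and $\eta_v|\alpha|\epsilon_w=\mathrm{Id}_{f\circ w_*}$. -/

import Mathlib

/-!
Conventions.  Categories, 2-categories and intercategories are presented as internal structures in
sets: a type of cells of each kind, functions giving domains and codomains, and composition
operations.  In this way every equation between cells, in particular every strictness assertion,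
is an ordinary equality.  A composition operation is written as a total function; its value on a
non-composable pair carries no meaning, and laws are only ever required of composable cells.

All composites are written in diagrammatic order.
-/

universe u v u₁ u₂ u₃ u₄

/-! ### Small 2-categories and Gray functors of two variables -/

/-- A small (strict) 2-category. -/
structure TwoCat where
  /-- objects -/
  C0 : Type v
  /-- arrows -/
  C1 : Type v
  /-- 2-cells -/
  C2 : Type v
  src₁ : C1 → C0
  tgt₁ : C1 → C0
  src₂ : C2 → C1
  tgt₂ : C2 → C1
  id₁ : C0 → C1
  id₂ : C1 → C2
  /-- composition of arrows -/
  comp : C1 → C1 → C1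
  /-- composition of 2-cells along a common arrow -/
  vcomp : C2 → C2 → C2
  /-- composition of 2-cells along a common object -/
  hcomp : C2 → C2 → C2
  src_src : ∀ x, src₁ (src₂ x) = src₁ (tgt₂ x)
  tgt_tgt : ∀ x, tgt₁ (src₂ x) = tgt₁ (tgt₂ x)
  src_id₁ : ∀ a, src₁ (id₁ a) = a
  tgt_id₁ : ∀ a, tgt₁ (id₁ a) = a
  src_comp : ∀ f g, tgt₁ f = src₁ g → src₁ (comp f g) = src₁ f
  tgt_comp : ∀ f g, tgt₁ f = src₁ g → tgt₁ (comp f g) = tgt₁ g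
  id_comp : ∀ f, comp (id₁ (src₁ f)) f = f
  comp_id : ∀ f, comp f (id₁ (tgt₁ f)) = f
  comp_assoc : ∀ f g h, tgt₁ f = src₁ g → tgt₁ g = src₁ h →
    comp (comp f g) h = comp f (comp g h)
  src_id₂ : ∀ f, src₂ (id₂ f) = f
  tgt_id₂ : ∀ f, tgt₂ (id₂ f) = f
  src_vcomp : ∀ x y, tgt₂ x = src₂ y → src₂ (vcomp x y) = src₂ x
  tgt_vcomp : ∀ x y, tgt₂ x = src₂ y → tgt₂ (vcomp x y) = tgt₂ y
  id_vcomp : ∀ x, vcomp (id₂ (src₂ x)) x = x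
  vcomp_id : ∀ x, vcomp x (id₂ (tgt₂ x)) = x
  vcomp_assoc : ∀ x y z, tgt₂ x = src₂ y → tgt₂ y = src₂ z →
    vcomp (vcomp x y) z = vcomp x (vcomp y z)
  src_hcomp : ∀ x y, tgt₁ (src₂ x) = src₁ (src₂ y) →
    src₂ (hcomp x y) = comp (src₂ x) (src₂ y)
  tgt_hcomp : ∀ x y, tgt₁ (src₂ x) = src₁ (src₂ y) →
    tgt₂ (hcomp x y) = comp (tgt₂ x) (tgt₂ y)
  hcomp_id₂ : ∀ f g, tgt₁ f = src₁ g → hcomp (id₂ f) (id₂ g) = id₂ (comp f g)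
  id_hcomp : ∀ x, hcomp (id₂ (id₁ (src₁ (src₂ x)))) x = x
  hcomp_id : ∀ x, hcomp x (id₂ (id₁ (tgt₁ (src₂ x)))) = x
  hcomp_assoc : ∀ x y z, tgt₁ (src₂ x) = src₁ (src₂ y) → tgt₁ (src₂ y) = src₁ (src₂ z) →
    hcomp (hcomp x y) z = hcomp x (hcomp y z)
  interchange : ∀ x x' y y', tgt₂ x = src₂ x' → tgt₂ y = src₂ y' →
    tgt₁ (src₂ x) = src₁ (src₂ y) →
    hcomp (vcomp x x') (vcomp y y') = vcomp (hcomp x y) (hcomp x' y')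

/-- The three maps `F0`, `F1`, `F2` on objects, arrows and 2-cells form a 2-functor. -/
structure IsTwoFunctor (A B : TwoCat.{v}) (F0 : A.C0 → B.C0) (F1 : A.C1 → B.C1)
    (F2 : A.C2 → B.C2) : Prop where
  src₁ : ∀ f, B.src₁ (F1 f) = F0 (A.src₁ f)
  tgt₁ : ∀ f, B.tgt₁ (F1 f) = F0 (A.tgt₁ f)
  src₂ : ∀ x, B.src₂ (F2 x) = F1 (A.src₂ x)
  tgt₂ : ∀ x, B.tgt₂ (F2 x) = F1 (A.tgt₂ x)
  id₁ : ∀ a, F1 (A.id₁ a) = B.id₁ (F0 a)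
  id₂ : ∀ f, F2 (A.id₂ f) = B.id₂ (F1 f)
  comp : ∀ f g, A.tgt₁ f = A.src₁ g → F1 (A.comp f g) = B.comp (F1 f) (F1 g)
  vcomp : ∀ x y, A.tgt₂ x = A.src₂ y → F2 (A.vcomp x y) = B.vcomp (F2 x) (F2 y)
  hcomp : ∀ x y, A.tgt₁ (A.src₂ x) = A.src₁ (A.src₂ y) →
    F2 (A.hcomp x y) = B.hcomp (F2 x) (F2 y)

/-- A Gray functor of two variables `H : A × B → C`, that is, a 2-functor `A ⊗ B → C` on Gray's
(lax) tensor product, equivalently a 2-functor from `B` to the 2-category of 2-functors `A → C`,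
lax transformations and modifications.  Here `ob a b = H(a,b)`, the maps `L₁ f b = H(f,b)` and
`L₂ φ b = H(φ,b)` are the action in the first variable, `R₁ a g = H(a,g)` and `R₂ a ψ = H(a,ψ)`
the action in the second variable, and
`γ f g : H(a,g) · H(f,b') ⟶ H(f,b) · H(a',g)` for `f : a ⟶ a'`, `g : b ⟶ b'`. -/
structure GrayFunctor (A B C : TwoCat.{v}) where
  ob : A.C0 → B.C0 → C.C0
  L₁ : A.C1 → B.C0 → C.C1
  L₂ : A.C2 → B.C0 → C.C2
  R₁ : A.C0 → B.C1 → C.C1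
  R₂ : A.C0 → B.C2 → C.C2
  γ : A.C1 → B.C1 → C.C2
  isTwoFunctor_left : ∀ b, IsTwoFunctor A C (fun a => ob a b) (fun f => L₁ f b) (fun x => L₂ x b)
  isTwoFunctor_right : ∀ a, IsTwoFunctor B C (ob a) (R₁ a) (R₂ a)
  src_γ : ∀ f g, C.src₂ (γ f g) = C.comp (R₁ (A.src₁ f) g) (L₁ f (B.tgt₁ g))
  tgt_γ : ∀ f g, C.tgt₂ (γ f g) = C.comp (L₁ f (B.src₁ g)) (R₁ (A.tgt₁ f) g)
  γ_id_left : ∀ a g, γ (A.id₁ a) g = C.id₂ (R₁ a g)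
  γ_id_right : ∀ f b, γ f (B.id₁ b) = C.id₂ (L₁ f b)
  γ_comp_left : ∀ f f' g, A.tgt₁ f = A.src₁ f' →
    γ (A.comp f f') g =
      C.vcomp (C.hcomp (γ f g) (C.id₂ (L₁ f' (B.tgt₁ g))))
        (C.hcomp (C.id₂ (L₁ f (B.src₁ g))) (γ f' g))
  γ_comp_right : ∀ f g g', B.tgt₁ g = B.src₁ g' →
    γ f (B.comp g g') =
      C.vcomp (C.hcomp (C.id₂ (R₁ (A.src₁ f) g)) (γ f g'))
        (C.hcomp (γ f g) (C.id₂ (R₁ (A.tgt₁ f) g')))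
  γ_natural_left : ∀ x g,
    C.vcomp (C.hcomp (C.id₂ (R₁ (A.src₁ (A.src₂ x)) g)) (L₂ x (B.tgt₁ g))) (γ (A.tgt₂ x) g) =
      C.vcomp (γ (A.src₂ x) g) (C.hcomp (L₂ x (B.src₁ g)) (C.id₂ (R₁ (A.tgt₁ (A.src₂ x)) g)))
  γ_natural_right : ∀ f y,
    C.vcomp (C.hcomp (R₂ (A.src₁ f) y) (C.id₂ (L₁ f (B.tgt₁ (B.src₂ y))))) (γ f (B.tgt₂ y)) =
      C.vcomp (γ f (B.src₂ y)) (C.hcomp (C.id₂ (L₁ f (B.src₁ (B.src₂ y)))) (R₂ (A.tgt₁ f) y))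

namespace GrayFunctor

variable {A B C : TwoCat.{v}} (H : GrayFunctor A B C)

theorem src_L₁ (f : A.C1) (b : B.C0) : C.src₁ (H.L₁ f b) = H.ob (A.src₁ f) b :=
  (H.isTwoFunctor_left b).src₁ f

theorem tgt_L₁ (f : A.C1) (b : B.C0) : C.tgt₁ (H.L₁ f b) = H.ob (A.tgt₁ f) b :=
  (H.isTwoFunctor_left b).tgt₁ f

theorem src_L₂ (x : A.C2) (b : B.C0) : C.src₂ (H.L₂ x b) = H.L₁ (A.src₂ x) b :=
  (H.isTwoFunctor_left b).src₂ x

theorem tgt_L₂ (x : A.C2) (b : B.C0) : C.tgt₂ (H.L₂ x b) = H.L₁ (A.tgt₂ x) b :=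
  (H.isTwoFunctor_left b).tgt₂ x

theorem src_R₁ (a : A.C0) (g : B.C1) : C.src₁ (H.R₁ a g) = H.ob a (B.src₁ g) :=
  (H.isTwoFunctor_right a).src₁ g

theorem tgt_R₁ (a : A.C0) (g : B.C1) : C.tgt₁ (H.R₁ a g) = H.ob a (B.tgt₁ g) :=
  (H.isTwoFunctor_right a).tgt₁ g

theorem src_R₂ (a : A.C0) (y : B.C2) : C.src₂ (H.R₂ a y) = H.R₁ a (B.src₂ y) :=
  (H.isTwoFunctor_right a).src₂ y

theorem tgt_R₂ (a : A.C0) (y : B.C2) : C.tgt₂ (H.R₂ a y) = H.R₁ a (B.tgt₂ y) :=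
  (H.isTwoFunctor_right a).tgt₂ y

end GrayFunctor

/-- A true Gray category: a category enriched in 2-categories with Gray's (lax) tensor product.
A composition 2-functor `hom A B ⊗ hom B C → hom A C` is the same as a Gray functor of two
variables.  The unit and associativity axioms of an enriched category are equations between
2-functors out of (iterated) tensor products, and are written here on the cells that generate
these tensor products. -/
structure TrueGrayCat where
  Obj : Type u
  hom : Obj → Obj → TwoCat.{v}
  one : ∀ A, (hom A A).C0
  comp : ∀ {A B C : Obj}, GrayFunctor (hom A B) (hom B C) (hom A C)
  one_ob : ∀ {A B} (f : (hom A B).C0), comp.ob (one A) f = f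
  one_R₁ : ∀ {A B} (α : (hom A B).C1), comp.R₁ (one A) α = α
  one_R₂ : ∀ {A B} (x : (hom A B).C2), comp.R₂ (one A) x = x
  ob_one : ∀ {A B} (f : (hom A B).C0), comp.ob f (one B) = f
  L₁_one : ∀ {A B} (α : (hom A B).C1), comp.L₁ α (one B) = α
  L₂_one : ∀ {A B} (x : (hom A B).C2), comp.L₂ x (one B) = x
  ob_assoc : ∀ {A B C D} (f : (hom A B).C0) (g : (hom B C).C0) (h : (hom C D).C0),
    comp.ob (comp.ob f g) h = comp.ob f (comp.ob g h)
  L₁_L₁ : ∀ {A B C D} (α : (hom A B).C1) (g : (hom B C).C0) (h : (hom C D).C0),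
    comp.L₁ (comp.L₁ α g) h = comp.L₁ α (comp.ob g h)
  L₁_R₁ : ∀ {A B C D} (f : (hom A B).C0) (β : (hom B C).C1) (h : (hom C D).C0),
    comp.L₁ (comp.R₁ f β) h = comp.R₁ f (comp.L₁ β h)
  R₁_ob : ∀ {A B C D} (f : (hom A B).C0) (g : (hom B C).C0) (κ : (hom C D).C1),
    comp.R₁ (comp.ob f g) κ = comp.R₁ f (comp.R₁ g κ)
  L₂_L₂ : ∀ {A B C D} (x : (hom A B).C2) (g : (hom B C).C0) (h : (hom C D).C0),
    comp.L₂ (comp.L₂ x g) h = comp.L₂ x (comp.ob g h)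
  L₂_R₂ : ∀ {A B C D} (f : (hom A B).C0) (y : (hom B C).C2) (h : (hom C D).C0),
    comp.L₂ (comp.R₂ f y) h = comp.R₂ f (comp.L₂ y h)
  R₂_ob : ∀ {A B C D} (f : (hom A B).C0) (g : (hom B C).C0) (z : (hom C D).C2),
    comp.R₂ (comp.ob f g) z = comp.R₂ f (comp.R₂ g z)
  L₂_γ : ∀ {A B C D} (α : (hom A B).C1) (β : (hom B C).C1) (h : (hom C D).C0),
    comp.L₂ (comp.γ α β) h = comp.γ α (comp.L₁ β h)
  γ_L₁ : ∀ {A B C D} (α : (hom A B).C1) (g : (hom B C).C0) (κ : (hom C D).C1),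
    comp.γ (comp.L₁ α g) κ = comp.γ α (comp.R₁ g κ)
  γ_R₁ : ∀ {A B C D} (f : (hom A B).C0) (β : (hom B C).C1) (κ : (hom C D).C1),
    comp.γ (comp.R₁ f β) κ = comp.R₂ f (comp.γ β κ)

/-! ### Categories, functors and pseudocategories in the 2-category of categories -/

/-- The data of a category. -/
structure CatData where
  Ob : Type u
  Mor : Type u
  dom : Mor → Ob
  cod : Mor → Ob
  one : Ob → Mor
  comp : Mor → Mor → Mor

namespace CatData

/-- The composite of three arrows. -/
def comp₃ (C : CatData.{u}) (f g h : C.Mor) : C.Mor := C.comp (C.comp f g) h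

/-- The arrow is an identity. -/
def IsIdentity (C : CatData.{u}) (f : C.Mor) : Prop := ∃ x, f = C.one x

/-- The arrow is an isomorphism. -/
def IsInvertible (C : CatData.{u}) (f : C.Mor) : Prop :=
  ∃ g, C.dom g = C.cod f ∧ C.cod g = C.dom f ∧
    C.comp f g = C.one (C.dom f) ∧ C.comp g f = C.one (C.cod f)

/-- The category laws. -/
structure IsCategory (C : CatData.{u}) : Prop where
  dom_one : ∀ x, C.dom (C.one x) = x
  cod_one : ∀ x, C.cod (C.one x) = x
  dom_comp : ∀ f g, C.cod f = C.dom g → C.dom (C.comp f g) = C.dom f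
  cod_comp : ∀ f g, C.cod f = C.dom g → C.cod (C.comp f g) = C.cod g
  one_comp : ∀ f, C.comp (C.one (C.dom f)) f = f
  comp_one : ∀ f, C.comp f (C.one (C.cod f)) = f
  assoc : ∀ f g h, C.cod f = C.dom g → C.cod g = C.dom h →
    C.comp (C.comp f g) h = C.comp f (C.comp g h)

/-- The discrete category on a type: the arrows are the identities. -/
abbrev discrete (X : Type u) : CatData.{u} where
  Ob := X
  Mor := X
  dom x := x
  cod x := x
  one x := x
  comp x _ := x

end CatData

/-- The data of a functor. -/
structure FunctorData (C : CatData.{u₁}) (D : CatData.{u₂}) where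
  ob : C.Ob → D.Ob
  hom : C.Mor → D.Mor

/-- The functor laws. -/
structure FunctorData.IsFunctor {C : CatData.{u₁}} {D : CatData.{u₂}} (F : FunctorData C D) :
    Prop where
  dom : ∀ f, D.dom (F.hom f) = F.ob (C.dom f)
  cod : ∀ f, D.cod (F.hom f) = F.ob (C.cod f)
  one : ∀ x, F.hom (C.one x) = D.one (F.ob x)
  comp : ∀ f g, C.cod f = C.dom g → F.hom (C.comp f g) = D.comp (F.hom f) (F.hom g)

/-- The data of a pseudocategory in the 2-category of categories, that is, of a weak double
category: a category `C₀` of objects and a category `C₁` of arrows, source, target and unit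
functors, the composition functor on composable pairs of objects (`mul`) and of arrows (`mulHom`)
of `C₁`, and the associativity and unit constraints. -/
structure PseudoCatData (C₀ : CatData.{u₁}) (C₁ : CatData.{u₂}) where
  src : FunctorData C₁ C₀
  tgt : FunctorData C₁ C₀
  unit : FunctorData C₀ C₁
  mul : C₁.Ob → C₁.Ob → C₁.Ob
  mulHom : C₁.Mor → C₁.Mor → C₁.Mor
  /-- `(x y) z ⟶ x (y z)` -/
  assoc : C₁.Ob → C₁.Ob → C₁.Ob → C₁.Mor
  /-- `1 x ⟶ x` -/
  lunit : C₁.Ob → C₁.Mor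
  /-- `x 1 ⟶ x` -/
  runit : C₁.Ob → C₁.Mor

namespace PseudoCatData

variable {C₀ : CatData.{u₁}} {C₁ : CatData.{u₂}}

/-- The laws of a pseudocategory in the 2-category of categories. -/
structure IsPseudoCategory (P : PseudoCatData C₀ C₁) : Prop where
  isCategory₀ : C₀.IsCategory
  isCategory₁ : C₁.IsCategory
  isFunctor_src : P.src.IsFunctor
  isFunctor_tgt : P.tgt.IsFunctor
  isFunctor_unit : P.unit.IsFunctor
  src_unit : ∀ A, P.src.ob (P.unit.ob A) = A
  tgt_unit : ∀ A, P.tgt.ob (P.unit.ob A) = A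
  src_unit_hom : ∀ f, P.src.hom (P.unit.hom f) = f
  tgt_unit_hom : ∀ f, P.tgt.hom (P.unit.hom f) = f
  src_mul : ∀ x y, P.tgt.ob x = P.src.ob y → P.src.ob (P.mul x y) = P.src.ob x
  tgt_mul : ∀ x y, P.tgt.ob x = P.src.ob y → P.tgt.ob (P.mul x y) = P.tgt.ob y
  src_mulHom : ∀ f g, P.tgt.hom f = P.src.hom g → P.src.hom (P.mulHom f g) = P.src.hom f
  tgt_mulHom : ∀ f g, P.tgt.hom f = P.src.hom g → P.tgt.hom (P.mulHom f g) = P.tgt.hom g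
  dom_mulHom : ∀ f g, P.tgt.hom f = P.src.hom g →
    C₁.dom (P.mulHom f g) = P.mul (C₁.dom f) (C₁.dom g)
  cod_mulHom : ∀ f g, P.tgt.hom f = P.src.hom g →
    C₁.cod (P.mulHom f g) = P.mul (C₁.cod f) (C₁.cod g)
  mulHom_one : ∀ x y, P.tgt.ob x = P.src.ob y →
    P.mulHom (C₁.one x) (C₁.one y) = C₁.one (P.mul x y)
  mulHom_comp : ∀ f f' g g', C₁.cod f = C₁.dom f' → C₁.cod g = C₁.dom g' →
    P.tgt.hom f = P.src.hom g → P.tgt.hom f' = P.src.hom g' →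
    P.mulHom (C₁.comp f f') (C₁.comp g g') = C₁.comp (P.mulHom f g) (P.mulHom f' g')
  dom_assoc : ∀ x y z, P.tgt.ob x = P.src.ob y → P.tgt.ob y = P.src.ob z →
    C₁.dom (P.assoc x y z) = P.mul (P.mul x y) z
  cod_assoc : ∀ x y z, P.tgt.ob x = P.src.ob y → P.tgt.ob y = P.src.ob z →
    C₁.cod (P.assoc x y z) = P.mul x (P.mul y z)
  src_assoc : ∀ x y z, P.tgt.ob x = P.src.ob y → P.tgt.ob y = P.src.ob z →
    P.src.hom (P.assoc x y z) = C₀.one (P.src.ob x)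
  tgt_assoc : ∀ x y z, P.tgt.ob x = P.src.ob y → P.tgt.ob y = P.src.ob z →
    P.tgt.hom (P.assoc x y z) = C₀.one (P.tgt.ob z)
  invertible_assoc : ∀ x y z, P.tgt.ob x = P.src.ob y → P.tgt.ob y = P.src.ob z →
    C₁.IsInvertible (P.assoc x y z)
  natural_assoc : ∀ f g h, P.tgt.hom f = P.src.hom g → P.tgt.hom g = P.src.hom h →
    C₁.comp (P.mulHom (P.mulHom f g) h) (P.assoc (C₁.cod f) (C₁.cod g) (C₁.cod h)) =
      C₁.comp (P.assoc (C₁.dom f) (C₁.dom g) (C₁.dom h)) (P.mulHom f (P.mulHom g h))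
  dom_lunit : ∀ x, C₁.dom (P.lunit x) = P.mul (P.unit.ob (P.src.ob x)) x
  cod_lunit : ∀ x, C₁.cod (P.lunit x) = x
  src_lunit : ∀ x, P.src.hom (P.lunit x) = C₀.one (P.src.ob x)
  tgt_lunit : ∀ x, P.tgt.hom (P.lunit x) = C₀.one (P.tgt.ob x)
  invertible_lunit : ∀ x, C₁.IsInvertible (P.lunit x)
  natural_lunit : ∀ f,
    C₁.comp (P.mulHom (P.unit.hom (P.src.hom f)) f) (P.lunit (C₁.cod f)) =
      C₁.comp (P.lunit (C₁.dom f)) f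
  dom_runit : ∀ x, C₁.dom (P.runit x) = P.mul x (P.unit.ob (P.tgt.ob x))
  cod_runit : ∀ x, C₁.cod (P.runit x) = x
  src_runit : ∀ x, P.src.hom (P.runit x) = C₀.one (P.src.ob x)
  tgt_runit : ∀ x, P.tgt.hom (P.runit x) = C₀.one (P.tgt.ob x)
  invertible_runit : ∀ x, C₁.IsInvertible (P.runit x)
  natural_runit : ∀ f,
    C₁.comp (P.mulHom f (P.unit.hom (P.tgt.hom f))) (P.runit (C₁.cod f)) =
      C₁.comp (P.runit (C₁.dom f)) f
  pentagon : ∀ x y z w, P.tgt.ob x = P.src.ob y → P.tgt.ob y = P.src.ob z →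
    P.tgt.ob z = P.src.ob w →
    C₁.comp₃ (P.mulHom (P.assoc x y z) (C₁.one w)) (P.assoc x (P.mul y z) w)
        (P.mulHom (C₁.one x) (P.assoc y z w)) =
      C₁.comp (P.assoc (P.mul x y) z w) (P.assoc x y (P.mul z w))
  triangle : ∀ x y, P.tgt.ob x = P.src.ob y →
    C₁.comp (P.assoc x (P.unit.ob (P.tgt.ob x)) y) (P.mulHom (C₁.one x) (P.lunit y)) =
      P.mulHom (P.runit x) (C₁.one y)

/-- Composition is strictly associative and unitary: the equations hold for objects and arrows of
`C₁`, and the constraints are identities. -/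
structure IsStrict (P : PseudoCatData C₀ C₁) : Prop where
  mul_assoc : ∀ x y z, P.tgt.ob x = P.src.ob y → P.tgt.ob y = P.src.ob z →
    P.mul (P.mul x y) z = P.mul x (P.mul y z)
  mulHom_assoc : ∀ f g h, P.tgt.hom f = P.src.hom g → P.tgt.hom g = P.src.hom h →
    P.mulHom (P.mulHom f g) h = P.mulHom f (P.mulHom g h)
  unit_mul : ∀ x, P.mul (P.unit.ob (P.src.ob x)) x = x
  unit_mulHom : ∀ f, P.mulHom (P.unit.hom (P.src.hom f)) f = f
  mul_unit : ∀ x, P.mul x (P.unit.ob (P.tgt.ob x)) = x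
  mulHom_unit : ∀ f, P.mulHom f (P.unit.hom (P.tgt.hom f)) = f
  assoc_isIdentity : ∀ x y z, P.tgt.ob x = P.src.ob y → P.tgt.ob y = P.src.ob z →
    C₁.IsIdentity (P.assoc x y z)
  lunit_isIdentity : ∀ x, C₁.IsIdentity (P.lunit x)
  runit_isIdentity : ∀ x, C₁.IsIdentity (P.runit x)

/-- Pseudocategory data whose constraints are taken to be identities. -/
abbrev withIdentityConstraints (src tgt : FunctorData C₁ C₀) (unit : FunctorData C₀ C₁)
    (mul : C₁.Ob → C₁.Ob → C₁.Ob) (mulHom : C₁.Mor → C₁.Mor → C₁.Mor) :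
    PseudoCatData C₀ C₁ where
  src := src
  tgt := tgt
  unit := unit
  mul := mul
  mulHom := mulHom
  assoc x y z := C₁.one (mul (mul x y) z)
  lunit x := C₁.one x
  runit x := C₁.one x

/-- The pseudocategory data in which all arrows are identities. -/
abbrev trivial (X : Type u) : PseudoCatData (CatData.discrete X) (CatData.discrete X) :=
  withIdentityConstraints ⟨fun x => x, fun x => x⟩ ⟨fun x => x, fun x => x⟩
    ⟨fun x => x, fun x => x⟩ (fun x _ => x) (fun x _ => x)

/-- `F₀`, `F₁` preserve the structure of weak double categories strictly. -/
structure IsStrictDoubleFunctor {D₀ : CatData.{u₃}} {D₁ : CatData.{u₄}}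
    (P : PseudoCatData C₀ C₁) (Q : PseudoCatData D₀ D₁)
    (F₀ : FunctorData C₀ D₀) (F₁ : FunctorData C₁ D₁) : Prop where
  isFunctor₀ : F₀.IsFunctor
  isFunctor₁ : F₁.IsFunctor
  src : ∀ x, Q.src.ob (F₁.ob x) = F₀.ob (P.src.ob x)
  src_hom : ∀ f, Q.src.hom (F₁.hom f) = F₀.hom (P.src.hom f)
  tgt : ∀ x, Q.tgt.ob (F₁.ob x) = F₀.ob (P.tgt.ob x)
  tgt_hom : ∀ f, Q.tgt.hom (F₁.hom f) = F₀.hom (P.tgt.hom f)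
  unit : ∀ A, F₁.ob (P.unit.ob A) = Q.unit.ob (F₀.ob A)
  unit_hom : ∀ f, F₁.hom (P.unit.hom f) = Q.unit.hom (F₀.hom f)
  mul : ∀ x y, P.tgt.ob x = P.src.ob y → F₁.ob (P.mul x y) = Q.mul (F₁.ob x) (F₁.ob y)
  mulHom : ∀ f g, P.tgt.hom f = P.src.hom g →
    F₁.hom (P.mulHom f g) = Q.mulHom (F₁.hom f) (F₁.hom g)
  assoc : ∀ x y z, P.tgt.ob x = P.src.ob y → P.tgt.ob y = P.src.ob z →
    F₁.hom (P.assoc x y z) = Q.assoc (F₁.ob x) (F₁.ob y) (F₁.ob z)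
  lunit : ∀ x, F₁.hom (P.lunit x) = Q.lunit (F₁.ob x)
  runit : ∀ x, F₁.hom (P.runit x) = Q.runit (F₁.ob x)

end PseudoCatData

/-! ### Intercategories -/

/-- The data of an intercategory (a double pseudocategory in the 2-category of categories).

There are four categories, whose composition is the transversal one:
* `obj`: objects and transversal arrows;
* `hor`: horizontal arrows and horizontal cells;
* `ver`: vertical arrows and vertical cells;
* `bas`: basic cells and cubes.

`H₀` and `H₁` contain the horizontal structure (source, target, identities `id`, composition `∘` or
`|`) of horizontal arrows and cells and of basic cells and cubes; `V₀` and `V₁` contain the vertical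
structure (source, target, identities `Id`, composition `•`) of vertical arrows and cells and of
basic cells and cubes.  So for a basic cell `a`, the left and right vertical arrows are `H₁.src a`
and `H₁.tgt a`, the top and bottom horizontal arrows are `V₁.src a` and `V₁.tgt a`.

The interchangers are the cubes
* `χ a b c d : (a ∘ b) • (c ∘ d) ⟶ (a • c) ∘ (b • d)`,
* `δ h h' : Id (h ∘ h') ⟶ Id h ∘ Id h'`,
* `μ v v' : id v • id v' ⟶ id (v • v')`,
* `τ A : Id (id A) ⟶ id (Id A)`. -/
structure IntercatData where
  obj : CatData.{u₁}
  hor : CatData.{u₂}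
  ver : CatData.{u₃}
  bas : CatData.{u₄}
  H₀ : PseudoCatData obj hor
  V₀ : PseudoCatData obj ver
  H₁ : PseudoCatData ver bas
  V₁ : PseudoCatData hor bas
  χ : bas.Ob → bas.Ob → bas.Ob → bas.Ob → bas.Mor
  δ : hor.Ob → hor.Ob → bas.Mor
  μ : ver.Ob → ver.Ob → bas.Mor
  τ : obj.Ob → bas.Mor

namespace IntercatData

variable (I : IntercatData.{u₁, u₂, u₃, u₄})

/-- Four basic cells fit together as `a` left of `b`, above `c` left of `d`. -/
structure Grid (a b c d : I.bas.Ob) : Prop where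
  top : I.H₁.tgt.ob a = I.H₁.src.ob b
  bottom : I.H₁.tgt.ob c = I.H₁.src.ob d
  left : I.V₁.tgt.ob a = I.V₁.src.ob c
  right : I.V₁.tgt.ob b = I.V₁.src.ob d

/-- Four cubes fit together as `a` left of `b`, above `c` left of `d`. -/
structure GridHom (a b c d : I.bas.Mor) : Prop where
  top : I.H₁.tgt.hom a = I.H₁.src.hom b
  bottom : I.H₁.tgt.hom c = I.H₁.src.hom d
  left : I.V₁.tgt.hom a = I.V₁.src.hom c
  right : I.V₁.tgt.hom b = I.V₁.src.hom d

/-- The cube `x` goes from `a` to `b` and is special: its four horizontal and vertical faces are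
transversal identities. -/
structure IsSpecial (x : I.bas.Mor) (a b : I.bas.Ob) : Prop where
  dom : I.bas.dom x = a
  cod : I.bas.cod x = b
  left : I.H₁.src.hom x = I.ver.one (I.H₁.src.ob a)
  right : I.H₁.tgt.hom x = I.ver.one (I.H₁.tgt.ob a)
  top : I.V₁.src.hom x = I.hor.one (I.V₁.src.ob a)
  bottom : I.V₁.tgt.hom x = I.hor.one (I.V₁.tgt.ob a)

/-- The laws of an intercategory.  Equivalently: vertically, `(obj, ver)` and `(hor, bas)` are weak
double categories, and the horizontal structure is a pseudocategory in the 2-category of weak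
double categories, lax functors and transformations, with strict source and target. -/
structure IsIntercategory : Prop where
  isPseudoCategory_H₀ : I.H₀.IsPseudoCategory
  isPseudoCategory_V₀ : I.V₀.IsPseudoCategory
  isPseudoCategory_H₁ : I.H₁.IsPseudoCategory
  isPseudoCategory_V₁ : I.V₁.IsPseudoCategory
  horizontal_src : I.V₁.IsStrictDoubleFunctor I.V₀ I.H₀.src I.H₁.src
  horizontal_tgt : I.V₁.IsStrictDoubleFunctor I.V₀ I.H₀.tgt I.H₁.tgt
  vertical_src : I.H₁.IsStrictDoubleFunctor I.H₀ I.V₀.src I.V₁.src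
  vertical_tgt : I.H₁.IsStrictDoubleFunctor I.H₀ I.V₀.tgt I.V₁.tgt
  -- domains and codomains of the interchangers
  special_χ : ∀ a b c d, I.Grid a b c d →
    I.IsSpecial (I.χ a b c d) (I.V₁.mul (I.H₁.mul a b) (I.H₁.mul c d))
      (I.H₁.mul (I.V₁.mul a c) (I.V₁.mul b d))
  special_δ : ∀ h h', I.H₀.tgt.ob h = I.H₀.src.ob h' →
    I.IsSpecial (I.δ h h') (I.V₁.unit.ob (I.H₀.mul h h'))
      (I.H₁.mul (I.V₁.unit.ob h) (I.V₁.unit.ob h'))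
  special_μ : ∀ v v', I.V₀.tgt.ob v = I.V₀.src.ob v' →
    I.IsSpecial (I.μ v v') (I.V₁.mul (I.H₁.unit.ob v) (I.H₁.unit.ob v'))
      (I.H₁.unit.ob (I.V₀.mul v v'))
  special_τ : ∀ A,
    I.IsSpecial (I.τ A) (I.V₁.unit.ob (I.H₀.unit.ob A)) (I.H₁.unit.ob (I.V₀.unit.ob A))
  -- naturality of the interchangers
  natural_χ : ∀ x y z w, I.GridHom x y z w →
    I.bas.comp (I.V₁.mulHom (I.H₁.mulHom x y) (I.H₁.mulHom z w))
        (I.χ (I.bas.cod x) (I.bas.cod y) (I.bas.cod z) (I.bas.cod w)) =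
      I.bas.comp (I.χ (I.bas.dom x) (I.bas.dom y) (I.bas.dom z) (I.bas.dom w))
        (I.H₁.mulHom (I.V₁.mulHom x z) (I.V₁.mulHom y w))
  natural_δ : ∀ φ ψ, I.H₀.tgt.hom φ = I.H₀.src.hom ψ →
    I.bas.comp (I.V₁.unit.hom (I.H₀.mulHom φ ψ)) (I.δ (I.hor.cod φ) (I.hor.cod ψ)) =
      I.bas.comp (I.δ (I.hor.dom φ) (I.hor.dom ψ))
        (I.H₁.mulHom (I.V₁.unit.hom φ) (I.V₁.unit.hom ψ))
  natural_μ : ∀ φ ψ, I.V₀.tgt.hom φ = I.V₀.src.hom ψ →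
    I.bas.comp (I.V₁.mulHom (I.H₁.unit.hom φ) (I.H₁.unit.hom ψ))
        (I.μ (I.ver.cod φ) (I.ver.cod ψ)) =
      I.bas.comp (I.μ (I.ver.dom φ) (I.ver.dom ψ)) (I.H₁.unit.hom (I.V₀.mulHom φ ψ))
  natural_τ : ∀ f,
    I.bas.comp (I.V₁.unit.hom (I.H₀.unit.hom f)) (I.τ (I.obj.cod f)) =
      I.bas.comp (I.τ (I.obj.dom f)) (I.H₁.unit.hom (I.V₀.unit.hom f))
  -- horizontal composition is a lax functor for the vertical structure
  χ_vertical_assoc : ∀ a b c d e f, I.Grid a b c d → I.Grid c d e f →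
    I.bas.comp₃ (I.V₁.mulHom (I.χ a b c d) (I.bas.one (I.H₁.mul e f)))
        (I.χ (I.V₁.mul a c) (I.V₁.mul b d) e f)
        (I.H₁.mulHom (I.V₁.assoc a c e) (I.V₁.assoc b d f)) =
      I.bas.comp₃ (I.V₁.assoc (I.H₁.mul a b) (I.H₁.mul c d) (I.H₁.mul e f))
        (I.V₁.mulHom (I.bas.one (I.H₁.mul a b)) (I.χ c d e f))
        (I.χ a b (I.V₁.mul c e) (I.V₁.mul d f))
  χ_δ_left : ∀ a b, I.H₁.tgt.ob a = I.H₁.src.ob b →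
    I.bas.comp₃ (I.V₁.mulHom (I.δ (I.V₁.src.ob a) (I.V₁.src.ob b)) (I.bas.one (I.H₁.mul a b)))
        (I.χ (I.V₁.unit.ob (I.V₁.src.ob a)) (I.V₁.unit.ob (I.V₁.src.ob b)) a b)
        (I.H₁.mulHom (I.V₁.lunit a) (I.V₁.lunit b)) =
      I.V₁.lunit (I.H₁.mul a b)
  χ_δ_right : ∀ a b, I.H₁.tgt.ob a = I.H₁.src.ob b →
    I.bas.comp₃ (I.V₁.mulHom (I.bas.one (I.H₁.mul a b)) (I.δ (I.V₁.tgt.ob a) (I.V₁.tgt.ob b)))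
        (I.χ a b (I.V₁.unit.ob (I.V₁.tgt.ob a)) (I.V₁.unit.ob (I.V₁.tgt.ob b)))
        (I.H₁.mulHom (I.V₁.runit a) (I.V₁.runit b)) =
      I.V₁.runit (I.H₁.mul a b)
  -- the horizontal identity is a lax functor for the vertical structure
  μ_assoc : ∀ v w z, I.V₀.tgt.ob v = I.V₀.src.ob w → I.V₀.tgt.ob w = I.V₀.src.ob z →
    I.bas.comp₃ (I.V₁.mulHom (I.μ v w) (I.bas.one (I.H₁.unit.ob z)))
        (I.μ (I.V₀.mul v w) z) (I.H₁.unit.hom (I.V₀.assoc v w z)) =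
      I.bas.comp₃ (I.V₁.assoc (I.H₁.unit.ob v) (I.H₁.unit.ob w) (I.H₁.unit.ob z))
        (I.V₁.mulHom (I.bas.one (I.H₁.unit.ob v)) (I.μ w z)) (I.μ v (I.V₀.mul w z))
  μ_τ_left : ∀ v,
    I.bas.comp₃ (I.V₁.mulHom (I.τ (I.V₀.src.ob v)) (I.bas.one (I.H₁.unit.ob v)))
        (I.μ (I.V₀.unit.ob (I.V₀.src.ob v)) v) (I.H₁.unit.hom (I.V₀.lunit v)) =
      I.V₁.lunit (I.H₁.unit.ob v)
  μ_τ_right : ∀ v,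
    I.bas.comp₃ (I.V₁.mulHom (I.bas.one (I.H₁.unit.ob v)) (I.τ (I.V₀.tgt.ob v)))
        (I.μ v (I.V₀.unit.ob (I.V₀.tgt.ob v))) (I.H₁.unit.hom (I.V₀.runit v)) =
      I.V₁.runit (I.H₁.unit.ob v)
  -- the horizontal associativity constraint is a transformation of lax functors
  χ_horizontal_assoc : ∀ a b c d e f, I.Grid a b d e → I.Grid b c e f →
    I.bas.comp₃ (I.χ (I.H₁.mul a b) c (I.H₁.mul d e) f)
        (I.H₁.mulHom (I.χ a b d e) (I.bas.one (I.V₁.mul c f)))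
        (I.H₁.assoc (I.V₁.mul a d) (I.V₁.mul b e) (I.V₁.mul c f)) =
      I.bas.comp₃ (I.V₁.mulHom (I.H₁.assoc a b c) (I.H₁.assoc d e f))
        (I.χ a (I.H₁.mul b c) d (I.H₁.mul e f))
        (I.H₁.mulHom (I.bas.one (I.V₁.mul a d)) (I.χ b c e f))
  δ_assoc : ∀ f g h, I.H₀.tgt.ob f = I.H₀.src.ob g → I.H₀.tgt.ob g = I.H₀.src.ob h →
    I.bas.comp₃ (I.δ (I.H₀.mul f g) h)
        (I.H₁.mulHom (I.δ f g) (I.bas.one (I.V₁.unit.ob h)))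
        (I.H₁.assoc (I.V₁.unit.ob f) (I.V₁.unit.ob g) (I.V₁.unit.ob h)) =
      I.bas.comp₃ (I.V₁.unit.hom (I.H₀.assoc f g h)) (I.δ f (I.H₀.mul g h))
        (I.H₁.mulHom (I.bas.one (I.V₁.unit.ob f)) (I.δ g h))
  -- the horizontal unit constraints are transformations of lax functors
  χ_μ_left : ∀ a c, I.V₁.tgt.ob a = I.V₁.src.ob c →
    I.bas.comp₃ (I.χ (I.H₁.unit.ob (I.H₁.src.ob a)) a (I.H₁.unit.ob (I.H₁.src.ob c)) c)
        (I.H₁.mulHom (I.μ (I.H₁.src.ob a) (I.H₁.src.ob c)) (I.bas.one (I.V₁.mul a c)))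
        (I.H₁.lunit (I.V₁.mul a c)) =
      I.V₁.mulHom (I.H₁.lunit a) (I.H₁.lunit c)
  χ_μ_right : ∀ a c, I.V₁.tgt.ob a = I.V₁.src.ob c →
    I.bas.comp₃ (I.χ a (I.H₁.unit.ob (I.H₁.tgt.ob a)) c (I.H₁.unit.ob (I.H₁.tgt.ob c)))
        (I.H₁.mulHom (I.bas.one (I.V₁.mul a c)) (I.μ (I.H₁.tgt.ob a) (I.H₁.tgt.ob c)))
        (I.H₁.runit (I.V₁.mul a c)) =
      I.V₁.mulHom (I.H₁.runit a) (I.H₁.runit c)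
  δ_τ_left : ∀ f,
    I.bas.comp₃ (I.δ (I.H₀.unit.ob (I.H₀.src.ob f)) f)
        (I.H₁.mulHom (I.τ (I.H₀.src.ob f)) (I.bas.one (I.V₁.unit.ob f)))
        (I.H₁.lunit (I.V₁.unit.ob f)) =
      I.V₁.unit.hom (I.H₀.lunit f)
  δ_τ_right : ∀ f,
    I.bas.comp₃ (I.δ f (I.H₀.unit.ob (I.H₀.tgt.ob f)))
        (I.H₁.mulHom (I.bas.one (I.V₁.unit.ob f)) (I.τ (I.H₀.tgt.ob f)))
        (I.H₁.runit (I.V₁.unit.ob f)) =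
      I.V₁.unit.hom (I.H₀.runit f)

/-- Transversal arrows and horizontal and vertical cells are identities. -/
structure HasIdentityCells : Prop where
  transversal : ∀ f, I.obj.IsIdentity f
  horizontal : ∀ φ, I.hor.IsIdentity φ
  vertical : ∀ ψ, I.ver.IsIdentity ψ

/-- Horizontal and vertical composition of arrows, cells and cubes are strictly associative and
unitary. -/
structure HasStrictComposites : Prop where
  H₀ : I.H₀.IsStrict
  V₀ : I.V₀.IsStrict
  H₁ : I.H₁.IsStrict
  V₁ : I.V₁.IsStrict

/-- The degenerate interchangers are identities. -/
structure IsChiral : Prop where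
  δ : ∀ h h', I.H₀.tgt.ob h = I.H₀.src.ob h' → I.bas.IsIdentity (I.δ h h')
  μ : ∀ v v', I.V₀.tgt.ob v = I.V₀.src.ob v' → I.bas.IsIdentity (I.μ v v')
  τ : ∀ A, I.bas.IsIdentity (I.τ A)

/-- A bijection `v ↦ v⋆` from vertical to horizontal arrows with basic cells `ε v` and `η v`. -/
structure ConnectionData where
  star : I.ver.Ob ≃ I.hor.Ob
  ε : I.ver.Ob → I.bas.Ob
  η : I.ver.Ob → I.bas.Ob

variable {I}

namespace ConnectionData

variable (K : I.ConnectionData)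

/-- The boundaries and equations required of `v ↦ v⋆`, `ε` and `η`, for `v : A → B`. -/
structure IsConnection : Prop where
  src_star : ∀ v, I.H₀.src.ob (K.star v) = I.V₀.src.ob v
  tgt_star : ∀ v, I.H₀.tgt.ob (K.star v) = I.V₀.tgt.ob v
  -- `ε v` has top `v⋆`, left `v`, right `Id B`, bottom `id B`
  ε_top : ∀ v, I.V₁.src.ob (K.ε v) = K.star v
  ε_left : ∀ v, I.H₁.src.ob (K.ε v) = v
  ε_right : ∀ v, I.H₁.tgt.ob (K.ε v) = I.V₀.unit.ob (I.V₀.tgt.ob v)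
  ε_bottom : ∀ v, I.V₁.tgt.ob (K.ε v) = I.H₀.unit.ob (I.V₀.tgt.ob v)
  -- `η v` has top `id A`, left `Id A`, right `v`, bottom `v⋆`
  η_top : ∀ v, I.V₁.src.ob (K.η v) = I.H₀.unit.ob (I.V₀.src.ob v)
  η_left : ∀ v, I.H₁.src.ob (K.η v) = I.V₀.unit.ob (I.V₀.src.ob v)
  η_right : ∀ v, I.H₁.tgt.ob (K.η v) = v
  η_bottom : ∀ v, I.V₁.tgt.ob (K.η v) = K.star v
  -- (i)
  η_hcomp_ε : ∀ v, I.H₁.mul (K.η v) (K.ε v) = I.V₁.unit.ob (K.star v)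
  -- (ii)
  η_vcomp_ε : ∀ v, I.V₁.mul (K.η v) (K.ε v) = I.H₁.unit.ob v
  -- (iii)
  star_unit : ∀ A, K.star (I.V₀.unit.ob A) = I.H₀.unit.ob A
  ε_unit : ∀ A, K.ε (I.V₀.unit.ob A) = I.V₁.unit.ob (I.H₀.unit.ob A)
  η_unit : ∀ A, K.η (I.V₀.unit.ob A) = I.V₁.unit.ob (I.H₀.unit.ob A)
  -- (iv)
  star_mul : ∀ v w, I.V₀.tgt.ob v = I.V₀.src.ob w →
    K.star (I.V₀.mul v w) = I.H₀.mul (K.star v) (K.star w)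
  ε_mul : ∀ v w, I.V₀.tgt.ob v = I.V₀.src.ob w →
    I.V₁.mul (I.H₁.mul (K.ε v) (I.V₁.unit.ob (K.star w))) (I.H₁.mul (I.H₁.unit.ob w) (K.ε w)) =
      K.ε (I.V₀.mul v w)
  η_mul : ∀ v w, I.V₀.tgt.ob v = I.V₀.src.ob w →
    I.V₁.mul (I.H₁.mul (K.η v) (I.H₁.unit.ob v)) (I.H₁.mul (I.V₁.unit.ob (K.star v)) (K.η w)) =
      K.η (I.V₀.mul v w)

/-- A basic cell `a` with top `f`, left `v`, right `w` and bottom `g` is a commutativity cell if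
`f ∘ w⋆ = v⋆ ∘ g` and `η v | a | ε w` is the vertical identity cell on this arrow. -/
structure IsCommutativityCell (a : I.bas.Ob) : Prop where
  boundary : I.H₀.mul (I.V₁.src.ob a) (K.star (I.H₁.tgt.ob a)) =
    I.H₀.mul (K.star (I.H₁.src.ob a)) (I.V₁.tgt.ob a)
  cell : I.H₁.mul (I.H₁.mul (K.η (I.H₁.src.ob a)) a) (K.ε (I.H₁.tgt.ob a)) =
    I.V₁.unit.ob (I.H₀.mul (I.V₁.src.ob a) (K.star (I.H₁.tgt.ob a)))

end ConnectionData

end IntercatData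

/-! ### Cells of a true Gray category in all homs at once -/

/-- A cell with its source and target objects: an element of the sum of all `F A B`. -/
structure Cell {O : Type u} (F : O → O → Type v) where
  {src tgt : O}
  val : F src tgt

namespace Cell

variable {O : Type u} {F K : O → O → Type v}

/-- Apply an operation on each `F A B`. -/
def map (op : ∀ {A B}, F A B → K A B) (x : Cell F) : Cell K := ⟨op x.val⟩

/-- Auxiliary to `lift`. -/
def liftAux (op : ∀ {A B}, F A B → F A B → F A B) :
    (x y : Cell F) → x.src = y.src → x.tgt = y.tgt → Cell F
  | ⟨a⟩, ⟨b⟩, rfl, rfl => ⟨op a b⟩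

open Classical in
/-- Apply a binary operation to two cells with the same source and target objects. -/
noncomputable def lift (op : ∀ {A B}, F A B → F A B → F A B) (x y : Cell F) : Cell F :=
  if h : x.src = y.src ∧ x.tgt = y.tgt then liftAux op x y h.1 h.2 else x

/-- Auxiliary to `join`. -/
def joinAux (op : ∀ {A B C}, F A B → F B C → F A C) :
    (x y : Cell F) → x.tgt = y.src → Cell F
  | ⟨a⟩, ⟨b⟩, rfl => ⟨op a b⟩

open Classical in
/-- Apply a binary operation to two cells of which the first ends where the second begins. -/
noncomputable def join (op : ∀ {A B C}, F A B → F B C → F A C) (x y : Cell F) : Cell F :=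
  if h : x.tgt = y.src then joinAux op x y h else x

/-- Auxiliary to `quad`. -/
def quadAux (op : ∀ {A B C}, F A B → F A B → F B C → F B C → K A C) :
    (x x' y y' : Cell F) → x.src = x'.src → x.tgt = x'.tgt → y.src = y'.src → y.tgt = y'.tgt →
      x.tgt = y.src → Cell K
  | ⟨a⟩, ⟨a'⟩, ⟨b⟩, ⟨b'⟩, rfl, rfl, rfl, rfl, rfl => ⟨op a a' b b'⟩

open Classical in
/-- Apply an operation to two cells `x`, `x'` in some `F A B` and two cells `y`, `y'` in some
`F B C`; the value is `junk` if the cells do not fit together. -/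
noncomputable def quad (op : ∀ {A B C}, F A B → F A B → F B C → F B C → K A C) (junk : Cell K)
    (x x' y y' : Cell F) : Cell K :=
  if h : x.src = x'.src ∧ x.tgt = x'.tgt ∧ y.src = y'.src ∧ y.tgt = y'.tgt ∧ x.tgt = y.src then
    quadAux op x x' y y' h.1 h.2.1 h.2.2.1 h.2.2.2.1 h.2.2.2.2
  else junk

end Cell

namespace TrueGrayCat

variable (G : TrueGrayCat.{u, v})

/-- The 1-cells of `G`. -/
abbrev Cell₁ : Type (max u v) := Cell fun A B : G.Obj => (G.hom A B).C0

/-- The 2-cells of `G`. -/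
abbrev Cell₂ : Type (max u v) := Cell fun A B : G.Obj => (G.hom A B).C1

/-- The 3-cells of `G`. -/
abbrev Cell₃ : Type (max u v) := Cell fun A B : G.Obj => (G.hom A B).C2

/-- The category of 2-cells and 3-cells of `G`. -/
noncomputable abbrev cellCat : CatData.{max u v} where
  Ob := G.Cell₂
  Mor := G.Cell₃
  dom := Cell.map (TwoCat.src₂ _)
  cod := Cell.map (TwoCat.tgt₂ _)
  one := Cell.map (TwoCat.id₂ _)
  comp := Cell.lift (TwoCat.vcomp _)

/-- Objects and 1-cells of `G`, with the composition of 1-cells. -/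
noncomputable abbrev arrows :
    PseudoCatData (CatData.discrete G.Obj) (CatData.discrete G.Cell₁) :=
  .withIdentityConstraints ⟨fun f => f.src, fun f => f.src⟩ ⟨fun f => f.tgt, fun f => f.tgt⟩
    ⟨fun A => ⟨G.one A⟩, fun A => ⟨G.one A⟩⟩
    (Cell.join fun f g => G.comp.ob f g) (Cell.join fun f g => G.comp.ob f g)

/-- 1-cells, 2-cells and 3-cells of `G`, with the composition of 2-cells and 3-cells in the hom
2-categories along 1-cells. -/
noncomputable abbrev homs : PseudoCatData (CatData.discrete G.Cell₁) G.cellCat :=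
  .withIdentityConstraints
    ⟨Cell.map (TwoCat.src₁ _), Cell.map fun x => (G.hom _ _).src₁ ((G.hom _ _).src₂ x)⟩
    ⟨Cell.map (TwoCat.tgt₁ _), Cell.map fun x => (G.hom _ _).tgt₁ ((G.hom _ _).src₂ x)⟩
    ⟨Cell.map (TwoCat.id₁ _), Cell.map fun f => (G.hom _ _).id₂ ((G.hom _ _).id₁ f)⟩
    (Cell.lift (TwoCat.comp _)) (Cell.lift (TwoCat.hcomp _))

/-- Objects, 2-cells and 3-cells of `G`, with given composition operations along objects. -/
noncomputable abbrev across 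
    (mul : ∀ {A B C}, (G.hom A B).C1 → (G.hom B C).C1 → (G.hom A C).C1)
    (mulHom : ∀ {A B C}, (G.hom A B).C2 → (G.hom B C).C2 → (G.hom A C).C2) :
    PseudoCatData (CatData.discrete G.Obj) G.cellCat :=
  .withIdentityConstraints ⟨fun x => x.src, fun x => x.src⟩ ⟨fun x => x.tgt, fun x => x.tgt⟩
    ⟨fun A => ⟨(G.hom A A).id₁ (G.one A)⟩, fun A => ⟨(G.hom A A).id₂ ((G.hom A A).id₁ (G.one A))⟩⟩
    (Cell.join mul) (Cell.join mulHom)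

/-! ### The lax case -/

variable {G} in
/-- `α h · g β` for `α : f ⟶ g` and `β : h ⟶ k`. -/
def laxMul {A B C : G.Obj} (α : (G.hom A B).C1) (β : (G.hom B C).C1) : (G.hom A C).C1 :=
  (G.hom A C).comp (G.comp.L₁ α ((G.hom B C).src₁ β)) (G.comp.R₁ ((G.hom A B).tgt₁ α) β)

variable {G} in
/-- The formula for `laxMul`, for 3-cells. -/
def laxMulHom {A B C : G.Obj} (x : (G.hom A B).C2) (y : (G.hom B C).C2) : (G.hom A C).C2 :=
  (G.hom A C).hcomp (G.comp.L₂ x ((G.hom B C).src₁ ((G.hom B C).src₂ y)))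
    (G.comp.R₂ ((G.hom A B).tgt₁ ((G.hom A B).src₂ x)) y)

variable {G} in
/-- `α h · γ(α', β) · l β'` for `α : f ⟶ g`, `α' : g ⟶ l`, `β : h ⟶ k`, `β' : k ⟶ m`. -/
def laxχ {A B C : G.Obj} (α α' : (G.hom A B).C1) (β β' : (G.hom B C).C1) : (G.hom A C).C2 :=
  (G.hom A C).hcomp
    ((G.hom A C).hcomp ((G.hom A C).id₂ (G.comp.L₁ α ((G.hom B C).src₁ β))) (G.comp.γ α' β))
    ((G.hom A C).id₂ (G.comp.R₁ ((G.hom A B).tgt₁ α') β'))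

/-- The intercategory `A_l` of a true Gray category.  Horizontal arrows are the 1-cells, basic cells
the 2-cells, cubes the 3-cells; transversal and vertical arrows and horizontal and vertical cells are
identities. -/
noncomputable abbrev lax : IntercatData.{u, max u v, u, max u v} where
  obj := CatData.discrete G.Obj
  hor := CatData.discrete G.Cell₁
  ver := CatData.discrete G.Obj
  bas := G.cellCat
  H₀ := G.arrows
  V₀ := PseudoCatData.trivial G.Obj
  H₁ := G.across laxMul laxMulHom
  V₁ := G.homs
  χ a b c d := Cell.quad laxχ (G.cellCat.one a) a c b d
  δ f g := G.cellCat.one (G.homs.unit.ob (G.arrows.mul f g))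
  μ A _ := G.cellCat.one ((G.across laxMul laxMulHom).unit.ob A)
  τ A := G.cellCat.one ((G.across laxMul laxMulHom).unit.ob A)

/-! ### The colax case -/

variable {G} in
/-- `f β · α k` for `α : f ⟶ g` and `β : h ⟶ k`. -/
def colaxMul {A B C : G.Obj} (α : (G.hom A B).C1) (β : (G.hom B C).C1) : (G.hom A C).C1 :=
  (G.hom A C).comp (G.comp.R₁ ((G.hom A B).src₁ α) β) (G.comp.L₁ α ((G.hom B C).tgt₁ β))

variable {G} in
/-- The formula for `colaxMul`, for 3-cells. -/
def colaxMulHom {A B C : G.Obj} (x : (G.hom A B).C2) (y : (G.hom B C).C2) : (G.hom A C).C2 :=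
  (G.hom A C).hcomp (G.comp.R₂ ((G.hom A B).src₁ ((G.hom A B).src₂ x)) y)
    (G.comp.L₂ x ((G.hom B C).tgt₁ ((G.hom B C).src₂ y)))

variable {G} in
/-- `f β · γ(α, β') · α' m` for `α : f ⟶ g`, `α' : g ⟶ l`, `β : h ⟶ k`, `β' : k ⟶ m`. -/
def colaxχ {A B C : G.Obj} (α α' : (G.hom A B).C1) (β β' : (G.hom B C).C1) : (G.hom A C).C2 :=
  (G.hom A C).hcomp
    ((G.hom A C).hcomp ((G.hom A C).id₂ (G.comp.R₁ ((G.hom A B).src₁ α) β)) (G.comp.γ α β'))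
    ((G.hom A C).id₂ (G.comp.L₁ α' ((G.hom B C).tgt₁ β')))

/-- The intercategory `A_c` of a true Gray category.  Vertical arrows are the 1-cells, basic cells
the 2-cells, cubes the 3-cells; transversal and horizontal arrows and horizontal and vertical cells
are identities. -/
noncomputable abbrev colax : IntercatData.{u, u, max u v, max u v} where
  obj := CatData.discrete G.Obj
  hor := CatData.discrete G.Obj
  ver := CatData.discrete G.Cell₁
  bas := G.cellCat
  H₀ := PseudoCatData.trivial G.Obj
  V₀ := G.arrows
  H₁ := G.homs
  V₁ := G.across colaxMul colaxMulHom
  χ a b c d := Cell.quad colaxχ (G.cellCat.one a) a b c d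
  δ A _ := G.cellCat.one ((G.across colaxMul colaxMulHom).unit.ob A)
  μ f g := G.cellCat.one (G.homs.unit.ob (G.arrows.mul f g))
  τ A := G.cellCat.one ((G.across colaxMul colaxMulHom).unit.ob A)

/-! ### The symmetric case -/

/-- A square of 1-cells with corners `A`, `A'` (top) and `B`, `B'` (bottom). -/
structure Frame where
  {A A' B B' : G.Obj}
  top : (G.hom A A').C0
  left : (G.hom A B).C0
  right : (G.hom A' B').C0
  bot : (G.hom B B').C0

/-- A quintet: a square of 1-cells with a 2-cell `left · bot ⟶ top · right`. -/
structure Quintet where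
  frame : G.Frame
  cell : (G.hom frame.A frame.B').C1
  src_cell : (G.hom _ _).src₁ cell = G.comp.ob frame.left frame.bot
  tgt_cell : (G.hom _ _).tgt₁ cell = G.comp.ob frame.top frame.right

/-- A 3-cell between quintets on the same square of 1-cells. -/
structure Quintet₃ where
  frame : G.Frame
  cell : (G.hom frame.A frame.B').C2
  src_cell : (G.hom _ _).src₁ ((G.hom _ _).src₂ cell) = G.comp.ob frame.left frame.bot
  tgt_cell : (G.hom _ _).tgt₁ ((G.hom _ _).src₂ cell) = G.comp.ob frame.top frame.right

namespace Frame

variable {G} (F : G.Frame)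

/-- The top 1-cell. -/
def topCell : G.Cell₁ := ⟨F.top⟩
/-- The left 1-cell. -/
def leftCell : G.Cell₁ := ⟨F.left⟩
/-- The right 1-cell. -/
def rightCell : G.Cell₁ := ⟨F.right⟩
/-- The bottom 1-cell. -/
def botCell : G.Cell₁ := ⟨F.bot⟩

end Frame

section

variable {G} {A A' A'' B B' B'' C C' C'' : G.Obj}

theorem src_hquint {f : (G.hom A A').C0} {k : (G.hom A B).C0} {k' : (G.hom A' B').C0}
    {g : (G.hom B B').C0} {g' : (G.hom B' B'').C0} {α : (G.hom A B').C1} {α' : (G.hom A' B'').C1}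
    (p : (G.hom A B').src₁ α = G.comp.ob k g) (q : (G.hom A B').tgt₁ α = G.comp.ob f k')
    (p' : (G.hom A' B'').src₁ α' = G.comp.ob k' g') :
    (G.hom A B'').src₁ ((G.hom A B'').comp (G.comp.L₁ α g') (G.comp.R₁ f α')) =
      G.comp.ob k (G.comp.ob g g') := by
  rw [TwoCat.src_comp, GrayFunctor.src_L₁, p, G.ob_assoc]
  rw [GrayFunctor.tgt_L₁, GrayFunctor.src_R₁, q, p', G.ob_assoc]

theorem tgt_hquint {f : (G.hom A A').C0} {k' : (G.hom A' B').C0} {f' : (G.hom A' A'').C0}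
    {k'' : (G.hom A'' B'').C0} {g' : (G.hom B' B'').C0}
    {α : (G.hom A B').C1} {α' : (G.hom A' B'').C1}
    (q : (G.hom A B').tgt₁ α = G.comp.ob f k') (p' : (G.hom A' B'').src₁ α' = G.comp.ob k' g')
    (q' : (G.hom A' B'').tgt₁ α' = G.comp.ob f' k'') :
    (G.hom A B'').tgt₁ ((G.hom A B'').comp (G.comp.L₁ α g') (G.comp.R₁ f α')) =
      G.comp.ob (G.comp.ob f f') k'' := by
  rw [TwoCat.tgt_comp, GrayFunctor.tgt_R₁, q', G.ob_assoc]
  rw [GrayFunctor.tgt_L₁, GrayFunctor.src_R₁, q, p', G.ob_assoc]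

theorem src_vquint {k : (G.hom A B).C0} {l : (G.hom B C).C0} {l' : (G.hom B' C').C0}
    {g : (G.hom B B').C0} {h : (G.hom C C').C0} {α : (G.hom A B').C1} {β : (G.hom B C').C1}
    (p : (G.hom A B').src₁ α = G.comp.ob k g) (p' : (G.hom B C').src₁ β = G.comp.ob l h)
    (q' : (G.hom B C').tgt₁ β = G.comp.ob g l') :
    (G.hom A C').src₁ ((G.hom A C').comp (G.comp.R₁ k β) (G.comp.L₁ α l')) =
      G.comp.ob (G.comp.ob k l) h := by
  rw [TwoCat.src_comp, GrayFunctor.src_R₁, p', G.ob_assoc]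
  rw [GrayFunctor.tgt_R₁, GrayFunctor.src_L₁, p, q', G.ob_assoc]

theorem tgt_vquint {f : (G.hom A A').C0} {k : (G.hom A B).C0} {k' : (G.hom A' B').C0}
    {l' : (G.hom B' C').C0} {g : (G.hom B B').C0}
    {α : (G.hom A B').C1} {β : (G.hom B C').C1}
    (p : (G.hom A B').src₁ α = G.comp.ob k g) (q : (G.hom A B').tgt₁ α = G.comp.ob f k')
    (q' : (G.hom B C').tgt₁ β = G.comp.ob g l') :
    (G.hom A C').tgt₁ ((G.hom A C').comp (G.comp.R₁ k β) (G.comp.L₁ α l')) =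
      G.comp.ob f (G.comp.ob k' l') := by
  rw [TwoCat.tgt_comp, GrayFunctor.tgt_L₁, q, G.ob_assoc]
  rw [GrayFunctor.tgt_R₁, GrayFunctor.src_L₁, p, q', G.ob_assoc]

theorem src_hquint₃ {f : (G.hom A A').C0} {k' : (G.hom A' B').C0} {g' : (G.hom B' B'').C0}
    {x : (G.hom A B').C2} {x' : (G.hom A' B'').C2}
    (q : (G.hom A B').tgt₁ ((G.hom A B').src₂ x) = G.comp.ob f k')
    (p' : (G.hom A' B'').src₁ ((G.hom A' B'').src₂ x') = G.comp.ob k' g') :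
    (G.hom A B'').src₂ ((G.hom A B'').hcomp (G.comp.L₂ x g') (G.comp.R₂ f x')) =
      (G.hom A B'').comp (G.comp.L₁ ((G.hom A B').src₂ x) g')
        (G.comp.R₁ f ((G.hom A' B'').src₂ x')) := by
  rw [TwoCat.src_hcomp, GrayFunctor.src_L₂, GrayFunctor.src_R₂]
  rw [GrayFunctor.src_L₂, GrayFunctor.src_R₂, GrayFunctor.tgt_L₁, GrayFunctor.src_R₁, q, p',
    G.ob_assoc]

theorem src_vquint₃ {k : (G.hom A B).C0} {l' : (G.hom B' C').C0} {g : (G.hom B B').C0}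
    {x : (G.hom A B').C2} {y : (G.hom B C').C2}
    (p : (G.hom A B').src₁ ((G.hom A B').src₂ x) = G.comp.ob k g)
    (q' : (G.hom B C').tgt₁ ((G.hom B C').src₂ y) = G.comp.ob g l') :
    (G.hom A C').src₂ ((G.hom A C').hcomp (G.comp.R₂ k y) (G.comp.L₂ x l')) =
      (G.hom A C').comp (G.comp.R₁ k ((G.hom B C').src₂ y))
        (G.comp.L₁ ((G.hom A B').src₂ x) l') := by
  rw [TwoCat.src_hcomp, GrayFunctor.src_R₂, GrayFunctor.src_L₂]
  rw [GrayFunctor.src_R₂, GrayFunctor.src_L₂, GrayFunctor.tgt_R₁, GrayFunctor.src_L₁, p, q',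
    G.ob_assoc]

/-- `k β h' · γ(α, β') · f α' l''`, the interchanger for quintets. -/
def symχ (f : (G.hom A A').C0) (k : (G.hom A B).C0) (h' : (G.hom C' C'').C0)
    (l'' : (G.hom B'' C'').C0) (α : (G.hom A B').C1) (α' : (G.hom A' B'').C1)
    (β : (G.hom B C').C1) (β' : (G.hom B' C'').C1) : (G.hom A C'').C2 :=
  (G.hom A C'').hcomp
    ((G.hom A C'').hcomp ((G.hom A C'').id₂ (G.comp.R₁ k (G.comp.L₁ β h'))) (G.comp.γ α β'))
    ((G.hom A C'').id₂ (G.comp.R₁ f (G.comp.L₁ α' l'')))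

section

variable {f : (G.hom A A').C0} {k : (G.hom A B).C0} {k' : (G.hom A' B').C0}
  {g : (G.hom B B').C0} {α : (G.hom A B').C1}
  {f' : (G.hom A' A'').C0} {k'' : (G.hom A'' B'').C0}
  {g' : (G.hom B' B'').C0} {α' : (G.hom A' B'').C1}
  {l : (G.hom B C).C0} {l' : (G.hom B' C').C0}
  {h : (G.hom C C').C0} {β : (G.hom B C').C1}
  {l'' : (G.hom B'' C'').C0} {h' : (G.hom C' C'').C0} {β' : (G.hom B' C'').C1}

theorem src_symχ (p : (G.hom A B').src₁ α = G.comp.ob k g)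
    (q : (G.hom A B').tgt₁ α = G.comp.ob f k') (p' : (G.hom A' B'').src₁ α' = G.comp.ob k' g')
    (s : (G.hom B C').tgt₁ β = G.comp.ob g l')
    (r' : (G.hom B' C'').src₁ β' = G.comp.ob l' h')
    (s' : (G.hom B' C'').tgt₁ β' = G.comp.ob g' l'') :
    (G.hom A C'').src₂ (symχ f k h' l'' α α' β β') =
        (G.hom A C'').comp (G.comp.R₁ k (G.comp.L₁ β h'))
          ((G.hom A C'').comp ((G.hom A C'').comp (G.comp.R₁ (G.comp.ob k g) β')
            (G.comp.L₁ α (G.comp.ob g' l''))) (G.comp.R₁ f (G.comp.L₁ α' l''))) ∧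
      (G.hom A C'').tgt₁ (G.comp.R₁ k (G.comp.L₁ β h')) =
        (G.hom A C'').src₁ (G.comp.R₁ (G.comp.ob k g) β') ∧
      (G.hom A C'').tgt₁ (G.comp.R₁ (G.comp.ob k g) β') =
        (G.hom A C'').src₁ (G.comp.L₁ α (G.comp.ob g' l'')) ∧
      (G.hom A C'').tgt₁ (G.comp.L₁ α (G.comp.ob g' l'')) =
        (G.hom A C'').src₁ (G.comp.R₁ f (G.comp.L₁ α' l'')) := by
  have e₁ : (G.hom A C'').tgt₁ (G.comp.R₁ k (G.comp.L₁ β h')) =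
      (G.hom A C'').src₁ (G.comp.R₁ (G.comp.ob k g) β') := by
    rw [GrayFunctor.tgt_R₁, GrayFunctor.tgt_L₁, GrayFunctor.src_R₁, s, r']
    simp only [G.ob_assoc]
  have e₂ : (G.hom A C'').tgt₁ (G.comp.R₁ (G.comp.ob k g) β') =
      (G.hom A C'').src₁ (G.comp.L₁ α (G.comp.ob g' l'')) := by
    rw [GrayFunctor.tgt_R₁, GrayFunctor.src_L₁, p, s']
  have e₃ : (G.hom A C'').tgt₁ (G.comp.L₁ α (G.comp.ob g' l'')) =
      (G.hom A C'').src₁ (G.comp.R₁ f (G.comp.L₁ α' l'')) := by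
    rw [GrayFunctor.tgt_L₁, GrayFunctor.src_R₁, GrayFunctor.src_L₁, q, p']
    simp only [G.ob_assoc]
  have e₄ : (G.hom A C'').src₂ (G.comp.γ α β') = (G.hom A C'').comp
      (G.comp.R₁ (G.comp.ob k g) β') (G.comp.L₁ α (G.comp.ob g' l'')) := by
    rw [GrayFunctor.src_γ, p, s']
  have e₅ : (G.hom A C'').tgt₁ ((G.hom A C'').src₂
      ((G.hom A C'').id₂ (G.comp.R₁ k (G.comp.L₁ β h')))) =
      (G.hom A C'').src₁ ((G.hom A C'').src₂ (G.comp.γ α β')) := by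
    rw [TwoCat.src_id₂, e₄, TwoCat.src_comp _ _ _ e₂, e₁]
  refine ⟨?_, e₁, e₂, e₃⟩
  rw [symχ, TwoCat.src_hcomp, TwoCat.src_hcomp _ _ _ e₅, TwoCat.src_id₂, TwoCat.src_id₂, e₄,
    TwoCat.comp_assoc _ _ _ _ (by rw [TwoCat.src_comp _ _ _ e₂, e₁])
      (by rw [TwoCat.tgt_comp _ _ _ e₂, e₃])]
  rw [TwoCat.src_hcomp _ _ _ e₅, TwoCat.src_id₂, TwoCat.src_id₂, e₄,
    TwoCat.tgt_comp _ _ _ (by rw [TwoCat.src_comp _ _ _ e₂, e₁]), TwoCat.tgt_comp _ _ _ e₂, e₃]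

theorem src_src_symχ (p : (G.hom A B').src₁ α = G.comp.ob k g)
    (q : (G.hom A B').tgt₁ α = G.comp.ob f k') (p' : (G.hom A' B'').src₁ α' = G.comp.ob k' g')
    (r : (G.hom B C').src₁ β = G.comp.ob l h) (s : (G.hom B C').tgt₁ β = G.comp.ob g l')
    (r' : (G.hom B' C'').src₁ β' = G.comp.ob l' h')
    (s' : (G.hom B' C'').tgt₁ β' = G.comp.ob g' l'') :
    (G.hom A C'').src₁ ((G.hom A C'').src₂ (symχ f k h' l'' α α' β β')) =
      G.comp.ob (G.comp.ob k l) (G.comp.ob h h') := by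
  obtain ⟨e, e₁, e₂, e₃⟩ := src_symχ p q p' s r' s'
  rw [e, TwoCat.src_comp, GrayFunctor.src_R₁, GrayFunctor.src_L₁, r]
  · simp only [G.ob_assoc]
  · rw [TwoCat.src_comp, TwoCat.src_comp _ _ _ e₂, e₁]
    rw [TwoCat.tgt_comp _ _ _ e₂, e₃]

theorem tgt_src_symχ (p : (G.hom A B').src₁ α = G.comp.ob k g)
    (q : (G.hom A B').tgt₁ α = G.comp.ob f k') (p' : (G.hom A' B'').src₁ α' = G.comp.ob k' g')
    (q' : (G.hom A' B'').tgt₁ α' = G.comp.ob f' k'')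
    (s : (G.hom B C').tgt₁ β = G.comp.ob g l')
    (r' : (G.hom B' C'').src₁ β' = G.comp.ob l' h')
    (s' : (G.hom B' C'').tgt₁ β' = G.comp.ob g' l'') :
    (G.hom A C'').tgt₁ ((G.hom A C'').src₂ (symχ f k h' l'' α α' β β')) =
      G.comp.ob (G.comp.ob f f') (G.comp.ob k'' l'') := by
  obtain ⟨e, e₁, e₂, e₃⟩ := src_symχ p q p' s r' s'
  rw [e, TwoCat.tgt_comp, TwoCat.tgt_comp, GrayFunctor.tgt_R₁, GrayFunctor.tgt_L₁, q']
  · simp only [G.ob_assoc]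
  · rw [TwoCat.tgt_comp _ _ _ e₂, e₃]
  · rw [TwoCat.src_comp, TwoCat.src_comp _ _ _ e₂, e₁]
    rw [TwoCat.tgt_comp _ _ _ e₂, e₃]

end

end

namespace Quintet

variable {G}

/-- Auxiliary to `hmul`:
`k gg' ⟶ f k' g' ⟶ ff' k''` for `α : k g ⟶ f k'` and `α' : k' g' ⟶ f' k''`. -/
def hmulAux : (x y : G.Quintet) → x.frame.rightCell = y.frame.leftCell → G.Quintet
  | ⟨⟨f, k, _, g⟩, α, p, q⟩, ⟨⟨f', _, k'', g'⟩, α', p', q'⟩, rfl =>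
    { frame := ⟨G.comp.ob f f', k, k'', G.comp.ob g g'⟩
      cell := (G.hom _ _).comp (G.comp.L₁ α g') (G.comp.R₁ f α')
      src_cell := src_hquint p q p'
      tgt_cell := tgt_hquint q p' q' }

/-- Auxiliary to `vmul`:
`kl h ⟶ k g l' ⟶ f k'l'` for `α : k g ⟶ f k'` and `β : l h ⟶ g l'`. -/
def vmulAux : (x y : G.Quintet) → x.frame.botCell = y.frame.topCell → G.Quintet
  | ⟨⟨f, k, k', _⟩, α, p, q⟩, ⟨⟨_, l, l', h⟩, β, p', q'⟩, rfl =>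
    { frame := ⟨f, G.comp.ob k l, G.comp.ob k' l', h⟩
      cell := (G.hom _ _).comp (G.comp.R₁ k β) (G.comp.L₁ α l')
      src_cell := src_vquint p p' q'
      tgt_cell := tgt_vquint p q q' }

open Classical in
/-- Horizontal composition of quintets. -/
noncomputable def hmul (x y : G.Quintet) : G.Quintet :=
  if h : x.frame.rightCell = y.frame.leftCell then hmulAux x y h else x

open Classical in
/-- Vertical composition of quintets. -/
noncomputable def vmul (x y : G.Quintet) : G.Quintet :=
  if h : x.frame.botCell = y.frame.topCell then vmulAux x y h else x

/-- The identity 2-cell as a quintet with identities as vertical sides. -/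
def vunit (f : G.Cell₁) : G.Quintet where
  frame := ⟨f.val, G.one _, G.one _, f.val⟩
  cell := (G.hom _ _).id₁ f.val
  src_cell := (TwoCat.src_id₁ _ _).trans (G.one_ob _).symm
  tgt_cell := (TwoCat.tgt_id₁ _ _).trans (G.ob_one _).symm

/-- The identity 2-cell as a quintet with identities as horizontal sides. -/
def hunit (k : G.Cell₁) : G.Quintet where
  frame := ⟨G.one _, k.val, k.val, G.one _⟩
  cell := (G.hom _ _).id₁ k.val
  src_cell := (TwoCat.src_id₁ _ _).trans (G.ob_one _).symm
  tgt_cell := (TwoCat.tgt_id₁ _ _).trans (G.one_ob _).symm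

/-- The identity 2-cell as a quintet with top and left side `v`. -/
def topLeft (v : G.Cell₁) : G.Quintet where
  frame := ⟨v.val, v.val, G.one _, G.one _⟩
  cell := (G.hom _ _).id₁ v.val
  src_cell := (TwoCat.src_id₁ _ _).trans (G.ob_one _).symm
  tgt_cell := (TwoCat.tgt_id₁ _ _).trans (G.ob_one _).symm

/-- The identity 2-cell as a quintet with right side and bottom `v`. -/
def rightBot (v : G.Cell₁) : G.Quintet where
  frame := ⟨G.one _, G.one _, v.val, v.val⟩
  cell := (G.hom _ _).id₁ v.val
  src_cell := (TwoCat.src_id₁ _ _).trans (G.one_ob _).symm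
  tgt_cell := (TwoCat.tgt_id₁ _ _).trans (G.one_ob _).symm

/-- The identity 3-cell of a quintet. -/
def one (x : G.Quintet) : G.Quintet₃ where
  frame := x.frame
  cell := (G.hom _ _).id₂ x.cell
  src_cell := by rw [TwoCat.src_id₂, x.src_cell]
  tgt_cell := by rw [TwoCat.src_id₂, x.tgt_cell]

end Quintet

namespace Quintet₃

variable {G}

/-- The domain of a 3-cell. -/
def dom (x : G.Quintet₃) : G.Quintet where
  frame := x.frame
  cell := (G.hom _ _).src₂ x.cell
  src_cell := x.src_cell
  tgt_cell := x.tgt_cell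

/-- The codomain of a 3-cell. -/
def cod (x : G.Quintet₃) : G.Quintet where
  frame := x.frame
  cell := (G.hom _ _).tgt₂ x.cell
  src_cell := by rw [← TwoCat.src_src, x.src_cell]
  tgt_cell := by rw [← TwoCat.tgt_tgt, x.tgt_cell]

/-- Auxiliary to `tcomp`. -/
def tcompAux : (x y : G.Quintet₃) → x.frame = y.frame → HEq x.cod.cell y.dom.cell → G.Quintet₃
  | ⟨F, x, p, q⟩, ⟨_, y, _, _⟩, rfl, h =>
    { frame := F
      cell := (G.hom _ _).vcomp x y
      src_cell := by rw [TwoCat.src_vcomp _ _ _ (eq_of_heq h), p]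
      tgt_cell := by rw [TwoCat.src_vcomp _ _ _ (eq_of_heq h), q] }

open Classical in
/-- Transversal composition. -/
noncomputable def tcomp (x y : G.Quintet₃) : G.Quintet₃ :=
  if h : x.cod = y.dom then
    tcompAux x y (congrArg Quintet.frame h) (congr_arg_heq Quintet.cell h)
  else x

/-- Auxiliary to `hmul`: the formula for quintets, applied to 3-cells. -/
def hmulAux : (x y : G.Quintet₃) → x.frame.rightCell = y.frame.leftCell → G.Quintet₃
  | ⟨⟨f, k, _, g⟩, x, p, q⟩, ⟨⟨f', _, k'', g'⟩, x', p', q'⟩, rfl =>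
    { frame := ⟨G.comp.ob f f', k, k'', G.comp.ob g g'⟩
      cell := (G.hom _ _).hcomp (G.comp.L₂ x g') (G.comp.R₂ f x')
      src_cell := (congrArg _ (src_hquint₃ q p')).trans (src_hquint p q p')
      tgt_cell := (congrArg _ (src_hquint₃ q p')).trans (tgt_hquint q p' q') }

/-- Auxiliary to `vmul`: the formula for quintets, applied to 3-cells. -/
def vmulAux : (x y : G.Quintet₃) → x.frame.botCell = y.frame.topCell → G.Quintet₃
  | ⟨⟨f, k, k', _⟩, x, p, q⟩, ⟨⟨_, l, l', h⟩, y, p', q'⟩, rfl =>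
    { frame := ⟨f, G.comp.ob k l, G.comp.ob k' l', h⟩
      cell := (G.hom _ _).hcomp (G.comp.R₂ k y) (G.comp.L₂ x l')
      src_cell := (congrArg _ (src_vquint₃ p q')).trans (src_vquint p p' q')
      tgt_cell := (congrArg _ (src_vquint₃ p q')).trans (tgt_vquint p q q') }

open Classical in
/-- Horizontal composition. -/
noncomputable def hmul (x y : G.Quintet₃) : G.Quintet₃ :=
  if h : x.frame.rightCell = y.frame.leftCell then hmulAux x y h else x

open Classical in
/-- Vertical composition. -/
noncomputable def vmul (x y : G.Quintet₃) : G.Quintet₃ :=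
  if h : x.frame.botCell = y.frame.topCell then vmulAux x y h else x

/-- Auxiliary to `χ`: the 3-cell `k β h' · γ(α, β') · f α' l''`, for `α : k g ⟶ f k'`,
`α' : k' g' ⟶ f' k''`, `β : l h ⟶ g l'` and `β' : l' h' ⟶ g' l''`. -/
def χAux : (a a' b b' : G.Quintet) → a.frame.rightCell = a'.frame.leftCell →
    b.frame.rightCell = b'.frame.leftCell → a.frame.botCell = b.frame.topCell →
    a'.frame.botCell = b'.frame.topCell → G.Quintet₃
  | ⟨⟨f, k, _, _⟩, α, p, q⟩, ⟨⟨f', _, k'', _⟩, α', p', q'⟩, ⟨⟨_, l, _, h⟩, β, r, s⟩,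
      ⟨⟨_, _, l'', h'⟩, β', r', s'⟩, rfl, rfl, rfl, rfl =>
    { frame := ⟨G.comp.ob f f', G.comp.ob k l, G.comp.ob k'' l'', G.comp.ob h h'⟩
      cell := symχ f k h' l'' α α' β β'
      src_cell := src_src_symχ p q p' r s r' s'
      tgt_cell := tgt_src_symχ p q p' q' s r' s' }

open Classical in
/-- The interchanger for four quintets, `a` left of `a'`, above `b` left of `b'`. -/
noncomputable def χ (a a' b b' : G.Quintet) : G.Quintet₃ :=
  if h : a.frame.rightCell = a'.frame.leftCell ∧ b.frame.rightCell = b'.frame.leftCell ∧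
      a.frame.botCell = b.frame.topCell ∧ a'.frame.botCell = b'.frame.topCell then
    χAux a a' b b' h.1 h.2.1 h.2.2.1 h.2.2.2
  else a.one

end Quintet₃

/-- The category of quintets and 3-cells between them. -/
noncomputable abbrev quintetCat : CatData.{max u v} where
  Ob := G.Quintet
  Mor := G.Quintet₃
  dom := Quintet₃.dom
  cod := Quintet₃.cod
  one := Quintet.one
  comp := Quintet₃.tcomp

/-- The horizontal structure of quintets. -/
noncomputable abbrev horizontalQuintets : PseudoCatData (CatData.discrete G.Cell₁) G.quintetCat :=
  .withIdentityConstraints ⟨fun x => x.frame.leftCell, fun x => x.frame.leftCell⟩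
    ⟨fun x => x.frame.rightCell, fun x => x.frame.rightCell⟩
    ⟨Quintet.hunit, fun k => (Quintet.hunit k).one⟩ Quintet.hmul Quintet₃.hmul

/-- The vertical structure of quintets. -/
noncomputable abbrev verticalQuintets : PseudoCatData (CatData.discrete G.Cell₁) G.quintetCat :=
  .withIdentityConstraints ⟨fun x => x.frame.topCell, fun x => x.frame.topCell⟩
    ⟨fun x => x.frame.botCell, fun x => x.frame.botCell⟩
    ⟨Quintet.vunit, fun f => (Quintet.vunit f).one⟩ Quintet.vmul Quintet₃.vmul

/-- The intercategory `A_s` of a true Gray category.  Horizontal and vertical arrows are the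
1-cells, basic cells the quintets, cubes the 3-cells between quintets; transversal arrows and
horizontal and vertical cells are identities. -/
noncomputable abbrev sym : IntercatData.{u, max u v, max u v, max u v} where
  obj := CatData.discrete G.Obj
  hor := CatData.discrete G.Cell₁
  ver := CatData.discrete G.Cell₁
  bas := G.quintetCat
  H₀ := G.arrows
  V₀ := G.arrows
  H₁ := G.horizontalQuintets
  V₁ := G.verticalQuintets
  χ := Quintet₃.χ
  δ f g := (Quintet.vunit (G.arrows.mul f g)).one
  μ f g := (Quintet.hunit (G.arrows.mul f g)).one
  τ A := (Quintet.vunit ⟨G.one A⟩).one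

/-- The bijection between vertical and horizontal arrows of `A_s` which is the identity on 1-cells
of `G`; the connecting basic cells contain identity 2-cells. -/
def symConnection : G.sym.ConnectionData where
  star := Equiv.refl G.Cell₁
  ε := Quintet.topLeft
  η := Quintet.rightBot

end TrueGrayCat

/-! ### Internal categories in categories with a discrete category of objects -/

/-! All three structures are as strict as they can be. The hom 2-categories are strict, whiskering
by a 1-cell is 2-functorial, and composition of 1-cells is strictly associative and unitary, so each
composition operation is that of a strict internal category (`PseudoCatData.IsInternalCategory`).
Objects, horizontal arrows and vertical arrows carry discrete categories, and `δ`, `μ`, `τ` are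
identities. The one datum with content is `χ`, which in each case is a single Gray interchanger `γ`
whiskered on both sides by 2-cells. `IntercatData.IsStrictChiral` lists what then has to be checked,
and `IntercatData.IsStrictChiral.isIntercategory` deduces the axioms of an intercategory from this
list.

The conditions on `χ` hold for three reasons. Naturality is the naturality of `γ` in both variables
(`GrayFunctor.γ_natural`) carried through whiskering (`TwoCat.hcomp_whisk_natural`). The unit
conditions, like the further identity conditions on `χ`, put an identity 2-cell into one of the two
arguments of `γ`, and `γ` is then an identity. For the two associativity conditions, compatibility
of `γ` with composition in each variable turns either side into a composite of three whiskered
copies of `γ`. The same three copies occur on both sides, in orders that differ by exchanging two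
neighbours; these two act on adjacent factors of a composite of 2-cells, so they commute by
interchange in the hom 2-category (`TwoCat.whisk_swap`).

In the symmetric case the cells `ε v` and `η v` contain identity 2-cells. Pasting them onto a
quintet leaves its 2-cell unchanged, so the 2-cell of a commutativity cell is an identity and the
argument about `γ` applies again. -/

theorem CatData.isCategory_discrete (X : Type u) : (CatData.discrete X).IsCategory where
  dom_one _ := rfl
  cod_one _ := rfl
  dom_comp _ _ _ := rfl
  cod_comp _ _ h := h
  one_comp _ := rfl
  comp_one _ := rfl
  assoc _ _ _ _ _ := rfl

namespace CatData.IsCategory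

variable {C : CatData.{u}} (hC : C.IsCategory)
include hC

theorem one_comp_of_eq {f : C.Mor} {x : C.Ob} (h : C.dom f = x) : C.comp (C.one x) f = f := by
  rw [← h, hC.one_comp]

theorem comp_one_of_eq {f : C.Mor} {x : C.Ob} (h : C.cod f = x) : C.comp f (C.one x) = f := by
  rw [← h, hC.comp_one]

theorem one_comp_one (x : C.Ob) : C.comp (C.one x) (C.one x) = C.one x :=
  hC.one_comp_of_eq (hC.dom_one x)

theorem isInvertible_one (x : C.Ob) : C.IsInvertible (C.one x) :=
  ⟨C.one x, by simp only [hC.dom_one, hC.cod_one, hC.one_comp_one, and_self]⟩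

theorem eq_one_of_isIdentity {f : C.Mor} (hf : C.IsIdentity f) : f = C.one (C.dom f) := by
  obtain ⟨x, rfl⟩ := hf
  rw [hC.dom_one]

end CatData.IsCategory

namespace PseudoCatData

variable {X : Type u₁} {C : CatData.{u₂}}

/-- A strict category in the 2-category of categories, with a discrete category of objects,
presented as a pseudocategory with identity constraints. -/
structure IsInternalCategory (P : PseudoCatData (CatData.discrete X) C) : Prop where
  isCategory : C.IsCategory
  assoc_eq : ∀ x y z, P.assoc x y z = C.one (P.mul (P.mul x y) z)
  lunit_eq : ∀ x, P.lunit x = C.one x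
  runit_eq : ∀ x, P.runit x = C.one x
  isFunctor_src : P.src.IsFunctor
  isFunctor_tgt : P.tgt.IsFunctor
  isFunctor_unit : P.unit.IsFunctor
  src_unit : ∀ A, P.src.ob (P.unit.ob A) = A
  tgt_unit : ∀ A, P.tgt.ob (P.unit.ob A) = A
  src_mul : ∀ x y, P.tgt.ob x = P.src.ob y → P.src.ob (P.mul x y) = P.src.ob x
  tgt_mul : ∀ x y, P.tgt.ob x = P.src.ob y → P.tgt.ob (P.mul x y) = P.tgt.ob y
  dom_mulHom : ∀ f g, P.tgt.hom f = P.src.hom g →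
    C.dom (P.mulHom f g) = P.mul (C.dom f) (C.dom g)
  cod_mulHom : ∀ f g, P.tgt.hom f = P.src.hom g →
    C.cod (P.mulHom f g) = P.mul (C.cod f) (C.cod g)
  mulHom_one : ∀ x y, P.tgt.ob x = P.src.ob y →
    P.mulHom (C.one x) (C.one y) = C.one (P.mul x y)
  mulHom_comp : ∀ f f' g g', C.cod f = C.dom f' → C.cod g = C.dom g' →
    P.tgt.hom f = P.src.hom g → P.tgt.hom f' = P.src.hom g' →
    P.mulHom (C.comp f f') (C.comp g g') = C.comp (P.mulHom f g) (P.mulHom f' g')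
  mulHom_assoc : ∀ f g h, P.tgt.hom f = P.src.hom g → P.tgt.hom g = P.src.hom h →
    P.mulHom (P.mulHom f g) h = P.mulHom f (P.mulHom g h)
  unit_mulHom : ∀ f, P.mulHom (P.unit.hom (P.src.hom f)) f = f
  mulHom_unit : ∀ f, P.mulHom f (P.unit.hom (P.tgt.hom f)) = f

namespace IsInternalCategory

variable {P : PseudoCatData (CatData.discrete X) C} (hP : P.IsInternalCategory)
include hP

theorem one_injective {x y : C.Ob} (h : C.one x = C.one y) : x = y := by
  rw [← hP.isCategory.dom_one x, h, hP.isCategory.dom_one]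

/-- The category of objects is discrete, so the image of an arrow under the source functor is
already determined by its domain. Face conditions on cubes thereby reduce to face conditions on
basic cells. -/
theorem src_hom (f : C.Mor) : P.src.hom f = P.src.ob (C.dom f) := hP.isFunctor_src.dom f

theorem tgt_hom (f : C.Mor) : P.tgt.hom f = P.tgt.ob (C.dom f) := hP.isFunctor_tgt.dom f

theorem src_dom (f : C.Mor) : P.src.ob (C.dom f) = P.src.hom f := (hP.src_hom f).symm

theorem tgt_dom (f : C.Mor) : P.tgt.ob (C.dom f) = P.tgt.hom f := (hP.tgt_hom f).symm

theorem tgt_cod (f : C.Mor) : P.tgt.ob (C.cod f) = P.tgt.hom f := (hP.isFunctor_tgt.cod f).symm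

theorem unit_hom (x : X) : P.unit.hom x = C.one (P.unit.ob x) := hP.isFunctor_unit.one x

theorem src_one (x : C.Ob) : P.src.hom (C.one x) = P.src.ob x := hP.isFunctor_src.one x

theorem tgt_one (x : C.Ob) : P.tgt.hom (C.one x) = P.tgt.ob x := hP.isFunctor_tgt.one x

theorem src_mulHom (f g : C.Mor) (h : P.tgt.hom f = P.src.hom g) :
    P.src.hom (P.mulHom f g) = P.src.hom f := by
  rw [hP.src_hom, hP.dom_mulHom f g h, hP.src_mul _ _ (by rw [hP.tgt_dom, hP.src_dom, h]),
    hP.src_dom]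

theorem tgt_mulHom (f g : C.Mor) (h : P.tgt.hom f = P.src.hom g) :
    P.tgt.hom (P.mulHom f g) = P.tgt.hom g := by
  rw [hP.tgt_hom, hP.dom_mulHom f g h, hP.tgt_mul _ _ (by rw [hP.tgt_dom, hP.src_dom, h]),
    hP.tgt_dom]

/-- Laws for objects are the laws for arrows evaluated at identity arrows, because `C.one` is
injective. Hence `IsInternalCategory` only has to demand associativity and unitarity of `mulHom`. -/
theorem mul_assoc (x y z : C.Ob) (h : P.tgt.ob x = P.src.ob y) (h' : P.tgt.ob y = P.src.ob z) :
    P.mul (P.mul x y) z = P.mul x (P.mul y z) := by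
  have e := hP.mulHom_assoc (C.one x) (C.one y) (C.one z) (by rw [hP.tgt_one, hP.src_one, h])
    (by rw [hP.tgt_one, hP.src_one, h'])
  rw [hP.mulHom_one _ _ h, hP.mulHom_one _ _ h', hP.mulHom_one _ _ (by rw [hP.tgt_mul _ _ h, h']),
    hP.mulHom_one _ _ (by rw [hP.src_mul _ _ h', h])] at e
  exact hP.one_injective e

theorem unit_mul (x : C.Ob) : P.mul (P.unit.ob (P.src.ob x)) x = x := by
  have e := hP.unit_mulHom (C.one x)
  rw [hP.src_one, hP.unit_hom, hP.mulHom_one _ _ (hP.tgt_unit _)] at e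
  exact hP.one_injective e

theorem mul_unit (x : C.Ob) : P.mul x (P.unit.ob (P.tgt.ob x)) = x := by
  have e := hP.mulHom_unit (C.one x)
  rw [hP.tgt_one, hP.unit_hom, hP.mulHom_one _ _ (hP.src_unit _).symm] at e
  exact hP.one_injective e

theorem isStrict : P.IsStrict where
  mul_assoc := hP.mul_assoc
  mulHom_assoc := hP.mulHom_assoc
  unit_mul := hP.unit_mul
  unit_mulHom := hP.unit_mulHom
  mul_unit := hP.mul_unit
  mulHom_unit := hP.mulHom_unit
  assoc_isIdentity x y z _ _ := ⟨_, hP.assoc_eq x y z⟩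
  lunit_isIdentity x := ⟨_, hP.lunit_eq x⟩
  runit_isIdentity x := ⟨_, hP.runit_eq x⟩

/-- With identity constraints, naturality is strict associativity or unitarity of `mulHom`, and
pentagon and triangle compare composites of identities of the same object. -/
theorem isPseudoCategory : P.IsPseudoCategory where
  isCategory₀ := CatData.isCategory_discrete X
  isCategory₁ := hP.isCategory
  isFunctor_src := hP.isFunctor_src
  isFunctor_tgt := hP.isFunctor_tgt
  isFunctor_unit := hP.isFunctor_unit
  src_unit := hP.src_unit
  tgt_unit := hP.tgt_unit
  src_unit_hom f := by rw [hP.unit_hom, hP.src_one, hP.src_unit]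
  tgt_unit_hom f := by rw [hP.unit_hom, hP.tgt_one, hP.tgt_unit]
  src_mul := hP.src_mul
  tgt_mul := hP.tgt_mul
  src_mulHom := hP.src_mulHom
  tgt_mulHom := hP.tgt_mulHom
  dom_mulHom := hP.dom_mulHom
  cod_mulHom := hP.cod_mulHom
  mulHom_one := hP.mulHom_one
  mulHom_comp := hP.mulHom_comp
  dom_assoc x y z _ _ := by rw [hP.assoc_eq, hP.isCategory.dom_one]
  cod_assoc x y z h h' := by rw [hP.assoc_eq, hP.isCategory.cod_one, hP.mul_assoc _ _ _ h h']
  src_assoc x y z h h' := by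
    rw [hP.assoc_eq, hP.src_one, hP.src_mul _ _ (by rw [hP.tgt_mul _ _ h, h']), hP.src_mul _ _ h]
  tgt_assoc x y z h h' := by
    rw [hP.assoc_eq, hP.tgt_one, hP.tgt_mul _ _ (by rw [hP.tgt_mul _ _ h, h'])]
  invertible_assoc x y z _ _ := by
    rw [hP.assoc_eq]
    exact hP.isCategory.isInvertible_one _
  natural_assoc f g h p q := by
    have p' : P.tgt.hom (P.mulHom f g) = P.src.hom h := by rw [hP.tgt_mulHom _ _ p, q]
    rw [hP.assoc_eq, hP.assoc_eq, hP.isCategory.comp_one_of_eq, hP.isCategory.one_comp_of_eq,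
      hP.mulHom_assoc _ _ _ p q]
    · rw [← hP.mulHom_assoc _ _ _ p q, hP.dom_mulHom _ _ p', hP.dom_mulHom _ _ p]
    · rw [hP.cod_mulHom _ _ p', hP.cod_mulHom _ _ p]
  dom_lunit x := by rw [hP.lunit_eq, hP.isCategory.dom_one, hP.unit_mul]
  cod_lunit x := by rw [hP.lunit_eq, hP.isCategory.cod_one]
  src_lunit x := by rw [hP.lunit_eq, hP.src_one]
  tgt_lunit x := by rw [hP.lunit_eq, hP.tgt_one]
  invertible_lunit x := by
    rw [hP.lunit_eq]
    exact hP.isCategory.isInvertible_one _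
  natural_lunit f := by
    rw [hP.lunit_eq, hP.lunit_eq, hP.unit_mulHom, hP.isCategory.comp_one, hP.isCategory.one_comp]
  dom_runit x := by rw [hP.runit_eq, hP.isCategory.dom_one, hP.mul_unit]
  cod_runit x := by rw [hP.runit_eq, hP.isCategory.cod_one]
  src_runit x := by rw [hP.runit_eq, hP.src_one]
  tgt_runit x := by rw [hP.runit_eq, hP.tgt_one]
  invertible_runit x := by
    rw [hP.runit_eq]
    exact hP.isCategory.isInvertible_one _
  natural_runit f := by
    rw [hP.runit_eq, hP.runit_eq, hP.mulHom_unit, hP.isCategory.comp_one, hP.isCategory.one_comp]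
  pentagon x y z w p q r := by
    have p' : P.tgt.ob (P.mul x y) = P.src.ob z := by rw [hP.tgt_mul _ _ p, q]
    have q' : P.tgt.ob (P.mul y z) = P.src.ob w := by rw [hP.tgt_mul _ _ q, r]
    have r' : P.tgt.ob x = P.src.ob (P.mul y z) := by rw [hP.src_mul _ _ q, p]
    have q'' : P.tgt.ob y = P.src.ob (P.mul z w) := by rw [hP.src_mul _ _ r, q]
    simp only [hP.assoc_eq, CatData.comp₃]
    -- Strict associativity makes all five constraints identities of the one fully right-bracketed
    -- product.
    rw [hP.mulHom_one _ _ (by rw [hP.tgt_mul _ _ p', r]),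
      hP.mulHom_one _ _ (by rw [hP.src_mul _ _ q', r']), hP.mul_assoc x y z p q,
      hP.mul_assoc x _ w r' q', hP.mul_assoc x y _ p q'', hP.mul_assoc y z w q r]
    simp only [hP.isCategory.one_comp_one]
  triangle x y p := by
    simp only [hP.assoc_eq, hP.lunit_eq, hP.runit_eq, hP.mul_unit, hP.mulHom_one _ _ p,
      hP.isCategory.one_comp_one]

end IsInternalCategory

theorem isInternalCategory_trivial (X : Type u) : (trivial X).IsInternalCategory where
  isCategory := CatData.isCategory_discrete X
  assoc_eq _ _ _ := rfl
  lunit_eq _ := rfl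
  runit_eq _ := rfl
  isFunctor_src := ⟨fun _ => rfl, fun _ => rfl, fun _ => rfl, fun _ _ _ => rfl⟩
  isFunctor_tgt := ⟨fun _ => rfl, fun _ => rfl, fun _ => rfl, fun _ _ _ => rfl⟩
  isFunctor_unit := ⟨fun _ => rfl, fun _ => rfl, fun _ => rfl, fun _ _ _ => rfl⟩
  src_unit _ := rfl
  tgt_unit _ := rfl
  src_mul _ _ _ := rfl
  tgt_mul _ _ h := h
  dom_mulHom _ _ _ := rfl
  cod_mulHom _ _ _ := rfl
  mulHom_one _ _ _ := rfl
  mulHom_comp _ _ _ _ _ _ _ _ := rfl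
  mulHom_assoc _ _ _ _ _ := rfl
  unit_mulHom _ := rfl
  mulHom_unit _ := rfl

end PseudoCatData

/-! ### Strict chiral intercategories with identity arrows and cells -/

namespace IntercatData

variable {O : Type u₁} {H : Type u₂} {V : Type u₃} {B : CatData.{u₄}}

/-- Intercategory data whose transversal arrows, horizontal and vertical cells, and degenerate
interchangers are identities. -/
abbrev ofStrict (H₀ : PseudoCatData (CatData.discrete O) (CatData.discrete H))
    (V₀ : PseudoCatData (CatData.discrete O) (CatData.discrete V))
    (H₁ : PseudoCatData (CatData.discrete V) B) (V₁ : PseudoCatData (CatData.discrete H) B)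
    (χ : B.Ob → B.Ob → B.Ob → B.Ob → B.Mor) : IntercatData.{u₁, u₂, u₃, u₄} where
  obj := CatData.discrete O
  hor := CatData.discrete H
  ver := CatData.discrete V
  bas := B
  H₀ := H₀
  V₀ := V₀
  H₁ := H₁
  V₁ := V₁
  χ := χ
  δ f g := B.one (V₁.unit.ob (H₀.mul f g))
  μ v w := B.one (H₁.unit.ob (V₀.mul v w))
  τ A := B.one (V₁.unit.ob (H₀.unit.ob A))

/-- The laws of an intercategory, for data of the form `ofStrict`. -/
structure IsStrictChiral (H₀ : PseudoCatData (CatData.discrete O) (CatData.discrete H))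
    (V₀ : PseudoCatData (CatData.discrete O) (CatData.discrete V))
    (H₁ : PseudoCatData (CatData.discrete V) B) (V₁ : PseudoCatData (CatData.discrete H) B)
    (χ : B.Ob → B.Ob → B.Ob → B.Ob → B.Mor) : Prop where
  internal_H₀ : H₀.IsInternalCategory
  internal_V₀ : V₀.IsInternalCategory
  internal_H₁ : H₁.IsInternalCategory
  internal_V₁ : V₁.IsInternalCategory
  src_src : ∀ a, V₀.src.ob (H₁.src.ob a) = H₀.src.ob (V₁.src.ob a)
  tgt_src : ∀ a, V₀.tgt.ob (H₁.src.ob a) = H₀.src.ob (V₁.tgt.ob a)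
  src_tgt : ∀ a, V₀.src.ob (H₁.tgt.ob a) = H₀.tgt.ob (V₁.src.ob a)
  tgt_tgt : ∀ a, V₀.tgt.ob (H₁.tgt.ob a) = H₀.tgt.ob (V₁.tgt.ob a)
  hsrc_unit : ∀ h, H₁.src.ob (V₁.unit.ob h) = V₀.unit.ob (H₀.src.ob h)
  htgt_unit : ∀ h, H₁.tgt.ob (V₁.unit.ob h) = V₀.unit.ob (H₀.tgt.ob h)
  vsrc_unit : ∀ w, V₁.src.ob (H₁.unit.ob w) = H₀.unit.ob (V₀.src.ob w)
  vtgt_unit : ∀ w, V₁.tgt.ob (H₁.unit.ob w) = H₀.unit.ob (V₀.tgt.ob w)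
  hsrc_mul : ∀ a b, V₁.tgt.ob a = V₁.src.ob b →
    H₁.src.ob (V₁.mul a b) = V₀.mul (H₁.src.ob a) (H₁.src.ob b)
  htgt_mul : ∀ a b, V₁.tgt.ob a = V₁.src.ob b →
    H₁.tgt.ob (V₁.mul a b) = V₀.mul (H₁.tgt.ob a) (H₁.tgt.ob b)
  vsrc_mul : ∀ a b, H₁.tgt.ob a = H₁.src.ob b →
    V₁.src.ob (H₁.mul a b) = H₀.mul (V₁.src.ob a) (V₁.src.ob b)
  vtgt_mul : ∀ a b, H₁.tgt.ob a = H₁.src.ob b →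
    V₁.tgt.ob (H₁.mul a b) = H₀.mul (V₁.tgt.ob a) (V₁.tgt.ob b)
  mul_vunit : ∀ f g, H₀.tgt.ob f = H₀.src.ob g →
    H₁.mul (V₁.unit.ob f) (V₁.unit.ob g) = V₁.unit.ob (H₀.mul f g)
  mul_hunit : ∀ v w, V₀.tgt.ob v = V₀.src.ob w →
    V₁.mul (H₁.unit.ob v) (H₁.unit.ob w) = H₁.unit.ob (V₀.mul v w)
  vunit_hunit : ∀ A, V₁.unit.ob (H₀.unit.ob A) = H₁.unit.ob (V₀.unit.ob A)
  dom_χ : ∀ a b c d, (ofStrict H₀ V₀ H₁ V₁ χ).Grid a b c d →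
    B.dom (χ a b c d) = V₁.mul (H₁.mul a b) (H₁.mul c d)
  cod_χ : ∀ a b c d, (ofStrict H₀ V₀ H₁ V₁ χ).Grid a b c d →
    B.cod (χ a b c d) = H₁.mul (V₁.mul a c) (V₁.mul b d)
  natural_χ : ∀ x y z w, (ofStrict H₀ V₀ H₁ V₁ χ).GridHom x y z w →
    B.comp (V₁.mulHom (H₁.mulHom x y) (H₁.mulHom z w))
        (χ (B.cod x) (B.cod y) (B.cod z) (B.cod w)) =
      B.comp (χ (B.dom x) (B.dom y) (B.dom z) (B.dom w))
        (H₁.mulHom (V₁.mulHom x z) (V₁.mulHom y w))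
  χ_vertical_assoc : ∀ a b c d e f, (ofStrict H₀ V₀ H₁ V₁ χ).Grid a b c d →
    (ofStrict H₀ V₀ H₁ V₁ χ).Grid c d e f →
    B.comp (V₁.mulHom (χ a b c d) (B.one (H₁.mul e f))) (χ (V₁.mul a c) (V₁.mul b d) e f) =
      B.comp (V₁.mulHom (B.one (H₁.mul a b)) (χ c d e f)) (χ a b (V₁.mul c e) (V₁.mul d f))
  χ_horizontal_assoc : ∀ a b c d e f, (ofStrict H₀ V₀ H₁ V₁ χ).Grid a b d e →
    (ofStrict H₀ V₀ H₁ V₁ χ).Grid b c e f →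
    B.comp (χ (H₁.mul a b) c (H₁.mul d e) f) (H₁.mulHom (χ a b d e) (B.one (V₁.mul c f))) =
      B.comp (χ a (H₁.mul b c) d (H₁.mul e f)) (H₁.mulHom (B.one (V₁.mul a d)) (χ b c e f))
  χ_vunit_left : ∀ f g a b, (ofStrict H₀ V₀ H₁ V₁ χ).Grid (V₁.unit.ob f) (V₁.unit.ob g) a b →
    B.IsIdentity (χ (V₁.unit.ob f) (V₁.unit.ob g) a b)
  χ_vunit_right : ∀ f g a b, (ofStrict H₀ V₀ H₁ V₁ χ).Grid a b (V₁.unit.ob f) (V₁.unit.ob g) →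
    B.IsIdentity (χ a b (V₁.unit.ob f) (V₁.unit.ob g))
  χ_hunit_left : ∀ v w a b, (ofStrict H₀ V₀ H₁ V₁ χ).Grid (H₁.unit.ob v) a (H₁.unit.ob w) b →
    B.IsIdentity (χ (H₁.unit.ob v) a (H₁.unit.ob w) b)
  χ_hunit_right : ∀ v w a b, (ofStrict H₀ V₀ H₁ V₁ χ).Grid a (H₁.unit.ob v) b (H₁.unit.ob w) →
    B.IsIdentity (χ a (H₁.unit.ob v) b (H₁.unit.ob w))

namespace IsStrictChiral

variable {H₀ : PseudoCatData (CatData.discrete O) (CatData.discrete H)}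
  {V₀ : PseudoCatData (CatData.discrete O) (CatData.discrete V)}
  {H₁ : PseudoCatData (CatData.discrete V) B} {V₁ : PseudoCatData (CatData.discrete H) B}
  {χ : B.Ob → B.Ob → B.Ob → B.Ob → B.Mor} (h : IsStrictChiral H₀ V₀ H₁ V₁ χ)

theorem hasIdentityCells : (ofStrict H₀ V₀ H₁ V₁ χ).HasIdentityCells :=
  ⟨fun f => ⟨f, rfl⟩, fun f => ⟨f, rfl⟩, fun f => ⟨f, rfl⟩⟩

theorem isChiral : (ofStrict H₀ V₀ H₁ V₁ χ).IsChiral :=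
  ⟨fun _ _ _ => ⟨_, rfl⟩, fun _ _ _ => ⟨_, rfl⟩, fun _ => ⟨_, rfl⟩⟩

include h

theorem hasStrictComposites : (ofStrict H₀ V₀ H₁ V₁ χ).HasStrictComposites :=
  ⟨h.internal_H₀.isStrict, h.internal_V₀.isStrict, h.internal_H₁.isStrict, h.internal_V₁.isStrict⟩

/-- The four faces of a cube lie in discrete categories, hence are identities; only domain and
codomain carry information. -/
theorem isSpecial {x : B.Mor} {a b : B.Ob} (hd : B.dom x = a) (hc : B.cod x = b) :
    (ofStrict H₀ V₀ H₁ V₁ χ).IsSpecial x a b := by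
  subst hd
  exact ⟨rfl, hc, h.internal_H₁.src_hom x, h.internal_H₁.tgt_hom x, h.internal_V₁.src_hom x,
    h.internal_V₁.tgt_hom x⟩

theorem χ_eq_one {a b c d : B.Ob} (hG : (ofStrict H₀ V₀ H₁ V₁ χ).Grid a b c d)
    (hχ : B.IsIdentity (χ a b c d)) : χ a b c d = B.one (V₁.mul (H₁.mul a b) (H₁.mul c d)) := by
  rw [h.internal_H₁.isCategory.eq_one_of_isIdentity hχ, h.dom_χ a b c d hG]

/-- Each clause about arrows follows from the corresponding clause about objects by passing to
domains. The three companion lemmas for the other faces work in the same way. -/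
theorem strictDoubleFunctor_hsrc : V₁.IsStrictDoubleFunctor V₀ H₀.src H₁.src where
  isFunctor₀ := h.internal_H₀.isFunctor_src
  isFunctor₁ := h.internal_H₁.isFunctor_src
  src := h.src_src
  src_hom f := by
    rw [h.internal_V₀.src_hom, h.internal_H₀.src_hom, h.internal_V₁.src_hom,
      h.internal_H₁.src_hom, h.src_src]
  tgt := h.tgt_src
  tgt_hom f := by
    rw [h.internal_V₀.tgt_hom, h.internal_H₀.src_hom, h.internal_V₁.tgt_hom,
      h.internal_H₁.src_hom, h.tgt_src]
  unit := h.hsrc_unit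
  unit_hom f := by
    rw [h.internal_V₁.unit_hom, h.internal_V₀.unit_hom, h.internal_H₁.src_one,
      h.internal_H₀.src_hom, h.hsrc_unit]
  mul := h.hsrc_mul
  mulHom f g p := by
    rw [h.internal_H₁.src_hom, h.internal_V₁.dom_mulHom _ _ p,
      h.hsrc_mul _ _ (by rw [h.internal_V₁.tgt_dom, h.internal_V₁.src_dom, p]),
      h.internal_H₁.src_dom, h.internal_H₁.src_dom]
    -- In a discrete category `one x` is `x`, so `mulHom_one` says that `mulHom` and `mul` agree.
    exact (h.internal_V₀.mulHom_one _ _ (by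
      rw [h.internal_H₁.src_hom, h.internal_H₁.src_hom, h.tgt_src, h.src_src,
        h.internal_V₁.tgt_dom, h.internal_V₁.src_dom, p])).symm
  assoc x y z p q := by
    rw [h.internal_V₁.assoc_eq, h.internal_V₀.assoc_eq, h.internal_H₁.src_one,
      h.hsrc_mul _ _ (by rw [h.internal_V₁.tgt_mul _ _ p, q]), h.hsrc_mul _ _ p]
  lunit x := by rw [h.internal_V₁.lunit_eq, h.internal_V₀.lunit_eq, h.internal_H₁.src_one]
  runit x := by rw [h.internal_V₁.runit_eq, h.internal_V₀.runit_eq, h.internal_H₁.src_one]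

theorem strictDoubleFunctor_htgt : V₁.IsStrictDoubleFunctor V₀ H₀.tgt H₁.tgt where
  isFunctor₀ := h.internal_H₀.isFunctor_tgt
  isFunctor₁ := h.internal_H₁.isFunctor_tgt
  src := h.src_tgt
  src_hom f := by
    rw [h.internal_V₀.src_hom, h.internal_H₀.tgt_hom, h.internal_V₁.src_hom,
      h.internal_H₁.tgt_hom, h.src_tgt]
  tgt := h.tgt_tgt
  tgt_hom f := by
    rw [h.internal_V₀.tgt_hom, h.internal_H₀.tgt_hom, h.internal_V₁.tgt_hom,
      h.internal_H₁.tgt_hom, h.tgt_tgt]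
  unit := h.htgt_unit
  unit_hom f := by
    rw [h.internal_V₁.unit_hom, h.internal_V₀.unit_hom, h.internal_H₁.tgt_one,
      h.internal_H₀.tgt_hom, h.htgt_unit]
  mul := h.htgt_mul
  mulHom f g p := by
    rw [h.internal_H₁.tgt_hom, h.internal_V₁.dom_mulHom _ _ p,
      h.htgt_mul _ _ (by rw [h.internal_V₁.tgt_dom, h.internal_V₁.src_dom, p]),
      h.internal_H₁.tgt_dom, h.internal_H₁.tgt_dom]
    exact (h.internal_V₀.mulHom_one _ _ (by
      rw [h.internal_H₁.tgt_hom, h.internal_H₁.tgt_hom, h.tgt_tgt, h.src_tgt,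
        h.internal_V₁.tgt_dom, h.internal_V₁.src_dom, p])).symm
  assoc x y z p q := by
    rw [h.internal_V₁.assoc_eq, h.internal_V₀.assoc_eq, h.internal_H₁.tgt_one,
      h.htgt_mul _ _ (by rw [h.internal_V₁.tgt_mul _ _ p, q]), h.htgt_mul _ _ p]
  lunit x := by rw [h.internal_V₁.lunit_eq, h.internal_V₀.lunit_eq, h.internal_H₁.tgt_one]
  runit x := by rw [h.internal_V₁.runit_eq, h.internal_V₀.runit_eq, h.internal_H₁.tgt_one]

theorem strictDoubleFunctor_vsrc : H₁.IsStrictDoubleFunctor H₀ V₀.src V₁.src where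
  isFunctor₀ := h.internal_V₀.isFunctor_src
  isFunctor₁ := h.internal_V₁.isFunctor_src
  src a := (h.src_src a).symm
  src_hom f := by
    rw [h.internal_V₀.src_hom, h.internal_H₀.src_hom, h.internal_V₁.src_hom,
      h.internal_H₁.src_hom, h.src_src]
  tgt a := (h.src_tgt a).symm
  tgt_hom f := by
    rw [h.internal_V₀.src_hom, h.internal_H₀.tgt_hom, h.internal_V₁.src_hom,
      h.internal_H₁.tgt_hom, h.src_tgt]
  unit := h.vsrc_unit
  unit_hom f := by
    rw [h.internal_H₁.unit_hom, h.internal_H₀.unit_hom, h.internal_V₁.src_one,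
      h.internal_V₀.src_hom, h.vsrc_unit]
  mul := h.vsrc_mul
  mulHom f g p := by
    rw [h.internal_V₁.src_hom, h.internal_H₁.dom_mulHom _ _ p,
      h.vsrc_mul _ _ (by rw [h.internal_H₁.tgt_dom, h.internal_H₁.src_dom, p]),
      h.internal_V₁.src_dom, h.internal_V₁.src_dom]
    exact (h.internal_H₀.mulHom_one _ _ (by
      rw [h.internal_V₁.src_hom, h.internal_V₁.src_hom, ← h.src_tgt, ← h.src_src,
        h.internal_H₁.tgt_dom, h.internal_H₁.src_dom,
        p])).symm
  assoc x y z p q := by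
    rw [h.internal_H₁.assoc_eq, h.internal_H₀.assoc_eq, h.internal_V₁.src_one,
      h.vsrc_mul _ _ (by rw [h.internal_H₁.tgt_mul _ _ p, q]), h.vsrc_mul _ _ p]
  lunit x := by rw [h.internal_H₁.lunit_eq, h.internal_H₀.lunit_eq, h.internal_V₁.src_one]
  runit x := by rw [h.internal_H₁.runit_eq, h.internal_H₀.runit_eq, h.internal_V₁.src_one]

theorem strictDoubleFunctor_vtgt : H₁.IsStrictDoubleFunctor H₀ V₀.tgt V₁.tgt where
  isFunctor₀ := h.internal_V₀.isFunctor_tgt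
  isFunctor₁ := h.internal_V₁.isFunctor_tgt
  src a := (h.tgt_src a).symm
  src_hom f := by
    rw [h.internal_V₀.tgt_hom, h.internal_H₀.src_hom, h.internal_V₁.tgt_hom,
      h.internal_H₁.src_hom, h.tgt_src]
  tgt a := (h.tgt_tgt a).symm
  tgt_hom f := by
    rw [h.internal_V₀.tgt_hom, h.internal_H₀.tgt_hom, h.internal_V₁.tgt_hom,
      h.internal_H₁.tgt_hom, h.tgt_tgt]
  unit := h.vtgt_unit
  unit_hom f := by
    rw [h.internal_H₁.unit_hom, h.internal_H₀.unit_hom, h.internal_V₁.tgt_one,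
      h.internal_V₀.tgt_hom, h.vtgt_unit]
  mul := h.vtgt_mul
  mulHom f g p := by
    rw [h.internal_V₁.tgt_hom, h.internal_H₁.dom_mulHom _ _ p,
      h.vtgt_mul _ _ (by rw [h.internal_H₁.tgt_dom, h.internal_H₁.src_dom, p]),
      h.internal_V₁.tgt_dom, h.internal_V₁.tgt_dom]
    exact (h.internal_H₀.mulHom_one _ _ (by
      rw [h.internal_V₁.tgt_hom, h.internal_V₁.tgt_hom, ← h.tgt_tgt, ← h.tgt_src,
        h.internal_H₁.tgt_dom, h.internal_H₁.src_dom,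
        p])).symm
  assoc x y z p q := by
    rw [h.internal_H₁.assoc_eq, h.internal_H₀.assoc_eq, h.internal_V₁.tgt_one,
      h.vtgt_mul _ _ (by rw [h.internal_H₁.tgt_mul _ _ p, q]), h.vtgt_mul _ _ p]
  lunit x := by rw [h.internal_H₁.lunit_eq, h.internal_H₀.lunit_eq, h.internal_V₁.tgt_one]
  runit x := by rw [h.internal_H₁.runit_eq, h.internal_H₀.runit_eq, h.internal_V₁.tgt_one]

/-- In a grid the two row composites can be composed vertically; `grid_vmul` is the same for
columns. The analogues for units follow. -/
theorem grid_hmul {a b c d : B.Ob} (p : (ofStrict H₀ V₀ H₁ V₁ χ).Grid a b c d) :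
    V₁.tgt.ob (H₁.mul a b) = V₁.src.ob (H₁.mul c d) := by
  rw [h.vtgt_mul _ _ p.top, h.vsrc_mul _ _ p.bottom]
  exact congrArg₂ H₀.mul p.left p.right

theorem grid_vmul {a b c d : B.Ob} (p : (ofStrict H₀ V₀ H₁ V₁ χ).Grid a b c d) :
    H₁.tgt.ob (V₁.mul a c) = H₁.src.ob (V₁.mul b d) := by
  rw [h.htgt_mul _ _ p.left, h.hsrc_mul _ _ p.right]
  exact congrArg₂ V₀.mul p.top p.bottom

theorem grid_unit {f g : H} (p : H₀.tgt.ob f = H₀.src.ob g) :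
    H₁.tgt.ob (V₁.unit.ob f) = H₁.src.ob (V₁.unit.ob g) := by
  rw [h.htgt_unit, h.hsrc_unit, p]

theorem vgrid_unit {v w : V} (p : V₀.tgt.ob v = V₀.src.ob w) :
    V₁.tgt.ob (H₁.unit.ob v) = V₁.src.ob (H₁.unit.ob w) := by
  rw [h.vtgt_unit, h.vsrc_unit, p]

/-- The coherence axioms mention constraints and degenerate interchangers, all of which are
identities here. Axioms combining `χ` with `δ` or `μ` reduce to `χ` being an identity on units,
those among `δ`, `μ`, `τ` alone to compatibility of units with composition, and the associativity
axioms for `χ` to the fields of the same name. -/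
theorem isIntercategory : (ofStrict H₀ V₀ H₁ V₁ χ).IsIntercategory where
  isPseudoCategory_H₀ := h.internal_H₀.isPseudoCategory
  isPseudoCategory_V₀ := h.internal_V₀.isPseudoCategory
  isPseudoCategory_H₁ := h.internal_H₁.isPseudoCategory
  isPseudoCategory_V₁ := h.internal_V₁.isPseudoCategory
  horizontal_src := h.strictDoubleFunctor_hsrc
  horizontal_tgt := h.strictDoubleFunctor_htgt
  vertical_src := h.strictDoubleFunctor_vsrc
  vertical_tgt := h.strictDoubleFunctor_vtgt
  special_χ a b c d hG := h.isSpecial (h.dom_χ a b c d hG) (h.cod_χ a b c d hG)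
  special_δ f g p := h.isSpecial (h.internal_H₁.isCategory.dom_one _)
    ((h.internal_H₁.isCategory.cod_one _).trans (h.mul_vunit f g p).symm)
  special_μ v w p := h.isSpecial
    ((h.internal_H₁.isCategory.dom_one _).trans (h.mul_hunit v w p).symm)
    (h.internal_H₁.isCategory.cod_one _)
  special_τ A := h.isSpecial (h.internal_H₁.isCategory.dom_one _)
    ((h.internal_H₁.isCategory.cod_one _).trans (h.vunit_hunit A))
  natural_χ := h.natural_χ
  natural_δ f g p := by
    change H₀.tgt.hom f = H₀.src.hom g at p
    have p' : H₀.tgt.ob f = H₀.src.ob g := by rwa [h.internal_H₀.tgt_hom,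
      h.internal_H₀.src_hom] at p
    have e : H₀.mulHom f g = H₀.mul f g := h.internal_H₀.mulHom_one f g p'
    simp only [e, h.internal_V₁.unit_hom, h.internal_H₁.isCategory.one_comp_one]
    rw [h.internal_H₁.mulHom_one _ _ (h.grid_unit p'), h.mul_vunit _ _ p',
      h.internal_H₁.isCategory.one_comp_one]
  natural_μ v w p := by
    change V₀.tgt.hom v = V₀.src.hom w at p
    have p' : V₀.tgt.ob v = V₀.src.ob w := by rwa [h.internal_V₀.tgt_hom,
      h.internal_V₀.src_hom] at p
    have e : V₀.mulHom v w = V₀.mul v w := h.internal_V₀.mulHom_one v w p'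
    simp only [e, h.internal_H₁.unit_hom, h.internal_H₁.isCategory.one_comp_one]
    rw [h.internal_V₁.mulHom_one _ _ (h.vgrid_unit p'), h.mul_hunit _ _ p',
      h.internal_H₁.isCategory.one_comp_one]
  natural_τ A := by
    have e : H₀.unit.hom A = H₀.unit.ob A := h.internal_H₀.unit_hom A
    have e' : V₀.unit.hom A = V₀.unit.ob A := h.internal_V₀.unit_hom A
    simp only [e, e', h.internal_V₁.unit_hom, h.internal_H₁.unit_hom, ← h.vunit_hunit]
  χ_vertical_assoc a b c d e f p q := by
    have p₂ : V₁.tgt.ob c = V₁.src.ob e := q.left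
    have p₃ : V₁.tgt.ob d = V₁.src.ob f := q.right
    have p₁ := h.grid_hmul p
    have q₁ := h.grid_hmul q
    have r : (ofStrict H₀ V₀ H₁ V₁ χ).Grid (V₁.mul a c) (V₁.mul b d) e f :=
      ⟨h.grid_vmul p, q.bottom, (h.internal_V₁.tgt_mul _ _ p.left).trans q.left,
        (h.internal_V₁.tgt_mul _ _ p.right).trans q.right⟩
    have s : V₁.tgt.hom (χ a b c d) = V₁.src.hom (B.one (H₁.mul e f)) := by
      rw [h.internal_V₁.tgt_hom, h.dom_χ _ _ _ _ p, h.internal_V₁.tgt_mul _ _ p₁,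
        h.internal_V₁.src_one, q₁]
    have s' : V₁.tgt.hom (B.one (H₁.mul a b)) = V₁.src.hom (χ c d e f) := by
      rw [h.internal_V₁.src_hom, h.dom_χ _ _ _ _ q, h.internal_V₁.src_mul _ _ q₁,
        h.internal_V₁.tgt_one, p₁]
    have t : V₁.tgt.ob a = V₁.src.ob (V₁.mul c e) :=
      p.left.trans (h.internal_V₁.src_mul _ _ q.left).symm
    have t' : V₁.tgt.ob b = V₁.src.ob (V₁.mul d f) :=
      p.right.trans (h.internal_V₁.src_mul _ _ q.right).symm
    have w : (ofStrict H₀ V₀ H₁ V₁ χ).Grid a b (V₁.mul c e) (V₁.mul d f) :=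
      ⟨p.top, h.grid_vmul q, t, t'⟩
    have z : H₁.tgt.ob (V₁.mul (V₁.mul a c) e) = H₁.src.ob (V₁.mul (V₁.mul b d) f) :=
      h.grid_vmul r
    have hC := h.internal_H₁.isCategory
    simp only [CatData.comp₃, h.internal_V₁.assoc_eq]
    -- The associativity constraints disappear from the end of the left side and the start of the
    -- right side. The goals left over confirm that they are identities of the right codomain and
    -- domain.
    rw [h.internal_H₁.mulHom_one _ _ z, hC.comp_one_of_eq, hC.one_comp_of_eq]
    · exact h.χ_vertical_assoc a b c d e f p q
    · rw [h.internal_V₁.dom_mulHom _ _ s', hC.dom_one, h.dom_χ _ _ _ _ q,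
        h.internal_V₁.mul_assoc _ _ _ p₁ q₁]
    · rw [hC.cod_comp, h.cod_χ _ _ _ _ r]
      rw [h.internal_V₁.cod_mulHom _ _ s, h.cod_χ _ _ _ _ p, hC.cod_one, h.dom_χ _ _ _ _ r]
  χ_δ_left a b p := by
    have p' : H₁.tgt.ob a = H₁.src.ob b := p
    have hC := h.internal_H₁.isCategory
    have q : H₀.tgt.ob (V₁.src.ob a) = H₀.src.ob (V₁.src.ob b) := by
      rw [← h.src_tgt, ← h.src_src, p']
    have hG : (ofStrict H₀ V₀ H₁ V₁ χ).Grid (V₁.unit.ob (V₁.src.ob a)) (V₁.unit.ob (V₁.src.ob b))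
        a b := ⟨h.grid_unit q, p, h.internal_V₁.tgt_unit _, h.internal_V₁.tgt_unit _⟩
    simp only [CatData.comp₃, h.internal_V₁.lunit_eq]
    -- The row of units composes to the unit on the top side of `H₁.mul a b`, so every factor
    -- becomes the identity of `H₁.mul a b`.
    rw [h.χ_eq_one hG (h.χ_vunit_left _ _ _ _ hG), h.mul_vunit _ _ q, ← h.vsrc_mul _ _ p',
      h.internal_V₁.unit_mul, h.internal_V₁.mulHom_one _ _ (h.internal_V₁.tgt_unit _),
      h.internal_V₁.unit_mul, h.internal_H₁.mulHom_one _ _ p', hC.one_comp_one, hC.one_comp_one]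
  χ_δ_right a b p := by
    have p' : H₁.tgt.ob a = H₁.src.ob b := p
    have hC := h.internal_H₁.isCategory
    have q : H₀.tgt.ob (V₁.tgt.ob a) = H₀.src.ob (V₁.tgt.ob b) := by
      rw [← h.tgt_tgt, ← h.tgt_src, p']
    have hG : (ofStrict H₀ V₀ H₁ V₁ χ).Grid a b (V₁.unit.ob (V₁.tgt.ob a))
        (V₁.unit.ob (V₁.tgt.ob b)) :=
      ⟨p, h.grid_unit q, (h.internal_V₁.src_unit _).symm, (h.internal_V₁.src_unit _).symm⟩
    simp only [CatData.comp₃, h.internal_V₁.runit_eq]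
    rw [h.χ_eq_one hG (h.χ_vunit_right _ _ _ _ hG), h.mul_vunit _ _ q, ← h.vtgt_mul _ _ p',
      h.internal_V₁.mul_unit, h.internal_V₁.mulHom_one _ _ (h.internal_V₁.src_unit _).symm,
      h.internal_V₁.mul_unit, h.internal_H₁.mulHom_one _ _ p', hC.one_comp_one, hC.one_comp_one]
  μ_assoc v w z p q := by
    have p' : V₀.tgt.ob v = V₀.src.ob w := p
    have q' : V₀.tgt.ob w = V₀.src.ob z := q
    have hC := h.internal_H₁.isCategory
    have r : V₀.tgt.ob (V₀.mul v w) = V₀.src.ob z := by rw [h.internal_V₀.tgt_mul _ _ p', q']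
    have s : V₀.tgt.ob v = V₀.src.ob (V₀.mul w z) := by rw [h.internal_V₀.src_mul _ _ q', p']
    simp only [CatData.comp₃, h.internal_V₁.assoc_eq, h.internal_V₀.assoc_eq]
    rw [h.internal_H₁.unit_hom, h.internal_V₁.mulHom_one _ _ (h.vgrid_unit r), h.mul_hunit _ _ r,
      h.internal_V₁.mulHom_one _ _ (h.vgrid_unit s), h.mul_hunit _ _ s, h.mul_hunit _ _ p',
      h.mul_hunit _ _ r, h.internal_V₀.mul_assoc _ _ _ p' q']
  μ_τ_left v := by
    have hC := h.internal_H₁.isCategory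
    have p : V₀.tgt.ob (V₀.unit.ob (V₀.src.ob v)) = V₀.src.ob v := h.internal_V₀.tgt_unit _
    simp only [CatData.comp₃, h.internal_V₁.lunit_eq, h.internal_V₀.lunit_eq]
    rw [h.vunit_hunit, h.internal_V₁.mulHom_one _ _ (h.vgrid_unit p), h.mul_hunit _ _ p,
      h.internal_V₀.unit_mul, h.internal_H₁.unit_hom, hC.one_comp_one, hC.one_comp_one]
  μ_τ_right v := by
    have hC := h.internal_H₁.isCategory
    have p : V₀.tgt.ob v = V₀.src.ob (V₀.unit.ob (V₀.tgt.ob v)) :=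
      (h.internal_V₀.src_unit _).symm
    simp only [CatData.comp₃, h.internal_V₁.runit_eq, h.internal_V₀.runit_eq]
    rw [h.vunit_hunit, h.internal_V₁.mulHom_one _ _ (h.vgrid_unit p), h.mul_hunit _ _ p,
      h.internal_V₀.mul_unit, h.internal_H₁.unit_hom, hC.one_comp_one, hC.one_comp_one]
  χ_horizontal_assoc a b c d e f p q := by
    have hC := h.internal_H₁.isCategory
    have p₁ := h.grid_vmul p
    have q₁ := h.grid_vmul q
    have r : (ofStrict H₀ V₀ H₁ V₁ χ).Grid (H₁.mul a b) c (H₁.mul d e) f :=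
      ⟨(h.internal_H₁.tgt_mul _ _ p.top).trans q.top,
        (h.internal_H₁.tgt_mul _ _ p.bottom).trans q.bottom, h.grid_hmul p, q.right⟩
    have s : H₁.tgt.hom (χ a b d e) = H₁.src.hom (B.one (V₁.mul c f)) := by
      -- The right face is read off the codomain of `χ`, which is a horizontal composite; the domain
      -- is a vertical one.
      rw [← h.internal_H₁.tgt_cod, h.cod_χ _ _ _ _ p]
      exact (h.internal_H₁.tgt_mul _ _ p₁).trans (q₁.trans (h.internal_H₁.src_one _).symm)
    have z : V₁.tgt.ob (H₁.mul a (H₁.mul b c)) = V₁.src.ob (H₁.mul d (H₁.mul e f)) := by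
      rw [← h.internal_H₁.mul_assoc _ _ _ p.top q.top,
        ← h.internal_H₁.mul_assoc _ _ _ p.bottom q.bottom]
      exact h.grid_hmul r
    have w : (ofStrict H₀ V₀ H₁ V₁ χ).Grid a (H₁.mul b c) d (H₁.mul e f) :=
      ⟨p.top.trans (h.internal_H₁.src_mul _ _ q.top).symm,
        p.bottom.trans (h.internal_H₁.src_mul _ _ q.bottom).symm, p.left, h.grid_hmul q⟩
    simp only [CatData.comp₃, h.internal_H₁.assoc_eq]
    rw [h.internal_H₁.mul_assoc _ _ _ p.top q.top, h.internal_H₁.mul_assoc _ _ _ p.bottom q.bottom,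
      h.internal_V₁.mulHom_one _ _ z, hC.comp_one_of_eq, hC.one_comp_of_eq]
    · exact h.χ_horizontal_assoc a b c d e f p q
    · rw [h.dom_χ _ _ _ _ w]
    · rw [hC.cod_comp, h.internal_H₁.cod_mulHom _ _ s, h.cod_χ _ _ _ _ p, hC.cod_one]
      rw [h.internal_H₁.dom_mulHom _ _ s, h.cod_χ _ _ _ _ r, h.dom_χ _ _ _ _ p, hC.dom_one]
  δ_assoc f g k p q := by
    have p' : H₀.tgt.ob f = H₀.src.ob g := p
    have q' : H₀.tgt.ob g = H₀.src.ob k := q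
    have r : H₀.tgt.ob (H₀.mul f g) = H₀.src.ob k := by rw [h.internal_H₀.tgt_mul _ _ p', q']
    have s : H₀.tgt.ob f = H₀.src.ob (H₀.mul g k) := by rw [h.internal_H₀.src_mul _ _ q', p']
    simp only [CatData.comp₃, h.internal_H₁.assoc_eq, h.internal_H₀.assoc_eq]
    rw [h.internal_V₁.unit_hom, h.internal_H₁.mulHom_one _ _ (h.grid_unit r), h.mul_vunit _ _ r,
      h.internal_H₁.mulHom_one _ _ (h.grid_unit s), h.mul_vunit _ _ s, h.mul_vunit _ _ p',
      h.mul_vunit _ _ r, h.internal_H₀.mul_assoc _ _ _ p' q']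
  χ_μ_left a c p := by
    have p' : V₁.tgt.ob a = V₁.src.ob c := p
    have hC := h.internal_H₁.isCategory
    have q : V₀.tgt.ob (H₁.src.ob a) = V₀.src.ob (H₁.src.ob c) := by
      rw [h.tgt_src, h.src_src, p']
    have hG : (ofStrict H₀ V₀ H₁ V₁ χ).Grid (H₁.unit.ob (H₁.src.ob a)) a
        (H₁.unit.ob (H₁.src.ob c)) c :=
      ⟨h.internal_H₁.tgt_unit _, h.internal_H₁.tgt_unit _, h.vgrid_unit q, p⟩
    simp only [CatData.comp₃, h.internal_H₁.lunit_eq]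
    rw [h.χ_eq_one hG (h.χ_hunit_left _ _ _ _ hG), h.internal_H₁.unit_mul,
      h.internal_H₁.unit_mul, ← h.hsrc_mul _ _ p',
      h.internal_H₁.mulHom_one _ _ (h.internal_H₁.tgt_unit _), h.internal_H₁.unit_mul,
      h.internal_V₁.mulHom_one _ _ p', hC.one_comp_one, hC.one_comp_one]
  χ_μ_right a c p := by
    have p' : V₁.tgt.ob a = V₁.src.ob c := p
    have hC := h.internal_H₁.isCategory
    have q : V₀.tgt.ob (H₁.tgt.ob a) = V₀.src.ob (H₁.tgt.ob c) := by
      rw [h.tgt_tgt, h.src_tgt, p']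
    have hG : (ofStrict H₀ V₀ H₁ V₁ χ).Grid a (H₁.unit.ob (H₁.tgt.ob a)) c
        (H₁.unit.ob (H₁.tgt.ob c)) :=
      ⟨(h.internal_H₁.src_unit _).symm, (h.internal_H₁.src_unit _).symm, p, h.vgrid_unit q⟩
    simp only [CatData.comp₃, h.internal_H₁.runit_eq]
    rw [h.χ_eq_one hG (h.χ_hunit_right _ _ _ _ hG), h.internal_H₁.mul_unit,
      h.internal_H₁.mul_unit, ← h.htgt_mul _ _ p',
      h.internal_H₁.mulHom_one _ _ (h.internal_H₁.src_unit _).symm, h.internal_H₁.mul_unit,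
      h.internal_V₁.mulHom_one _ _ p', hC.one_comp_one, hC.one_comp_one]
  δ_τ_left f := by
    have hC := h.internal_H₁.isCategory
    have p : H₀.tgt.ob (H₀.unit.ob (H₀.src.ob f)) = H₀.src.ob f := h.internal_H₀.tgt_unit _
    simp only [CatData.comp₃, h.internal_H₁.lunit_eq, h.internal_H₀.lunit_eq]
    rw [h.internal_H₁.mulHom_one _ _ (h.grid_unit p), h.mul_vunit _ _ p,
      h.internal_H₀.unit_mul, h.internal_V₁.unit_hom, hC.one_comp_one, hC.one_comp_one]
  δ_τ_right f := by
    have hC := h.internal_H₁.isCategory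
    have p : H₀.tgt.ob f = H₀.src.ob (H₀.unit.ob (H₀.tgt.ob f)) :=
      (h.internal_H₀.src_unit _).symm
    simp only [CatData.comp₃, h.internal_H₁.runit_eq, h.internal_H₀.runit_eq]
    rw [h.internal_H₁.mulHom_one _ _ (h.grid_unit p), h.mul_vunit _ _ p,
      h.internal_H₀.mul_unit, h.internal_V₁.unit_hom, hC.one_comp_one, hC.one_comp_one]

end IsStrictChiral

end IntercatData

/-! ### Whiskering in 2-categories -/

namespace TwoCat

variable (C : TwoCat.{v})

theorem src_tgt₂ (x : C.C2) : C.src₁ (C.tgt₂ x) = C.src₁ (C.src₂ x) := (C.src_src x).symm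

theorem tgt_tgt₂ (x : C.C2) : C.tgt₁ (C.tgt₂ x) = C.tgt₁ (C.src₂ x) := (C.tgt_tgt x).symm

theorem id_comp_of_eq {f : C.C1} {a : C.C0} (h : C.src₁ f = a) : C.comp (C.id₁ a) f = f := by
  rw [← h, C.id_comp]

theorem comp_id_of_eq {f : C.C1} {a : C.C0} (h : C.tgt₁ f = a) : C.comp f (C.id₁ a) = f := by
  rw [← h, C.comp_id]

theorem id_hcomp_of_eq {x : C.C2} {a : C.C0} (h : C.src₁ (C.src₂ x) = a) :
    C.hcomp (C.id₂ (C.id₁ a)) x = x := by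
  rw [← h, C.id_hcomp]

theorem hcomp_id_of_eq {x : C.C2} {a : C.C0} (h : C.tgt₁ (C.src₂ x) = a) :
    C.hcomp x (C.id₂ (C.id₁ a)) = x := by
  rw [← h, C.hcomp_id]

theorem id_vcomp_of_eq {x : C.C2} {f : C.C1} (h : C.src₂ x = f) : C.vcomp (C.id₂ f) x = x := by
  rw [← h, C.id_vcomp]

theorem vcomp_id_of_eq {x : C.C2} {f : C.C1} (h : C.tgt₂ x = f) : C.vcomp x (C.id₂ f) = x := by
  rw [← h, C.vcomp_id]

/-- The 2-cell `a · x · b` for arrows `a`, `b` and a 2-cell `x`. -/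
def whisk (a : C.C1) (x : C.C2) (b : C.C1) : C.C2 := C.hcomp (C.hcomp (C.id₂ a) x) (C.id₂ b)

variable {C} {a b f : C.C1} {x y : C.C2}

theorem src₂_id_hcomp (h : C.tgt₁ a = C.src₁ (C.src₂ x)) :
    C.src₂ (C.hcomp (C.id₂ a) x) = C.comp a (C.src₂ x) := by
  rw [src_hcomp _ _ _ (by rw [src_id₂, h]), src_id₂]

theorem tgt₂_id_hcomp (h : C.tgt₁ a = C.src₁ (C.src₂ x)) :
    C.tgt₂ (C.hcomp (C.id₂ a) x) = C.comp a (C.tgt₂ x) := by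
  rw [tgt_hcomp _ _ _ (by rw [src_id₂, h]), tgt_id₂]

theorem src₂_whisk (h : C.tgt₁ a = C.src₁ (C.src₂ x)) (h' : C.tgt₁ (C.src₂ x) = C.src₁ b) :
    C.src₂ (C.whisk a x b) = C.comp a (C.comp (C.src₂ x) b) := by
  rw [whisk, src_hcomp _ _ _ (by rw [src₂_id_hcomp h, tgt_comp _ _ _ h, src_id₂, h']),
    src₂_id_hcomp h, src_id₂, comp_assoc _ _ _ _ h h']

theorem tgt₂_whisk (h : C.tgt₁ a = C.src₁ (C.src₂ x)) (h' : C.tgt₁ (C.src₂ x) = C.src₁ b) :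
    C.tgt₂ (C.whisk a x b) = C.comp a (C.comp (C.tgt₂ x) b) := by
  rw [whisk, tgt_hcomp _ _ _ (by rw [src₂_id_hcomp h, tgt_comp _ _ _ h, src_id₂, h']),
    tgt₂_id_hcomp h, tgt_id₂,
    comp_assoc _ _ _ _ (by rw [src_tgt₂, h]) (by rw [tgt_tgt₂, h'])]

/-- This lemma and the next three absorb outer or inner whiskerings into one `whisk`, so that a
2-cell built from a single `γ` gets the normal form `whisk a x b`. -/
theorem id_hcomp_whisk (hf : C.tgt₁ f = C.src₁ a) (h : C.tgt₁ a = C.src₁ (C.src₂ x))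
    (h' : C.tgt₁ (C.src₂ x) = C.src₁ b) :
    C.hcomp (C.id₂ f) (C.whisk a x b) = C.whisk (C.comp f a) x b := by
  have e : C.src₂ (C.hcomp (C.id₂ a) x) = C.comp a (C.src₂ x) := src₂_id_hcomp h
  rw [whisk, whisk, ← hcomp_assoc, ← hcomp_assoc, hcomp_id₂ _ _ _ hf]
  · rw [src_id₂, src_id₂, hf]
  · rw [src_id₂, h]
  · rw [src_id₂, e, src_comp _ _ _ h, hf]
  · rw [e, src_id₂, tgt_comp _ _ _ h, h']

theorem whisk_hcomp_id (h : C.tgt₁ a = C.src₁ (C.src₂ x)) (h' : C.tgt₁ (C.src₂ x) = C.src₁ b)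
    (hf : C.tgt₁ b = C.src₁ f) :
    C.hcomp (C.whisk a x b) (C.id₂ f) = C.whisk a x (C.comp b f) := by
  have e : C.src₂ (C.hcomp (C.id₂ a) x) = C.comp a (C.src₂ x) := src₂_id_hcomp h
  rw [whisk, whisk, hcomp_assoc, hcomp_id₂ _ _ _ hf]
  · rw [e, src_id₂, tgt_comp _ _ _ h, h']
  · rw [src_id₂, src_id₂, hf]

theorem whisk_id_hcomp (h : C.tgt₁ a = C.src₁ f) (h' : C.tgt₁ f = C.src₁ (C.src₂ x)) :
    C.whisk a (C.hcomp (C.id₂ f) x) b = C.whisk (C.comp a f) x b := by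
  rw [whisk, whisk, ← hcomp_assoc, hcomp_id₂ _ _ _ h]
  · rw [src_id₂, src_id₂, h]
  · rw [src_id₂, h']

theorem whisk_hcomp_id' (h : C.tgt₁ a = C.src₁ (C.src₂ x)) (h' : C.tgt₁ (C.src₂ x) = C.src₁ f)
    (hb : C.tgt₁ f = C.src₁ b) :
    C.whisk a (C.hcomp x (C.id₂ f)) b = C.whisk a x (C.comp f b) := by
  have e : C.src₂ (C.hcomp (C.id₂ a) x) = C.comp a (C.src₂ x) := src₂_id_hcomp h
  rw [whisk, whisk, ← hcomp_assoc, hcomp_assoc, hcomp_id₂ _ _ _ hb]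
  · rw [e, src_id₂, tgt_comp _ _ _ h, h']
  · rw [src_id₂, src_id₂, hb]
  · rw [src_id₂, h]
  · rw [src_id₂, h']

theorem whisk_vcomp (hxy : C.tgt₂ x = C.src₂ y) (h : C.tgt₁ a = C.src₁ (C.src₂ x))
    (h' : C.tgt₁ (C.src₂ x) = C.src₁ b) :
    C.whisk a (C.vcomp x y) b = C.vcomp (C.whisk a x b) (C.whisk a y b) := by
  have h₂ : C.tgt₁ a = C.src₁ (C.src₂ y) := by rw [← hxy, src_tgt₂, h]
  have e : ∀ f, C.vcomp (C.id₂ f) (C.id₂ f) = C.id₂ f := fun f =>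
    id_vcomp_of_eq _ (src_id₂ _ _)
  have := C.interchange (C.id₂ a) (C.id₂ a) x y (by rw [src_id₂, tgt_id₂]) hxy
    (by rw [src_id₂, h])
  rw [e] at this
  rw [whisk, this]
  have := C.interchange (C.hcomp (C.id₂ a) x) (C.hcomp (C.id₂ a) y) (C.id₂ b) (C.id₂ b)
    (by rw [tgt₂_id_hcomp h, src₂_id_hcomp h₂, hxy]) (by rw [src_id₂, tgt_id₂])
    (by rw [src_id₂, src₂_id_hcomp h, tgt_comp _ _ _ h, h'])
  rw [e] at this
  rw [this, whisk, whisk]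

theorem whisk_id (h : C.tgt₁ a = C.src₁ f) (h' : C.tgt₁ f = C.src₁ b) :
    C.whisk a (C.id₂ f) b = C.id₂ (C.comp a (C.comp f b)) := by
  rw [whisk, hcomp_id₂ _ _ _ h, hcomp_id₂ _ _ _ (by rw [tgt_comp _ _ _ h, h']),
    comp_assoc _ _ _ _ h h']

/-- Whiskered 2-cells in adjacent positions commute. -/
theorem whisk_swap (h : C.tgt₁ a = C.src₁ (C.src₂ x)) (hxy : C.tgt₁ (C.src₂ x) = C.src₁ (C.src₂ y))
    (h' : C.tgt₁ (C.src₂ y) = C.src₁ b) :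
    C.vcomp (C.whisk a x (C.comp (C.src₂ y) b)) (C.whisk (C.comp a (C.tgt₂ x)) y b) =
      C.vcomp (C.whisk (C.comp a (C.src₂ x)) y b) (C.whisk a x (C.comp (C.tgt₂ y) b)) := by
  have e : C.tgt₁ a = C.src₁ (C.tgt₂ x) := by rw [src_tgt₂, h]
  have e' : C.tgt₁ (C.tgt₂ y) = C.src₁ b := by rw [tgt_tgt₂, h']
  -- The factors next to `x` and `y` are moved inside, so that all four 2-cells are whiskered by the
  -- same `a` and `b`.
  rw [← whisk_hcomp_id' h (by rw [hxy]) h', ← whisk_hcomp_id' h (by rw [src_tgt₂, hxy]) e',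
    ← whisk_id_hcomp h hxy, ← whisk_id_hcomp e (by rw [tgt_tgt₂, hxy])]
  have k₁ : C.tgt₁ (C.src₂ x) = C.src₁ (C.src₂ (C.id₂ (C.src₂ y))) := by rw [src_id₂, hxy]
  have k₂ : C.tgt₁ (C.src₂ (C.id₂ (C.tgt₂ x))) = C.src₁ (C.src₂ y) := by
    rw [src_id₂, tgt_tgt₂, hxy]
  have k₃ : C.tgt₁ (C.src₂ (C.id₂ (C.src₂ x))) = C.src₁ (C.src₂ y) := by rw [src_id₂, hxy]
  have k₄ : C.tgt₁ (C.src₂ x) = C.src₁ (C.src₂ (C.id₂ (C.tgt₂ y))) := by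
    rw [src_id₂, src_tgt₂, hxy]
  -- By interchange both orders of composition give `hcomp x y` inside the whiskering.
  rw [← whisk_vcomp, ← whisk_vcomp, ← interchange _ _ _ _ _ (src_id₂ _ _).symm (tgt_id₂ _ _) k₁,
    ← interchange _ _ _ _ _ (tgt_id₂ _ _) (src_id₂ _ _).symm k₃, vcomp_id, id_vcomp, vcomp_id,
    id_vcomp]
  · rw [tgt_hcomp _ _ _ k₃, src_hcomp _ _ _ k₄, src_id₂, tgt_id₂]
  · rw [src_hcomp _ _ _ k₃, src_id₂, src_comp _ _ _ hxy, h]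
  · rw [src_hcomp _ _ _ k₃, src_id₂, tgt_comp _ _ _ hxy, h']
  · rw [tgt_hcomp _ _ _ k₁, src_hcomp _ _ _ k₂, src_id₂, tgt_id₂]
  · rw [src_hcomp _ _ _ k₁, src_id₂, src_comp _ _ _ hxy, h]
  · rw [src_hcomp _ _ _ k₁, src_id₂, tgt_comp _ _ _ hxy, h']

/-- Naturality of a whiskered square of 2-cells. -/
theorem hcomp_whisk_natural {z w p q : C.C2} (hz : C.tgt₁ (C.src₂ z) = C.src₁ (C.src₂ x))
    (hw : C.tgt₁ (C.src₂ x) = C.src₁ (C.src₂ w)) (hxp : C.tgt₂ x = C.src₂ p)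
    (hqy : C.tgt₂ q = C.src₂ y) (e : C.vcomp x p = C.vcomp q y) :
    C.vcomp (C.hcomp (C.hcomp z x) w) (C.whisk (C.tgt₂ z) p (C.tgt₂ w)) =
      C.vcomp (C.whisk (C.src₂ z) q (C.src₂ w)) (C.hcomp (C.hcomp z y) w) := by
  have e₁ : C.src₂ x = C.src₂ q := by
    rw [← src_vcomp _ _ _ hxp, e, src_vcomp _ _ _ hqy]
  have s : C.tgt₁ (C.src₂ (C.id₂ (C.tgt₂ z))) = C.src₁ (C.src₂ p) := by
    rw [src_id₂, tgt_tgt₂, hz, ← hxp, src_tgt₂]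
  have s' : C.tgt₁ (C.src₂ (C.id₂ (C.src₂ z))) = C.src₁ (C.src₂ q) := by
    rw [src_id₂, hz, e₁]
  have t : C.tgt₁ (C.src₂ z) = C.src₁ (C.src₂ y) := by rw [hz, e₁, ← hqy, src_tgt₂]
  have k : C.tgt₁ (C.src₂ (C.hcomp z x)) = C.tgt₁ (C.src₂ x) := by
    rw [src_hcomp _ _ _ hz, tgt_comp _ _ _ hz]
  -- Interchange gathers the three positions: the outer ones become `z` and `w` on both sides, the
  -- middle one becomes the two sides of `e`.
  rw [whisk, whisk, ← interchange, ← interchange _ _ _ _ _ (src_id₂ _ _).symm hxp hz,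
    ← interchange, ← interchange _ _ _ _ _ (tgt_id₂ _ _) hqy s', vcomp_id, vcomp_id, id_vcomp,
    id_vcomp, e]
  · rw [tgt_hcomp _ _ _ s', src_hcomp _ _ _ t, tgt_id₂, hqy]
  · rw [tgt_id₂]
  · rw [src_hcomp _ _ _ s', src_id₂, src_id₂, ← e₁, tgt_comp _ _ _ hz, hw]
  · rw [tgt_hcomp _ _ _ hz, src_hcomp _ _ _ s, src_id₂, hxp]
  · rw [src_id₂]
  · rw [k, hw]

end TwoCat

theorem IsTwoFunctor.map_whisk {A B : TwoCat.{v}} {F0 : A.C0 → B.C0} {F1 : A.C1 → B.C1}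
    {F2 : A.C2 → B.C2} (hF : IsTwoFunctor A B F0 F1 F2) {a b : A.C1} {x : A.C2}
    (h : A.tgt₁ a = A.src₁ (A.src₂ x)) (h' : A.tgt₁ (A.src₂ x) = A.src₁ b) :
    F2 (A.whisk a x b) = B.whisk (F1 a) (F2 x) (F1 b) := by
  rw [TwoCat.whisk, TwoCat.whisk, hF.hcomp, hF.hcomp, hF.id₂, hF.id₂]
  · rw [TwoCat.src_id₂, h]
  · rw [TwoCat.src_id₂, TwoCat.src₂_id_hcomp h, TwoCat.tgt_comp _ _ _ h, h']

/-! ### Gray functors of two variables -/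

namespace GrayFunctor

variable {A B C : TwoCat.{v}} (H : GrayFunctor A B C)

theorem L₁_id (a : A.C0) (b : B.C0) : H.L₁ (A.id₁ a) b = C.id₁ (H.ob a b) :=
  (H.isTwoFunctor_left b).id₁ a

theorem L₂_id (f : A.C1) (b : B.C0) : H.L₂ (A.id₂ f) b = C.id₂ (H.L₁ f b) :=
  (H.isTwoFunctor_left b).id₂ f

theorem L₁_comp (f g : A.C1) (b : B.C0) (h : A.tgt₁ f = A.src₁ g) :
    H.L₁ (A.comp f g) b = C.comp (H.L₁ f b) (H.L₁ g b) :=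
  (H.isTwoFunctor_left b).comp f g h

theorem L₂_vcomp (x y : A.C2) (b : B.C0) (h : A.tgt₂ x = A.src₂ y) :
    H.L₂ (A.vcomp x y) b = C.vcomp (H.L₂ x b) (H.L₂ y b) :=
  (H.isTwoFunctor_left b).vcomp x y h

theorem L₂_hcomp (x y : A.C2) (b : B.C0) (h : A.tgt₁ (A.src₂ x) = A.src₁ (A.src₂ y)) :
    H.L₂ (A.hcomp x y) b = C.hcomp (H.L₂ x b) (H.L₂ y b) :=
  (H.isTwoFunctor_left b).hcomp x y h

theorem L₂_whisk {f g : A.C1} {x : A.C2} (b : B.C0) (h : A.tgt₁ f = A.src₁ (A.src₂ x))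
    (h' : A.tgt₁ (A.src₂ x) = A.src₁ g) :
    H.L₂ (A.whisk f x g) b = C.whisk (H.L₁ f b) (H.L₂ x b) (H.L₁ g b) :=
  (H.isTwoFunctor_left b).map_whisk h h'

theorem R₁_id (a : A.C0) (b : B.C0) : H.R₁ a (B.id₁ b) = C.id₁ (H.ob a b) :=
  (H.isTwoFunctor_right a).id₁ b

theorem R₂_id (a : A.C0) (f : B.C1) : H.R₂ a (B.id₂ f) = C.id₂ (H.R₁ a f) :=
  (H.isTwoFunctor_right a).id₂ f

theorem R₁_comp (a : A.C0) (f g : B.C1) (h : B.tgt₁ f = B.src₁ g) :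
    H.R₁ a (B.comp f g) = C.comp (H.R₁ a f) (H.R₁ a g) :=
  (H.isTwoFunctor_right a).comp f g h

theorem R₂_vcomp (a : A.C0) (x y : B.C2) (h : B.tgt₂ x = B.src₂ y) :
    H.R₂ a (B.vcomp x y) = C.vcomp (H.R₂ a x) (H.R₂ a y) :=
  (H.isTwoFunctor_right a).vcomp x y h

theorem R₂_hcomp (a : A.C0) (x y : B.C2) (h : B.tgt₁ (B.src₂ x) = B.src₁ (B.src₂ y)) :
    H.R₂ a (B.hcomp x y) = C.hcomp (H.R₂ a x) (H.R₂ a y) :=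
  (H.isTwoFunctor_right a).hcomp x y h

theorem R₂_whisk {f g : B.C1} {x : B.C2} (a : A.C0) (h : B.tgt₁ f = B.src₁ (B.src₂ x))
    (h' : B.tgt₁ (B.src₂ x) = B.src₁ g) :
    H.R₂ a (B.whisk f x g) = C.whisk (H.R₁ a f) (H.R₂ a x) (H.R₁ a g) :=
  (H.isTwoFunctor_right a).map_whisk h h'

/-- Joint naturality of `γ` in both variables. -/
theorem γ_natural (x : A.C2) (y : B.C2) :
    C.vcomp (C.hcomp (H.R₂ (A.src₁ (A.src₂ x)) y) (H.L₂ x (B.tgt₁ (B.src₂ y))))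
        (H.γ (A.tgt₂ x) (B.tgt₂ y)) =
      C.vcomp (H.γ (A.src₂ x) (B.src₂ y))
        (C.hcomp (H.L₂ x (B.src₁ (B.src₂ y))) (H.R₂ (A.tgt₁ (A.src₂ x)) y)) := by
  have l : ∀ b, C.tgt₂ (H.L₂ x b) = H.L₁ (A.tgt₂ x) b := H.tgt_L₂ x
  have l' : ∀ b, C.src₂ (H.L₂ x b) = H.L₁ (A.src₂ x) b := H.src_L₂ x
  have r : ∀ a, C.tgt₂ (H.R₂ a y) = H.R₁ a (B.tgt₂ y) := fun a => H.tgt_R₂ a y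
  have r' : ∀ a, C.src₂ (H.R₂ a y) = H.R₁ a (B.src₂ y) := fun a => H.src_R₂ a y
  have nl := H.γ_natural_left x (B.tgt₂ y)
  have nr := H.γ_natural_right (A.src₂ x) y
  rw [B.tgt_tgt₂, B.src_tgt₂] at nl
  have c₁ : C.tgt₁ (H.R₁ (A.src₁ (A.src₂ x)) (B.src₂ y)) =
      C.src₁ (H.L₁ (A.src₂ x) (B.tgt₁ (B.src₂ y))) := by rw [H.tgt_R₁, H.src_L₁]
  have c₂ : C.tgt₁ (H.L₁ (A.src₂ x) (B.src₁ (B.src₂ y))) =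
      C.src₁ (H.R₁ (A.tgt₁ (A.src₂ x)) (B.src₂ y)) := by rw [H.tgt_L₁, H.src_R₁]
  have c₃ : C.tgt₁ (H.R₁ (A.src₁ (A.src₂ x)) (B.tgt₂ y)) =
      C.src₁ (H.L₁ (A.src₂ x) (B.tgt₁ (B.src₂ y))) := by rw [H.tgt_R₁, H.src_L₁, B.tgt_tgt₂]
  have c₄ : C.tgt₁ (H.L₁ (A.src₂ x) (B.src₁ (B.src₂ y))) =
      C.src₁ (H.R₁ (A.tgt₁ (A.src₂ x)) (B.tgt₂ y)) := by rw [H.tgt_L₁, H.src_R₁, B.src_tgt₂]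
  -- `i₁` and `i₂` factor the two horizontal composites so that `y` acts first and `x` second. Then
  -- `γ` slides past `x` by `nl` and past `y` by `nr`.
  have i₁ := C.interchange (H.R₂ (A.src₁ (A.src₂ x)) y)
    (C.id₂ (H.R₁ (A.src₁ (A.src₂ x)) (B.tgt₂ y)))
    (C.id₂ (H.L₁ (A.src₂ x) (B.tgt₁ (B.src₂ y)))) (H.L₂ x (B.tgt₁ (B.src₂ y)))
    (by rw [r, C.src_id₂]) (by rw [l', C.tgt_id₂]) (by rw [r', C.src_id₂, c₁])
  have i₂ := C.interchange (C.id₂ (H.L₁ (A.src₂ x) (B.src₁ (B.src₂ y))))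
    (H.L₂ x (B.src₁ (B.src₂ y))) (H.R₂ (A.tgt₁ (A.src₂ x)) y)
    (C.id₂ (H.R₁ (A.tgt₁ (A.src₂ x)) (B.tgt₂ y)))
    (by rw [l', C.tgt_id₂]) (by rw [r, C.src_id₂]) (by rw [r', C.src_id₂, c₂])
  rw [C.vcomp_id_of_eq (r _), C.id_vcomp_of_eq (l' _)] at i₁
  rw [C.vcomp_id_of_eq (r _), C.id_vcomp_of_eq (l' _)] at i₂
  rw [i₁, i₂, C.vcomp_assoc, nl, ← C.vcomp_assoc, nr, C.vcomp_assoc]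
  · rw [H.tgt_γ, C.src_hcomp _ _ (by rw [C.src_id₂, r', c₂]), C.src_id₂, r']
  · rw [C.tgt_hcomp _ _ (by rw [C.src_id₂, r', c₂]), C.tgt_id₂, r,
      C.src_hcomp _ _ (by rw [C.src_id₂, l', c₄]), C.src_id₂, l']
  · rw [H.src_γ, C.tgt_hcomp _ _ (by rw [C.src_id₂, r', c₁]), C.tgt_id₂, r, B.tgt_tgt₂]
  · rw [H.tgt_γ, C.src_hcomp _ _ (by rw [C.src_id₂, l', c₄]), C.src_id₂, l', B.src_tgt₂]
  · rw [C.tgt_hcomp _ _ (by rw [C.src_id₂, r', c₁]), C.tgt_id₂, r,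
      C.src_hcomp _ _ (by rw [C.src_id₂, l', c₃]), C.src_id₂, l']
  · rw [H.src_γ, C.tgt_hcomp _ _ (by rw [C.src_id₂, l', c₃]), C.tgt_id₂, l, B.tgt_tgt₂,
      A.src_tgt₂]

end GrayFunctor

/-! ### Operations on cells -/

namespace Cell

variable {O : Type u} {F K : O → O → Type v} {A B C : O}

theorem map_mk (op : ∀ {A B}, F A B → K A B) (x : F A B) :
    map @op (Cell.mk x) = Cell.mk (op x) :=
  rfl

/-- The partial operations compute once the cells are constructors whose objects match
definitionally. Later proofs destructure cells and eliminate the equations between objects until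
these lemmas apply. -/
theorem lift_mk (op : ∀ {A B}, F A B → F A B → F A B) (x y : F A B) :
    lift @op (Cell.mk x) (Cell.mk y) = Cell.mk (op x y) := by
  exact dif_pos (And.intro rfl rfl)

theorem join_mk (op : ∀ {A B C}, F A B → F B C → F A C) (x : F A B) (y : F B C) :
    join @op (Cell.mk x) (Cell.mk y) = Cell.mk (@op A B C x y) :=
  dif_pos rfl

theorem quad_mk (op : ∀ {A B C}, F A B → F A B → F B C → F B C → K A C) (junk : Cell K)
    (x x' : F A B) (y y' : F B C) :
    quad @op junk (Cell.mk x) (Cell.mk x') (Cell.mk y) (Cell.mk y') =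
      Cell.mk (@op A B C x x' y y') := by
  rw [quad, dif_pos ⟨rfl, rfl, rfl, rfl, rfl⟩]
  rfl

end Cell

namespace TrueGrayCat

variable {G : TrueGrayCat.{u, v}}

-- This set defines a normal form. Whiskering is distributed over all composites, `γ` of a composite
-- or of an identity is expanded, composites of arrows are bracketed to the right, and iterated
-- whiskerings become `f (α g)` with composite 1-cells on the right merged. A whiskered first
-- argument of `γ` passes its right factor to the second argument and its left factor to the
-- outside.
attribute [local simp] TwoCat.src_tgt₂ TwoCat.tgt_tgt₂ TwoCat.src_id₁ TwoCat.tgt_id₁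
  TwoCat.src_comp TwoCat.tgt_comp TwoCat.src_id₂ TwoCat.tgt_id₂ TwoCat.src_vcomp TwoCat.tgt_vcomp
  TwoCat.src_hcomp TwoCat.tgt_hcomp TwoCat.comp_assoc
  TwoCat.src₂_whisk TwoCat.tgt₂_whisk TwoCat.id_hcomp_whisk TwoCat.whisk_hcomp_id
  TwoCat.whisk_id_hcomp TwoCat.whisk_hcomp_id' TwoCat.whisk_vcomp
  TwoCat.id_comp_of_eq TwoCat.comp_id_of_eq
  GrayFunctor.src_L₁ GrayFunctor.tgt_L₁ GrayFunctor.src_R₁ GrayFunctor.tgt_R₁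
  GrayFunctor.src_L₂ GrayFunctor.tgt_L₂ GrayFunctor.src_R₂ GrayFunctor.tgt_R₂
  GrayFunctor.src_γ GrayFunctor.tgt_γ
  GrayFunctor.L₁_comp GrayFunctor.L₁_id GrayFunctor.L₂_id GrayFunctor.L₂_hcomp
  GrayFunctor.L₂_vcomp GrayFunctor.L₂_whisk
  GrayFunctor.R₁_comp GrayFunctor.R₁_id GrayFunctor.R₂_id GrayFunctor.R₂_hcomp
  GrayFunctor.R₂_vcomp GrayFunctor.R₂_whisk
  GrayFunctor.γ_comp_left GrayFunctor.γ_comp_right GrayFunctor.γ_id_left GrayFunctor.γ_id_right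
  ob_assoc L₁_L₁ L₁_R₁ R₁_ob L₂_L₂ L₂_R₂ R₂_ob L₂_γ γ_L₁ γ_R₁
  one_ob one_R₁ one_R₂ ob_one L₁_one L₂_one

/-! ### The interchanger for quintets -/

theorem symχ_eq_whisk {A A' B B' B'' C' C'' : G.Obj} (f : (G.hom A A').C0) (k : (G.hom A B).C0)
    (h' : (G.hom C' C'').C0) (l'' : (G.hom B'' C'').C0) (α : (G.hom A B').C1)
    (α' : (G.hom A' B'').C1) (β : (G.hom B C').C1) (β' : (G.hom B' C'').C1) :
    symχ f k h' l'' α α' β β' = (G.hom A C'').whisk (G.comp.R₁ k (G.comp.L₁ β h'))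
      (G.comp.γ α β') (G.comp.R₁ f (G.comp.L₁ α' l'')) := rfl

section

variable {A A' A'' B B' B'' C C' C'' : G.Obj}
  {f : (G.hom A A').C0} {k : (G.hom A B).C0} {k' : (G.hom A' B').C0}
  {g : (G.hom B B').C0} {α : (G.hom A B').C1}
  {f' : (G.hom A' A'').C0} {k'' : (G.hom A'' B'').C0}
  {g' : (G.hom B' B'').C0} {α' : (G.hom A' B'').C1}
  {l : (G.hom B C).C0} {l' : (G.hom B' C').C0}
  {h : (G.hom C C').C0} {β : (G.hom B C').C1}
  {l'' : (G.hom B'' C'').C0} {h' : (G.hom C' C'').C0} {β' : (G.hom B' C'').C1}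

theorem src₂_symχ (p : (G.hom A B').src₁ α = G.comp.ob k g)
    (q : (G.hom A B').tgt₁ α = G.comp.ob f k') (p' : (G.hom A' B'').src₁ α' = G.comp.ob k' g')
    (s : (G.hom B C').tgt₁ β = G.comp.ob g l')
    (r' : (G.hom B' C'').src₁ β' = G.comp.ob l' h')
    (s' : (G.hom B' C'').tgt₁ β' = G.comp.ob g' l'') :
    (G.hom A C'').src₂ (symχ f k h' l'' α α' β β') =
      (G.hom A C'').comp
        (G.comp.R₁ k ((G.hom B C'').comp (G.comp.L₁ β h') (G.comp.R₁ g β')))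
        (G.comp.L₁ ((G.hom A B'').comp (G.comp.L₁ α g') (G.comp.R₁ f α')) l'') := by
  rw [symχ_eq_whisk]
  -- Most rewrite rules require composability, and for nested composites these conditions generate
  -- further ones; hence the increased discharge depth, here and below.
  simp (maxDischargeDepth := 6) [p, q, p', s, r', s']

theorem tgt₂_symχ (p : (G.hom A B').src₁ α = G.comp.ob k g)
    (q : (G.hom A B').tgt₁ α = G.comp.ob f k') (p' : (G.hom A' B'').src₁ α' = G.comp.ob k' g')
    (s : (G.hom B C').tgt₁ β = G.comp.ob g l')
    (r' : (G.hom B' C'').src₁ β' = G.comp.ob l' h')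
    (s' : (G.hom B' C'').tgt₁ β' = G.comp.ob g' l'') :
    (G.hom A C'').tgt₂ (symχ f k h' l'' α α' β β') =
      (G.hom A C'').comp
        (G.comp.L₁ ((G.hom A C').comp (G.comp.R₁ k β) (G.comp.L₁ α l')) h')
        (G.comp.R₁ f ((G.hom A' C'').comp (G.comp.R₁ k' β') (G.comp.L₁ α' l''))) := by
  rw [symχ_eq_whisk]
  simp (maxDischargeDepth := 6) [p, q, p', s, r', s']

theorem symχ_natural {x : (G.hom A B').C2} {x' : (G.hom A' B'').C2} {y : (G.hom B C').C2}
    {y' : (G.hom B' C'').C2} (p : (G.hom A B').src₁ ((G.hom A B').src₂ x) = G.comp.ob k g)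
    (q : (G.hom A B').tgt₁ ((G.hom A B').src₂ x) = G.comp.ob f k')
    (p' : (G.hom A' B'').src₁ ((G.hom A' B'').src₂ x') = G.comp.ob k' g')
    (s : (G.hom B C').tgt₁ ((G.hom B C').src₂ y) = G.comp.ob g l')
    (r' : (G.hom B' C'').src₁ ((G.hom B' C'').src₂ y') = G.comp.ob l' h')
    (s' : (G.hom B' C'').tgt₁ ((G.hom B' C'').src₂ y') = G.comp.ob g' l'') :
    (G.hom A C'').vcomp
        ((G.hom A C'').hcomp
          (G.comp.R₂ k ((G.hom B C'').hcomp (G.comp.L₂ y h') (G.comp.R₂ g y')))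
          (G.comp.L₂ ((G.hom A B'').hcomp (G.comp.L₂ x g') (G.comp.R₂ f x')) l''))
        (symχ f k h' l'' ((G.hom A B').tgt₂ x) ((G.hom A' B'').tgt₂ x') ((G.hom B C').tgt₂ y)
          ((G.hom B' C'').tgt₂ y')) =
      (G.hom A C'').vcomp
        (symχ f k h' l'' ((G.hom A B').src₂ x) ((G.hom A' B'').src₂ x') ((G.hom B C').src₂ y)
          ((G.hom B' C'').src₂ y'))
        ((G.hom A C'').hcomp
          (G.comp.L₂ ((G.hom A C').hcomp (G.comp.R₂ k y) (G.comp.L₂ x l')) h')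
          (G.comp.R₂ f ((G.hom A' C'').hcomp (G.comp.R₂ k' y') (G.comp.L₂ x' l'')))) := by
  have e := G.comp.γ_natural x y'
  rw [p, q, r', s'] at e
  -- Only `x` and `y'` enter `γ`; the cubes `y` and `x'` act on the outer factors.
  have := TwoCat.hcomp_whisk_natural (z := G.comp.R₂ k (G.comp.L₂ y h'))
    (w := G.comp.R₂ f (G.comp.L₂ x' l''))
    (by simp [p, s, r', s']) (by simp [p, q, p', s']) (by simp [p, s']) (by simp [q, r']) e
  simp (maxDischargeDepth := 6) [TwoCat.hcomp_assoc, symχ_eq_whisk, p, q, p', s, r', s'] at this ⊢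
  exact this

/-- The outer factors of `χ` are already identities, so `χ` is an identity as soon as `γ(α, β')` is;
this happens when `α` or, in the next lemma, `β'` is an identity 2-cell. Nothing is needed of the
sides of the quintet. -/
theorem symχ_eq_id_of_left (p : (G.hom A B').src₁ α = G.comp.ob k g)
    (q : (G.hom A B').tgt₁ α = G.comp.ob f k') (p' : (G.hom A' B'').src₁ α' = G.comp.ob k' g')
    (s : (G.hom B C').tgt₁ β = G.comp.ob g l') (r' : (G.hom B' C'').src₁ β' = G.comp.ob l' h')
    (s' : (G.hom B' C'').tgt₁ β' = G.comp.ob g' l'') {z : (G.hom A B').C0}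
    (hα : α = (G.hom A B').id₁ z) :
    ∃ w, symχ f k h' l'' α α' β β' = (G.hom A C'').id₂ w := by
  subst hα
  rw [TwoCat.src_id₁] at p
  rw [TwoCat.tgt_id₁] at q
  -- The equation `z = f k'` is needed after whiskering by `g' l''`, in the right-bracketed form in
  -- which `simp` meets it.
  have q' := congrArg (fun t => G.comp.ob t (G.comp.ob g' l'')) q
  have p₂ := congrArg (fun t => G.comp.ob t (G.comp.ob g' l'')) p
  simp only [G.ob_assoc] at q' p₂
  rw [symχ_eq_whisk, GrayFunctor.γ_id_left, TwoCat.whisk_id]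
  · exact ⟨_, rfl⟩
  · simp [s, p, r']
  · simp [p', s', q']

theorem symχ_eq_id_of_right (p : (G.hom A B').src₁ α = G.comp.ob k g)
    (q : (G.hom A B').tgt₁ α = G.comp.ob f k') (p' : (G.hom A' B'').src₁ α' = G.comp.ob k' g')
    (s : (G.hom B C').tgt₁ β = G.comp.ob g l') (r' : (G.hom B' C'').src₁ β' = G.comp.ob l' h')
    (s' : (G.hom B' C'').tgt₁ β' = G.comp.ob g' l'') {z : (G.hom B' C'').C0}
    (hβ : β' = (G.hom B' C'').id₁ z) :
    ∃ w, symχ f k h' l'' α α' β β' = (G.hom A C'').id₂ w := by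
  subst hβ
  rw [TwoCat.src_id₁] at r'
  rw [TwoCat.tgt_id₁] at s'
  rw [symχ_eq_whisk, GrayFunctor.γ_id_right, TwoCat.whisk_id]
  · exact ⟨_, rfl⟩
  · simp [s, p, r']
  · simp [p', q, s']

variable {D D' D'' : G.Obj}
  {m : (G.hom C D).C0} {m' : (G.hom C' D').C0} {m'' : (G.hom C'' D'').C0}
  {j : (G.hom D D').C0} {j' : (G.hom D' D'').C0} {κ : (G.hom C D').C1} {κ' : (G.hom C' D'').C1}

/-- Expanding `γ(kβ · αl', κ')` on the left and `γ(α, l'κ' · β'm'')` on the right gives the factors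
`γ(α, β'm'')`, `k γ(β, κ')`, `γ(α, l'κ')` in this order on the left, and with the first two
exchanged on the right. Those two act on adjacent factors. -/
theorem symχ_vertical_assoc (p : (G.hom A B').src₁ α = G.comp.ob k g)
    (q : (G.hom A B').tgt₁ α = G.comp.ob f k') (p' : (G.hom A' B'').src₁ α' = G.comp.ob k' g')
    (r : (G.hom B C').src₁ β = G.comp.ob l h) (s : (G.hom B C').tgt₁ β = G.comp.ob g l')
    (r' : (G.hom B' C'').src₁ β' = G.comp.ob l' h')
    (s' : (G.hom B' C'').tgt₁ β' = G.comp.ob g' l'')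
    (w : (G.hom C D').tgt₁ κ = G.comp.ob h m')
    (t' : (G.hom C' D'').src₁ κ' = G.comp.ob m' j')
    (w' : (G.hom C' D'').tgt₁ κ' = G.comp.ob h' m'') :
    (G.hom A D'').vcomp
        ((G.hom A D'').hcomp
          (G.comp.R₂ (G.comp.ob k l)
            ((G.hom C D'').id₂ ((G.hom C D'').comp (G.comp.L₁ κ j') (G.comp.R₁ h κ'))))
          (G.comp.L₂ (symχ f k h' l'' α α' β β') m''))
        (symχ f (G.comp.ob k l) j' m'' ((G.hom A C').comp (G.comp.R₁ k β) (G.comp.L₁ α l'))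
          ((G.hom A' C'').comp (G.comp.R₁ k' β') (G.comp.L₁ α' l'')) κ κ') =
      (G.hom A D'').vcomp
        ((G.hom A D'').hcomp (G.comp.R₂ k (symχ g l j' m'' β β' κ κ'))
          (G.comp.L₂ ((G.hom A B'').id₂ ((G.hom A B'').comp (G.comp.L₁ α g') (G.comp.R₁ f α')))
            (G.comp.ob l'' m'')))
        (symχ f k j' (G.comp.ob l'' m'') α α'
          ((G.hom B D').comp (G.comp.R₁ l κ) (G.comp.L₁ β m'))
          ((G.hom B' D'').comp (G.comp.R₁ l' κ') (G.comp.L₁ β' m''))) := by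
  have sw := TwoCat.whisk_swap (a := G.comp.R₁ k (G.comp.R₁ l (G.comp.L₁ κ j')))
    (x := G.comp.R₂ k (G.comp.γ β κ')) (y := G.comp.γ α (G.comp.L₁ β' m''))
    (b := G.comp.R₁ f (G.comp.L₁ α' (G.comp.ob l'' m'')))
    (by simp [r, w, t', w']) (by simp [p, s, w', r', s']) (by simp [p', q, s'])
  simp (maxDischargeDepth := 6) [symχ_eq_whisk, p, q, p', r, s, r', s', w, t', w'] at sw ⊢
  rw [← TwoCat.vcomp_assoc, ← sw, TwoCat.vcomp_assoc]
  all_goals simp (maxDischargeDepth := 6) [p, q, p', r, s, r', s', w, t', w']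

end

section

variable {A A' A'' A₃ B B' B'' B₃ C C' C'' C₃ : G.Obj}
  {f : (G.hom A A').C0} {k : (G.hom A B).C0} {k' : (G.hom A' B').C0}
  {g : (G.hom B B').C0} {α : (G.hom A B').C1}
  {f' : (G.hom A' A'').C0} {k'' : (G.hom A'' B'').C0}
  {g' : (G.hom B' B'').C0} {α' : (G.hom A' B'').C1}
  {f'' : (G.hom A'' A₃).C0} {k₃ : (G.hom A₃ B₃).C0}
  {g'' : (G.hom B'' B₃).C0} {α'' : (G.hom A'' B₃).C1}
  {l : (G.hom B C).C0} {l' : (G.hom B' C').C0} {h : (G.hom C C').C0} {β : (G.hom B C').C1}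
  {l'' : (G.hom B'' C'').C0} {h' : (G.hom C' C'').C0} {β' : (G.hom B' C'').C1}
  {l₃ : (G.hom B₃ C₃).C0} {h'' : (G.hom C'' C₃).C0} {β'' : (G.hom B'' C₃).C1}

/-- Expanding `γ(αg' · fα', β'')` and `γ(α, β'h'' · g'β'')` gives `γ(α, g'β'')` as first factor on
both sides. The remaining factors are `f γ(α', β'')` and `γ(α, β'h'')`, in opposite orders, and they
act on adjacent factors. -/
theorem symχ_horizontal_assoc (p : (G.hom A B').src₁ α = G.comp.ob k g)
    (q : (G.hom A B').tgt₁ α = G.comp.ob f k') (p' : (G.hom A' B'').src₁ α' = G.comp.ob k' g')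
    (q' : (G.hom A' B'').tgt₁ α' = G.comp.ob f' k'')
    (p'' : (G.hom A'' B₃).src₁ α'' = G.comp.ob k'' g'')
    (s : (G.hom B C').tgt₁ β = G.comp.ob g l')
    (r' : (G.hom B' C'').src₁ β' = G.comp.ob l' h')
    (s' : (G.hom B' C'').tgt₁ β' = G.comp.ob g' l'')
    (r'' : (G.hom B'' C₃).src₁ β'' = G.comp.ob l'' h'')
    (s'' : (G.hom B'' C₃).tgt₁ β'' = G.comp.ob g'' l₃) :
    (G.hom A C₃).vcomp
        (symχ (G.comp.ob f f') k h'' l₃ ((G.hom A B'').comp (G.comp.L₁ α g') (G.comp.R₁ f α'))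
          α'' ((G.hom B C'').comp (G.comp.L₁ β h') (G.comp.R₁ g β')) β'')
        ((G.hom A C₃).hcomp (G.comp.L₂ (symχ f k h' l'' α α' β β') h'')
          (G.comp.R₂ (G.comp.ob f f') ((G.hom A'' C₃).id₂
            ((G.hom A'' C₃).comp (G.comp.R₁ k'' β'') (G.comp.L₁ α'' l₃))))) =
      (G.hom A C₃).vcomp
        (symχ f k (G.comp.ob h' h'') l₃ α
          ((G.hom A' B₃).comp (G.comp.L₁ α' g'') (G.comp.R₁ f' α''))
          β ((G.hom B' C₃).comp (G.comp.L₁ β' h'') (G.comp.R₁ g' β'')))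
        ((G.hom A C₃).hcomp
          (G.comp.L₂ ((G.hom A C').id₂
            ((G.hom A C').comp (G.comp.R₁ k β) (G.comp.L₁ α l'))) (G.comp.ob h' h''))
          (G.comp.R₂ f (symχ f' k' h'' l₃ α' α'' β' β''))) := by
  have sw := TwoCat.whisk_swap (a := G.comp.R₁ k (G.comp.L₁ β (G.comp.ob h' h'')))
    (x := G.comp.γ α (G.comp.L₁ β' h'')) (y := G.comp.R₂ f (G.comp.γ α' β''))
    (b := G.comp.R₁ f (G.comp.R₁ f' (G.comp.L₁ α'' l₃)))
    (by simp [p, s, r', s']) (by simp [q, p', s', r'', s'']) (by simp [p'', q', s''])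
  simp (maxDischargeDepth := 6) [symχ_eq_whisk, p, q, p', q', p'', s, r', s', r'', s''] at sw ⊢
  rw [TwoCat.vcomp_assoc, ← sw, TwoCat.vcomp_assoc]
  all_goals simp (maxDischargeDepth := 6) [p, q, p', q', p'', s, r', s', r'', s'']

end

/-! ### Quintets -/

section

variable {A A' A'' B B' B'' C C' C'' : G.Obj}

/-- The type of the 2-cell depends only on the corners `A` and `B'`. With fixed corners the sides
may therefore agree merely propositionally, as they do in the associativity and unit laws, while the
2-cells are still compared by an ordinary equation. -/
theorem Quintet.mk_congr {f f₂ : (G.hom A A').C0} {k k₂ : (G.hom A B).C0}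
    {k' k₂' : (G.hom A' B').C0} {g g₂ : (G.hom B B').C0} {α α₂ : (G.hom A B').C1} {p q p₂ q₂}
    (hf : f = f₂) (hk : k = k₂) (hk' : k' = k₂') (hg : g = g₂) (hα : α = α₂) :
    (⟨⟨f, k, k', g⟩, α, p, q⟩ : G.Quintet) = ⟨⟨f₂, k₂, k₂', g₂⟩, α₂, p₂, q₂⟩ := by
  subst hf hk hk' hg hα
  rfl

theorem Quintet₃.mk_congr {f f₂ : (G.hom A A').C0} {k k₂ : (G.hom A B).C0}
    {k' k₂' : (G.hom A' B').C0} {g g₂ : (G.hom B B').C0} {α α₂ : (G.hom A B').C2} {p q p₂ q₂}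
    (hf : f = f₂) (hk : k = k₂) (hk' : k' = k₂') (hg : g = g₂) (hα : α = α₂) :
    (⟨⟨f, k, k', g⟩, α, p, q⟩ : G.Quintet₃) = ⟨⟨f₂, k₂, k₂', g₂⟩, α₂, p₂, q₂⟩ := by
  subst hf hk hk' hg hα
  rfl

variable {f : (G.hom A A').C0} {k : (G.hom A B).C0} {k' : (G.hom A' B').C0}
  {g : (G.hom B B').C0} {f' : (G.hom A' A'').C0} {k'' : (G.hom A'' B'').C0}
  {g' : (G.hom B' B'').C0} {l : (G.hom B C).C0} {l' : (G.hom B' C').C0} {h : (G.hom C C').C0}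
  {l'' : (G.hom B'' C'').C0} {h' : (G.hom C' C'').C0}

theorem Quintet.hmul_mk {α : (G.hom A B').C1} {α' : (G.hom A' B'').C1}
    (p : (G.hom A B').src₁ α = G.comp.ob k g) (q : (G.hom A B').tgt₁ α = G.comp.ob f k')
    (p' : (G.hom A' B'').src₁ α' = G.comp.ob k' g')
    (q' : (G.hom A' B'').tgt₁ α' = G.comp.ob f' k'') :
    Quintet.hmul (⟨⟨f, k, k', g⟩, α, p, q⟩ : G.Quintet) ⟨⟨f', k', k'', g'⟩, α', p', q'⟩ =
      ⟨⟨G.comp.ob f f', k, k'', G.comp.ob g g'⟩,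
        (G.hom _ _).comp (G.comp.L₁ α g') (G.comp.R₁ f α'), src_hquint p q p',
        tgt_hquint q p' q'⟩ :=
  dif_pos rfl

theorem Quintet.vmul_mk {α : (G.hom A B').C1} {β : (G.hom B C').C1}
    (p : (G.hom A B').src₁ α = G.comp.ob k g) (q : (G.hom A B').tgt₁ α = G.comp.ob f k')
    (p' : (G.hom B C').src₁ β = G.comp.ob l h) (q' : (G.hom B C').tgt₁ β = G.comp.ob g l') :
    Quintet.vmul (⟨⟨f, k, k', g⟩, α, p, q⟩ : G.Quintet) ⟨⟨g, l, l', h⟩, β, p', q'⟩ =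
      ⟨⟨f, G.comp.ob k l, G.comp.ob k' l', h⟩,
        (G.hom _ _).comp (G.comp.R₁ k β) (G.comp.L₁ α l'), src_vquint p p' q',
        tgt_vquint p q q'⟩ :=
  dif_pos rfl

theorem Quintet₃.hmul_mk {x : (G.hom A B').C2} {x' : (G.hom A' B'').C2}
    (p : (G.hom A B').src₁ ((G.hom A B').src₂ x) = G.comp.ob k g)
    (q : (G.hom A B').tgt₁ ((G.hom A B').src₂ x) = G.comp.ob f k')
    (p' : (G.hom A' B'').src₁ ((G.hom A' B'').src₂ x') = G.comp.ob k' g')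
    (q' : (G.hom A' B'').tgt₁ ((G.hom A' B'').src₂ x') = G.comp.ob f' k'') :
    Quintet₃.hmul (⟨⟨f, k, k', g⟩, x, p, q⟩ : G.Quintet₃) ⟨⟨f', k', k'', g'⟩, x', p', q'⟩ =
      ⟨⟨G.comp.ob f f', k, k'', G.comp.ob g g'⟩,
        (G.hom _ _).hcomp (G.comp.L₂ x g') (G.comp.R₂ f x'),
        (congrArg _ (src_hquint₃ q p')).trans (src_hquint p q p'),
        (congrArg _ (src_hquint₃ q p')).trans (tgt_hquint q p' q')⟩ :=
  dif_pos rfl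

theorem Quintet₃.vmul_mk {x : (G.hom A B').C2} {y : (G.hom B C').C2}
    (p : (G.hom A B').src₁ ((G.hom A B').src₂ x) = G.comp.ob k g)
    (q : (G.hom A B').tgt₁ ((G.hom A B').src₂ x) = G.comp.ob f k')
    (p' : (G.hom B C').src₁ ((G.hom B C').src₂ y) = G.comp.ob l h)
    (q' : (G.hom B C').tgt₁ ((G.hom B C').src₂ y) = G.comp.ob g l') :
    Quintet₃.vmul (⟨⟨f, k, k', g⟩, x, p, q⟩ : G.Quintet₃) ⟨⟨g, l, l', h⟩, y, p', q'⟩ =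
      ⟨⟨f, G.comp.ob k l, G.comp.ob k' l', h⟩,
        (G.hom _ _).hcomp (G.comp.R₂ k y) (G.comp.L₂ x l'),
        (congrArg _ (src_vquint₃ p q')).trans (src_vquint p p' q'),
        (congrArg _ (src_vquint₃ p q')).trans (tgt_vquint p q q')⟩ :=
  dif_pos rfl

theorem Quintet₃.tcomp_mk {F : G.Frame} {x y : (G.hom F.A F.B').C2} {p q p' q'}
    (e : (G.hom F.A F.B').tgt₂ x = (G.hom F.A F.B').src₂ y) :
    Quintet₃.tcomp (⟨F, x, p, q⟩ : G.Quintet₃) ⟨F, y, p', q'⟩ =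
      ⟨F, (G.hom F.A F.B').vcomp x y, by rw [TwoCat.src_vcomp _ _ _ e, p],
        by rw [TwoCat.src_vcomp _ _ _ e, q]⟩ := by
  have e' : Quintet₃.cod (⟨F, x, p, q⟩ : G.Quintet₃) = Quintet₃.dom ⟨F, y, p', q'⟩ := by
    simp only [Quintet₃.cod, Quintet₃.dom, e]
  rw [Quintet₃.tcomp, dif_pos e']
  rfl

theorem Quintet₃.χ_mk {α : (G.hom A B').C1} {α' : (G.hom A' B'').C1} {β : (G.hom B C').C1}
    {β' : (G.hom B' C'').C1}
    (p : (G.hom A B').src₁ α = G.comp.ob k g) (q : (G.hom A B').tgt₁ α = G.comp.ob f k')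
    (p' : (G.hom A' B'').src₁ α' = G.comp.ob k' g')
    (q' : (G.hom A' B'').tgt₁ α' = G.comp.ob f' k'')
    (r : (G.hom B C').src₁ β = G.comp.ob l h) (s : (G.hom B C').tgt₁ β = G.comp.ob g l')
    (r' : (G.hom B' C'').src₁ β' = G.comp.ob l' h')
    (s' : (G.hom B' C'').tgt₁ β' = G.comp.ob g' l'') :
    Quintet₃.χ (⟨⟨f, k, k', g⟩, α, p, q⟩ : G.Quintet) ⟨⟨f', k', k'', g'⟩, α', p', q'⟩
        ⟨⟨g, l, l', h⟩, β, r, s⟩ ⟨⟨g', l', l'', h'⟩, β', r', s'⟩ =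
      ⟨⟨G.comp.ob f f', G.comp.ob k l, G.comp.ob k'' l'', G.comp.ob h h'⟩,
        symχ f k h' l'' α α' β β', src_src_symχ p q p' r s r' s',
        tgt_src_symχ p q p' q' s r' s'⟩ := by
  rw [Quintet₃.χ, dif_pos ⟨rfl, rfl, rfl, rfl⟩]
  rfl

end

/-! ### Strict internal categories of 1-cells and of quintets -/

theorem isInternalCategory_arrows (G : TrueGrayCat.{u, v}) : G.arrows.IsInternalCategory where
  isCategory := CatData.isCategory_discrete _
  assoc_eq _ _ _ := rfl
  lunit_eq _ := rfl
  runit_eq _ := rfl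
  isFunctor_src := ⟨fun _ => rfl, fun _ => rfl, fun _ => rfl, fun _ _ _ => rfl⟩
  isFunctor_tgt := ⟨fun _ => rfl, fun _ => rfl, fun _ => rfl, fun _ _ _ => rfl⟩
  isFunctor_unit := ⟨fun _ => rfl, fun _ => rfl, fun _ => rfl, fun _ _ _ => rfl⟩
  src_unit _ := rfl
  tgt_unit _ := rfl
  src_mul := by
    rintro ⟨f⟩ ⟨g⟩ h
    cases h
    simp only [Cell.join_mk]
  tgt_mul := by
    rintro ⟨f⟩ ⟨g⟩ h
    cases h
    simp only [Cell.join_mk]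
  dom_mulHom _ _ _ := rfl
  cod_mulHom _ _ _ := rfl
  mulHom_one _ _ _ := rfl
  mulHom_comp _ _ _ _ _ _ _ _ := rfl
  mulHom_assoc := by
    rintro ⟨f⟩ ⟨g⟩ ⟨h⟩ e e'
    cases e
    cases e'
    simp only [Cell.join_mk, ob_assoc]
  unit_mulHom := by
    rintro ⟨f⟩
    simp only [Cell.join_mk, one_ob]
  mulHom_unit := by
    rintro ⟨f⟩
    simp only [Cell.join_mk, ob_one]

theorem isCategory_quintetCat (G : TrueGrayCat.{u, v}) : G.quintetCat.IsCategory where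
  dom_one x := by
    obtain ⟨F, α, p, q⟩ := x
    simp [Quintet.one, Quintet₃.dom]
  cod_one x := by
    obtain ⟨F, α, p, q⟩ := x
    simp [Quintet.one, Quintet₃.cod]
  dom_comp x y e := by
    obtain ⟨F, x, p, q⟩ := x
    obtain ⟨F', y, p', q'⟩ := y
    simp only [Quintet₃.dom, Quintet₃.cod, Quintet.mk.injEq] at e
    -- The frames are variables, so their equality can be eliminated; the cells then have the same
    -- type and `e` becomes an ordinary equation.
    obtain ⟨rfl, e⟩ := e
    rw [heq_iff_eq] at e
    dsimp only
    rw [Quintet₃.tcomp_mk e]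
    simp [Quintet₃.dom, e]
  cod_comp x y e := by
    obtain ⟨F, x, p, q⟩ := x
    obtain ⟨F', y, p', q'⟩ := y
    simp only [Quintet₃.dom, Quintet₃.cod, Quintet.mk.injEq] at e
    obtain ⟨rfl, e⟩ := e
    rw [heq_iff_eq] at e
    dsimp only
    rw [Quintet₃.tcomp_mk e]
    simp [Quintet₃.cod, e]
  one_comp x := by
    obtain ⟨F, x, p, q⟩ := x
    simp [Quintet.one, Quintet₃.dom, Quintet₃.tcomp_mk, TwoCat.id_vcomp]
  comp_one x := by
    obtain ⟨F, x, p, q⟩ := x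
    simp [Quintet.one, Quintet₃.cod, Quintet₃.tcomp_mk, TwoCat.vcomp_id]
  assoc x y z e e' := by
    obtain ⟨F, x, p, q⟩ := x
    obtain ⟨F', y, p', q'⟩ := y
    obtain ⟨F'', z, p'', q''⟩ := z
    simp only [Quintet₃.dom, Quintet₃.cod, Quintet.mk.injEq] at e e'
    obtain ⟨rfl, e⟩ := e
    obtain ⟨rfl, e'⟩ := e'
    rw [heq_iff_eq] at e e'
    dsimp only
    rw [Quintet₃.tcomp_mk e, Quintet₃.tcomp_mk e', Quintet₃.tcomp_mk (by simp [e, e']),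
      Quintet₃.tcomp_mk (by simp [e, e'])]
    simp [TwoCat.vcomp_assoc, e, e']

theorem isInternalCategory_horizontalQuintets (G : TrueGrayCat.{u, v}) :
    G.horizontalQuintets.IsInternalCategory where
  isCategory := isCategory_quintetCat G
  assoc_eq _ _ _ := rfl
  lunit_eq _ := rfl
  runit_eq _ := rfl
  isFunctor_src := by
    refine ⟨fun _ => rfl, fun _ => rfl, fun _ => rfl, ?_⟩
    rintro ⟨F, x, p, q⟩ ⟨F', y, p', q'⟩ e
    simp only [Quintet₃.dom, Quintet₃.cod, Quintet.mk.injEq] at e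
    obtain ⟨rfl, e⟩ := e
    dsimp only
    rw [Quintet₃.tcomp_mk (eq_of_heq e)]
  isFunctor_tgt := by
    refine ⟨fun _ => rfl, fun _ => rfl, fun _ => rfl, ?_⟩
    rintro ⟨F, x, p, q⟩ ⟨F', y, p', q'⟩ e
    simp only [Quintet₃.dom, Quintet₃.cod, Quintet.mk.injEq] at e
    obtain ⟨rfl, e⟩ := e
    dsimp only
    rw [Quintet₃.tcomp_mk (eq_of_heq e)]
  isFunctor_unit := by
    refine ⟨fun k => ?_, fun k => ?_, fun _ => rfl, fun k k' e => ?_⟩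
    · exact (isCategory_quintetCat G).dom_one _
    · exact (isCategory_quintetCat G).cod_one _
    -- Composable arrows of a discrete category are equal.
    · cases e
      exact ((isCategory_quintetCat G).one_comp_one _).symm
  src_unit _ := rfl
  tgt_unit _ := rfl
  src_mul := by
    rintro ⟨⟨f, k, k', g⟩, α, p, q⟩ ⟨⟨f', k₁, k'', g'⟩, α', p', q'⟩ e
    cases e
    dsimp only
    rw [Quintet.hmul_mk]
    rfl
  tgt_mul := by
    rintro ⟨⟨f, k, k', g⟩, α, p, q⟩ ⟨⟨f', k₁, k'', g'⟩, α', p', q'⟩ e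
    cases e
    dsimp only
    rw [Quintet.hmul_mk]
    rfl
  dom_mulHom := by
    rintro ⟨⟨f, k, k', g⟩, x, p, q⟩ ⟨⟨f', k₁, k'', g'⟩, x', p', q'⟩ e
    cases e
    dsimp only
    rw [Quintet₃.hmul_mk]
    simp only [Quintet₃.dom]
    rw [Quintet.hmul_mk]
    exact Quintet.mk_congr rfl rfl rfl rfl (by simp [q, p'])
  cod_mulHom := by
    rintro ⟨⟨f, k, k', g⟩, x, p, q⟩ ⟨⟨f', k₁, k'', g'⟩, x', p', q'⟩ e
    cases e
    dsimp only
    rw [Quintet₃.hmul_mk]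
    simp only [Quintet₃.cod]
    rw [Quintet.hmul_mk]
    exact Quintet.mk_congr rfl rfl rfl rfl (by simp [q, p'])
  mulHom_one := by
    rintro ⟨⟨f, k, k', g⟩, α, p, q⟩ ⟨⟨f', k₁, k'', g'⟩, α', p', q'⟩ e
    cases e
    dsimp only
    rw [Quintet.hmul_mk]
    simp only [Quintet.one]
    rw [Quintet₃.hmul_mk]
    exact Quintet₃.mk_congr rfl rfl rfl rfl (by simp [q, p', TwoCat.hcomp_id₂])
  mulHom_comp := by
    rintro ⟨F, x, p, q⟩ ⟨F', x', p', q'⟩ ⟨K, y, r, s⟩ ⟨K', y', r', s'⟩ e e' h h'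
    simp only [Quintet₃.dom, Quintet₃.cod, Quintet.mk.injEq] at e e'
    obtain ⟨rfl, e⟩ := e
    obtain ⟨rfl, e'⟩ := e'
    rw [heq_iff_eq] at e e'
    obtain ⟨f, k, k', g⟩ := F
    obtain ⟨f', k₁, k'', g'⟩ := K
    cases h
    dsimp only at p q r s p' q' r' s' e e' ⊢
    rw [Quintet₃.tcomp_mk e, Quintet₃.tcomp_mk e', Quintet₃.hmul_mk, Quintet₃.hmul_mk,
      Quintet₃.hmul_mk, Quintet₃.tcomp_mk]
    · refine Quintet₃.mk_congr rfl rfl rfl rfl ?_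
      rw [GrayFunctor.L₂_vcomp _ _ _ _ e, GrayFunctor.R₂_vcomp _ _ _ _ e', TwoCat.interchange] <;>
        simp [e, e', q, r]
    · simp [e, e', q, r, q', r']
  mulHom_assoc := by
    rintro ⟨⟨f, k, k', g⟩, x, p, q⟩ ⟨⟨f', k₁, k'', g'⟩, x', p', q'⟩
      ⟨⟨f'', k₂, k₃, g''⟩, x'', p'', q''⟩ e e'
    cases e
    cases e'
    dsimp only
    rw [Quintet₃.hmul_mk, Quintet₃.hmul_mk, Quintet₃.hmul_mk, Quintet₃.hmul_mk]
    refine Quintet₃.mk_congr (G.ob_assoc _ _ _) rfl rfl (G.ob_assoc _ _ _) ?_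
    simp (maxDischargeDepth := 6) [q, p', q', p'', TwoCat.hcomp_assoc]
  unit_mulHom := by
    rintro ⟨@⟨A, A', B, B', f, k, k', g⟩, x, p, q⟩
    refine (Quintet₃.hmul_mk _ _ p q).trans ?_
    refine Quintet₃.mk_congr (G.one_ob _) rfl rfl (G.one_ob _) ?_
    -- Unfolding the unit quintet exhibits the left factor as a whiskered identity, which `simp`
    -- turns into an identity.
    change (G.hom A B').hcomp (G.comp.L₂ ((G.hom A B).id₂ ((G.hom A B).id₁ k)) g)
      (G.comp.R₂ (G.one A) x) = x
    simp [TwoCat.id_hcomp_of_eq, p]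
  mulHom_unit := by
    rintro ⟨@⟨A, A', B, B', f, k, k', g⟩, x, p, q⟩
    refine (Quintet₃.hmul_mk p q _ _).trans ?_
    refine Quintet₃.mk_congr (G.ob_one _) rfl rfl (G.ob_one _) ?_
    change (G.hom A B').hcomp (G.comp.L₂ x (G.one B'))
      (G.comp.R₂ f ((G.hom A' B').id₂ ((G.hom A' B').id₁ k'))) = x
    simp [TwoCat.hcomp_id_of_eq, q]

theorem isInternalCategory_verticalQuintets (G : TrueGrayCat.{u, v}) :
    G.verticalQuintets.IsInternalCategory where
  isCategory := isCategory_quintetCat G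
  assoc_eq _ _ _ := rfl
  lunit_eq _ := rfl
  runit_eq _ := rfl
  isFunctor_src := by
    refine ⟨fun _ => rfl, fun _ => rfl, fun _ => rfl, ?_⟩
    rintro ⟨F, x, p, q⟩ ⟨F', y, p', q'⟩ e
    simp only [Quintet₃.dom, Quintet₃.cod, Quintet.mk.injEq] at e
    obtain ⟨rfl, e⟩ := e
    dsimp only
    rw [Quintet₃.tcomp_mk (eq_of_heq e)]
  isFunctor_tgt := by
    refine ⟨fun _ => rfl, fun _ => rfl, fun _ => rfl, ?_⟩
    rintro ⟨F, x, p, q⟩ ⟨F', y, p', q'⟩ e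
    simp only [Quintet₃.dom, Quintet₃.cod, Quintet.mk.injEq] at e
    obtain ⟨rfl, e⟩ := e
    dsimp only
    rw [Quintet₃.tcomp_mk (eq_of_heq e)]
  isFunctor_unit := by
    refine ⟨fun k => ?_, fun k => ?_, fun _ => rfl, fun k k' e => ?_⟩
    · exact (isCategory_quintetCat G).dom_one _
    · exact (isCategory_quintetCat G).cod_one _
    · cases e
      exact ((isCategory_quintetCat G).one_comp_one _).symm
  src_unit _ := rfl
  tgt_unit _ := rfl
  src_mul := by
    rintro ⟨⟨f, k, k', g⟩, α, p, q⟩ ⟨⟨g₁, l, l', h⟩, β, p', q'⟩ e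
    cases e
    dsimp only
    rw [Quintet.vmul_mk]
    rfl
  tgt_mul := by
    rintro ⟨⟨f, k, k', g⟩, α, p, q⟩ ⟨⟨g₁, l, l', h⟩, β, p', q'⟩ e
    cases e
    dsimp only
    rw [Quintet.vmul_mk]
    rfl
  dom_mulHom := by
    rintro ⟨⟨f, k, k', g⟩, x, p, q⟩ ⟨⟨g₁, l, l', h⟩, y, p', q'⟩ e
    cases e
    dsimp only
    rw [Quintet₃.vmul_mk]
    simp only [Quintet₃.dom]
    rw [Quintet.vmul_mk]
    exact Quintet.mk_congr rfl rfl rfl rfl (by simp [p, q'])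
  cod_mulHom := by
    rintro ⟨⟨f, k, k', g⟩, x, p, q⟩ ⟨⟨g₁, l, l', h⟩, y, p', q'⟩ e
    cases e
    dsimp only
    rw [Quintet₃.vmul_mk]
    simp only [Quintet₃.cod]
    rw [Quintet.vmul_mk]
    exact Quintet.mk_congr rfl rfl rfl rfl (by simp [p, q'])
  mulHom_one := by
    rintro ⟨⟨f, k, k', g⟩, α, p, q⟩ ⟨⟨g₁, l, l', h⟩, β, p', q'⟩ e
    cases e
    dsimp only
    rw [Quintet.vmul_mk]
    simp only [Quintet.one]
    rw [Quintet₃.vmul_mk]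
    exact Quintet₃.mk_congr rfl rfl rfl rfl (by simp [p, q', TwoCat.hcomp_id₂])
  mulHom_comp := by
    rintro ⟨F, x, p, q⟩ ⟨F', x', p', q'⟩ ⟨K, y, r, s⟩ ⟨K', y', r', s'⟩ e e' h h'
    simp only [Quintet₃.dom, Quintet₃.cod, Quintet.mk.injEq] at e e'
    obtain ⟨rfl, e⟩ := e
    obtain ⟨rfl, e'⟩ := e'
    rw [heq_iff_eq] at e e'
    obtain ⟨f, k, k', g⟩ := F
    obtain ⟨g₁, l, l', h⟩ := K
    cases h
    dsimp only at p q r s p' q' r' s' e e' ⊢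
    rw [Quintet₃.tcomp_mk e, Quintet₃.tcomp_mk e', Quintet₃.vmul_mk, Quintet₃.vmul_mk,
      Quintet₃.vmul_mk, Quintet₃.tcomp_mk]
    · refine Quintet₃.mk_congr rfl rfl rfl rfl ?_
      rw [GrayFunctor.L₂_vcomp _ _ _ _ e, GrayFunctor.R₂_vcomp _ _ _ _ e', TwoCat.interchange] <;>
        simp [e, e', p, s]
    · simp [e, e', p, s, p', s']
  mulHom_assoc := by
    rintro ⟨⟨f, k, k', g⟩, x, p, q⟩ ⟨⟨g₁, l, l', h⟩, y, p', q'⟩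
      ⟨⟨h₁, m, m', j⟩, z, p'', q''⟩ e e'
    cases e
    cases e'
    dsimp only
    rw [Quintet₃.vmul_mk, Quintet₃.vmul_mk, Quintet₃.vmul_mk, Quintet₃.vmul_mk]
    refine Quintet₃.mk_congr rfl (G.ob_assoc _ _ _) (G.ob_assoc _ _ _) rfl ?_
    simp (maxDischargeDepth := 6) [p, q', p', q'', TwoCat.hcomp_assoc]
  unit_mulHom := by
    rintro ⟨@⟨A, A', B, B', f, k, k', g⟩, x, p, q⟩
    refine (Quintet₃.vmul_mk _ _ p q).trans ?_
    refine Quintet₃.mk_congr rfl (G.one_ob _) (G.one_ob _) rfl ?_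
    change (G.hom A B').hcomp (G.comp.R₂ (G.one A) x)
      (G.comp.L₂ ((G.hom A A').id₂ ((G.hom A A').id₁ f)) k') = x
    simp [TwoCat.hcomp_id_of_eq, q]
  mulHom_unit := by
    rintro ⟨@⟨A, A', B, B', f, k, k', g⟩, x, p, q⟩
    refine (Quintet₃.vmul_mk p q _ _).trans ?_
    refine Quintet₃.mk_congr rfl (G.ob_one _) (G.ob_one _) rfl ?_
    change (G.hom A B').hcomp (G.comp.R₂ k ((G.hom B B').id₂ ((G.hom B B').id₁ g)))
      (G.comp.L₂ x (G.one B')) = x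
    simp [TwoCat.id_hcomp_of_eq, p]

theorem arrows_mul_mk {A B C : G.Obj} (f : (G.hom A B).C0) (g : (G.hom B C).C0) :
    G.arrows.mul ⟨f⟩ ⟨g⟩ = ⟨G.comp.ob f g⟩ :=
  Cell.join_mk _ _ _

/-! ### Interchangers of quintets with an identity 2-cell -/

section

variable {a b c d : G.Quintet}

/-- The hypothesis concerns only the 2-cell of `a`, so one lemma serves horizontal units, vertical
units and commutativity cells. -/
theorem isIdentity_χ_of_left (h : G.sym.Grid a b c d) {z : (G.hom a.frame.A a.frame.B').C0}
    (ha : a.cell = (G.hom _ _).id₁ z) : G.quintetCat.IsIdentity (Quintet₃.χ a b c d) := by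
  obtain ⟨⟨f, k, k', g⟩, α, p, q⟩ := a
  obtain ⟨⟨f', k₁, k'', g'⟩, α', p', q'⟩ := b
  obtain ⟨⟨g₁, l, l', h⟩, β, r, s⟩ := c
  obtain ⟨⟨g₂, l₂, l'', h'⟩, β', r', s'⟩ := d
  obtain ⟨e₁, e₂, e₃, e₄⟩ := h
  cases e₁
  cases e₂
  cases e₃
  cases e₄
  dsimp only at p q p' q' r s r' s' ha
  obtain ⟨w, hw⟩ := symχ_eq_id_of_left p q p' s r' s' ha
  -- To be an identity in `quintetCat`, `χ` must be the identity of a quintet; `h₁` and `h₂` give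
  -- the boundary of `w` that makes it one.
  have h₁ := src_src_symχ p q p' r s r' s'
  have h₂ := tgt_src_symχ p q p' q' s r' s'
  rw [hw, TwoCat.src_id₂] at h₁ h₂
  exact ⟨⟨_, w, h₁, h₂⟩, (Quintet₃.χ_mk p q p' q' r s r' s').trans
    (Quintet₃.mk_congr rfl rfl rfl rfl hw)⟩

theorem isIdentity_χ_of_right (h : G.sym.Grid a b c d) {z : (G.hom d.frame.A d.frame.B').C0}
    (hd : d.cell = (G.hom _ _).id₁ z) : G.quintetCat.IsIdentity (Quintet₃.χ a b c d) := by
  obtain ⟨⟨f, k, k', g⟩, α, p, q⟩ := a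
  obtain ⟨⟨f', k₁, k'', g'⟩, α', p', q'⟩ := b
  obtain ⟨⟨g₁, l, l', h⟩, β, r, s⟩ := c
  obtain ⟨⟨g₂, l₂, l'', h'⟩, β', r', s'⟩ := d
  obtain ⟨e₁, e₂, e₃, e₄⟩ := h
  cases e₁
  cases e₂
  cases e₃
  cases e₄
  dsimp only at p q p' q' r s r' s' hd
  obtain ⟨w, hw⟩ := symχ_eq_id_of_right p q p' s r' s' hd
  have h₁ := src_src_symχ p q p' r s r' s'
  have h₂ := tgt_src_symχ p q p' q' s r' s'
  rw [hw, TwoCat.src_id₂] at h₁ h₂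
  exact ⟨⟨_, w, h₁, h₂⟩, (Quintet₃.χ_mk p q p' q' r s r' s').trans
    (Quintet₃.mk_congr rfl rfl rfl rfl hw)⟩

end

/-! ### The symmetric intercategory -/

theorem isStrictChiral_sym (G : TrueGrayCat.{u, v}) :
    IntercatData.IsStrictChiral G.arrows G.arrows G.horizontalQuintets G.verticalQuintets
      Quintet₃.χ where
  internal_H₀ := isInternalCategory_arrows G
  internal_V₀ := isInternalCategory_arrows G
  internal_H₁ := isInternalCategory_horizontalQuintets G
  internal_V₁ := isInternalCategory_verticalQuintets G
  src_src _ := rfl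
  tgt_src _ := rfl
  src_tgt _ := rfl
  tgt_tgt _ := rfl
  hsrc_unit _ := rfl
  htgt_unit _ := rfl
  vsrc_unit _ := rfl
  vtgt_unit _ := rfl
  hsrc_mul := by
    rintro ⟨⟨f, k, k', g⟩, α, p, q⟩ ⟨⟨g₁, l, l', h⟩, β, p', q'⟩ e
    cases e
    dsimp only
    rw [Quintet.vmul_mk]
    exact (arrows_mul_mk k l).symm
  htgt_mul := by
    rintro ⟨⟨f, k, k', g⟩, α, p, q⟩ ⟨⟨g₁, l, l', h⟩, β, p', q'⟩ e
    cases e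
    dsimp only
    rw [Quintet.vmul_mk]
    exact (arrows_mul_mk k' l').symm
  vsrc_mul := by
    rintro ⟨⟨f, k, k', g⟩, α, p, q⟩ ⟨⟨f', k₁, k'', g'⟩, α', p', q'⟩ e
    cases e
    dsimp only
    rw [Quintet.hmul_mk]
    exact (arrows_mul_mk f f').symm
  vtgt_mul := by
    rintro ⟨⟨f, k, k', g⟩, α, p, q⟩ ⟨⟨f', k₁, k'', g'⟩, α', p', q'⟩ e
    cases e
    dsimp only
    rw [Quintet.hmul_mk]
    exact (arrows_mul_mk g g').symm
  mul_vunit := by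
    rintro @⟨A, B, f⟩ @⟨B, C, g⟩ e
    cases e
    rw [arrows_mul_mk]
    refine (Quintet.hmul_mk _ _ _ _).trans (Quintet.mk_congr rfl rfl rfl rfl ?_)
    change (G.hom A C).comp (G.comp.L₁ ((G.hom A B).id₁ f) g)
      (G.comp.R₁ f ((G.hom B C).id₁ g)) = (G.hom A C).id₁ (G.comp.ob f g)
    simp
  mul_hunit := by
    rintro @⟨A, B, f⟩ @⟨B, C, g⟩ e
    cases e
    rw [arrows_mul_mk]
    refine (Quintet.vmul_mk _ _ _ _).trans (Quintet.mk_congr rfl rfl rfl rfl ?_)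
    change (G.hom A C).comp (G.comp.R₁ f ((G.hom B C).id₁ g))
      (G.comp.L₁ ((G.hom A B).id₁ f) g) = (G.hom A C).id₁ (G.comp.ob f g)
    simp
  vunit_hunit _ := rfl
  dom_χ := by
    rintro ⟨⟨f, k, k', g⟩, α, p, q⟩ ⟨⟨f', k₁, k'', g'⟩, α', p', q'⟩ ⟨⟨g₁, l, l', h⟩, β, r, s⟩
      ⟨⟨g₂, l₂, l'', h'⟩, β', r', s'⟩ ⟨e₁, e₂, e₃, e₄⟩
    cases e₁
    cases e₂
    cases e₃
    cases e₄
    dsimp only at p q p' q' r s r' s' ⊢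
    rw [Quintet₃.χ_mk, Quintet.hmul_mk, Quintet.hmul_mk, Quintet.vmul_mk]
    exact Quintet.mk_congr rfl rfl rfl rfl (src₂_symχ p q p' s r' s')
  cod_χ := by
    rintro ⟨⟨f, k, k', g⟩, α, p, q⟩ ⟨⟨f', k₁, k'', g'⟩, α', p', q'⟩ ⟨⟨g₁, l, l', h⟩, β, r, s⟩
      ⟨⟨g₂, l₂, l'', h'⟩, β', r', s'⟩ ⟨e₁, e₂, e₃, e₄⟩
    cases e₁
    cases e₂
    cases e₃
    cases e₄
    dsimp only at p q p' q' r s r' s' ⊢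
    rw [Quintet₃.χ_mk, Quintet.vmul_mk, Quintet.vmul_mk, Quintet.hmul_mk]
    exact Quintet.mk_congr rfl rfl rfl rfl (tgt₂_symχ p q p' s r' s')
  natural_χ := by
    rintro ⟨⟨f, k, k', g⟩, x, p, q⟩ ⟨⟨f', k₁, k'', g'⟩, x', p', q'⟩ ⟨⟨g₁, l, l', h⟩, y, r, s⟩
      ⟨⟨g₂, l₂, l'', h'⟩, y', r', s'⟩ ⟨e₁, e₂, e₃, e₄⟩
    cases e₁
    cases e₂
    cases e₃
    cases e₄
    dsimp only at p q p' q' r s r' s' ⊢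
    simp only [Quintet₃.dom, Quintet₃.cod]
    rw [Quintet₃.χ_mk, Quintet₃.χ_mk, Quintet₃.hmul_mk, Quintet₃.hmul_mk, Quintet₃.vmul_mk,
      Quintet₃.vmul_mk, Quintet₃.vmul_mk, Quintet₃.hmul_mk, Quintet₃.tcomp_mk, Quintet₃.tcomp_mk]
    · exact Quintet₃.mk_congr rfl rfl rfl rfl (symχ_natural p q p' s r' s')
    · simp (maxDischargeDepth := 6) [symχ_eq_whisk, p, q, p', s, r', s']
    · simp (maxDischargeDepth := 6) [symχ_eq_whisk, p, q, p', s, r', s']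
  χ_vertical_assoc := by
    rintro ⟨⟨f, k, k', g⟩, α, p, q⟩ ⟨⟨f', k₁, k'', g'⟩, α', p', q'⟩ ⟨⟨g₁, l, l', h⟩, β, r, s⟩
      ⟨⟨g₂, l₂, l'', h'⟩, β', r', s'⟩ ⟨⟨h₁, m, m', j⟩, κ, t, w⟩ ⟨⟨h₂, m₂, m'', j'⟩, κ', t', w'⟩
      ⟨e₁, e₂, e₃, e₄⟩ ⟨e₅, e₆, e₇, e₈⟩
    cases e₁
    cases e₂
    cases e₃
    cases e₄
    -- `e₅` repeats `e₂`, since the middle row belongs to both grids.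
    cases e₆
    cases e₇
    cases e₈
    dsimp only at p q p' q' r s r' s' t w t' w' ⊢
    rw [Quintet₃.χ_mk, Quintet.hmul_mk, Quintet.vmul_mk, Quintet.vmul_mk, Quintet₃.χ_mk,
      Quintet₃.χ_mk, Quintet.hmul_mk, Quintet.vmul_mk, Quintet.vmul_mk, Quintet₃.χ_mk]
    simp only [Quintet.one]
    rw [Quintet₃.vmul_mk, Quintet₃.vmul_mk, Quintet₃.tcomp_mk, Quintet₃.tcomp_mk]
    · exact Quintet₃.mk_congr rfl (G.ob_assoc _ _ _) (G.ob_assoc _ _ _) rfl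
        (symχ_vertical_assoc p q p' r s r' s' w t' w')
    · simp (maxDischargeDepth := 6) [symχ_eq_whisk, p, q, p', r, s, r', s', w, t', w']
    · simp (maxDischargeDepth := 6) [symχ_eq_whisk, p, q, p', r, s, r', s', w, t', w']
  χ_horizontal_assoc := by
    rintro ⟨⟨f, k, k', g⟩, α, p, q⟩ ⟨⟨f', k₁, k'', g'⟩, α', p', q'⟩
      ⟨⟨f'', k₂, k₃, g''⟩, α'', p'', q''⟩ ⟨⟨g₁, l, l', h⟩, β, r, s⟩
      ⟨⟨g₂, l₂, l'', h'⟩, β', r', s'⟩ ⟨⟨g₃, l₄, l₃, h''⟩, β'', r'', s''⟩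
      ⟨e₁, e₂, e₃, e₄⟩ ⟨e₅, e₆, e₇, e₈⟩
    cases e₁
    cases e₂
    cases e₃
    cases e₄
    cases e₅
    cases e₆
    cases e₈
    dsimp only at p q p' q' p'' q'' r s r' s' r'' s'' ⊢
    rw [Quintet.hmul_mk, Quintet.hmul_mk, Quintet₃.χ_mk, Quintet₃.χ_mk, Quintet.vmul_mk,
      Quintet.hmul_mk, Quintet.hmul_mk, Quintet₃.χ_mk, Quintet₃.χ_mk, Quintet.vmul_mk]
    -- The identity cubes are unfolded to constructors so that the computation rules for composites
    -- apply to them.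
    simp only [Quintet.one]
    rw [Quintet₃.hmul_mk, Quintet₃.hmul_mk, Quintet₃.tcomp_mk, Quintet₃.tcomp_mk]
    · exact Quintet₃.mk_congr (G.ob_assoc _ _ _) rfl rfl (G.ob_assoc _ _ _)
        (symχ_horizontal_assoc p q p' q' p'' s r' s' r'' s'')
    · simp (maxDischargeDepth := 6) [symχ_eq_whisk, p, q, p', q', p'', s, r', s', r'', s'']
    · simp (maxDischargeDepth := 6) [symχ_eq_whisk, p, q, p', q', p'', s, r', s', r'', s'']
  -- Each unit condition fills a row or a column with units, and any row or column contains the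
  -- upper left or the lower right cell, the two that enter `γ`.
  χ_vunit_left _ _ _ _ h := isIdentity_χ_of_left h rfl
  χ_vunit_right _ _ _ _ h := isIdentity_χ_of_right h rfl
  χ_hunit_left _ _ _ _ h := isIdentity_χ_of_left h rfl
  χ_hunit_right _ _ _ _ h := isIdentity_χ_of_right h rfl

/-! ### Connecting cells and commutativity cells -/

/-- All cells involved contain identity 2-cells, and whiskerings and composites of identities are
identities. What remains is to match the frames, by the unit laws for 1-cells. -/
theorem isConnection_symConnection (G : TrueGrayCat.{u, v}) :
    G.symConnection.IsConnection where
  src_star _ := rfl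
  tgt_star _ := rfl
  ε_top _ := rfl
  ε_left _ := rfl
  ε_right _ := rfl
  ε_bottom _ := rfl
  η_top _ := rfl
  η_left _ := rfl
  η_right _ := rfl
  η_bottom _ := rfl
  η_hcomp_ε := by
    rintro @⟨A, B, k⟩
    refine (Quintet.hmul_mk _ _ _ _).trans
      (Quintet.mk_congr (G.one_ob _) rfl rfl (G.ob_one _) ?_)
    change (G.hom A B).comp (G.comp.L₁ ((G.hom A B).id₁ k) (G.one B))
      (G.comp.R₁ (G.one A) ((G.hom A B).id₁ k)) = (G.hom A B).id₁ k
    simp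
  η_vcomp_ε := by
    rintro @⟨A, B, k⟩
    refine (Quintet.vmul_mk _ _ _ _).trans
      (Quintet.mk_congr rfl (G.one_ob _) (G.ob_one _) rfl ?_)
    change (G.hom A B).comp (G.comp.R₁ (G.one A) ((G.hom A B).id₁ k))
      (G.comp.L₁ ((G.hom A B).id₁ k) (G.one B)) = (G.hom A B).id₁ k
    simp
  star_unit _ := rfl
  ε_unit _ := rfl
  η_unit _ := rfl
  star_mul _ _ _ := rfl
  ε_mul := by
    rintro @⟨A, B, k⟩ @⟨B, C, l⟩ e
    cases e
    -- The composite 1-cell has to be a constructor before the connecting cell over it unfolds.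
    rw [show G.sym.V₀.mul ⟨k⟩ ⟨l⟩ = _ from arrows_mul_mk k l]
    refine (congrArg₂ Quintet.vmul (Quintet.hmul_mk _ _ _ _) (Quintet.hmul_mk _ _ _ _)).trans
      ((Quintet.vmul_mk _ _ _ _).trans
        (Quintet.mk_congr rfl rfl (G.one_ob _) (G.one_ob _) ?_))
    change (G.hom A C).comp
      (G.comp.R₁ k ((G.hom B C).comp (G.comp.L₁ ((G.hom B C).id₁ l) (G.one C))
        (G.comp.R₁ (G.one B) ((G.hom B C).id₁ l))))
      (G.comp.L₁ ((G.hom A C).comp (G.comp.L₁ ((G.hom A B).id₁ k) l)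
        (G.comp.R₁ k ((G.hom B C).id₁ l))) (G.one C)) = (G.hom A C).id₁ (G.comp.ob k l)
    simp
  η_mul := by
    rintro @⟨A, B, k⟩ @⟨B, C, l⟩ e
    cases e
    rw [show G.sym.V₀.mul ⟨k⟩ ⟨l⟩ = _ from arrows_mul_mk k l]
    refine (congrArg₂ Quintet.vmul (Quintet.hmul_mk _ _ _ _) (Quintet.hmul_mk _ _ _ _)).trans
      ((Quintet.vmul_mk _ _ _ _).trans
        (Quintet.mk_congr (G.one_ob _) (G.one_ob _) rfl rfl ?_))
    change (G.hom A C).comp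
      (G.comp.R₁ (G.one A) ((G.hom A C).comp (G.comp.L₁ ((G.hom A B).id₁ k) l)
        (G.comp.R₁ k ((G.hom B C).id₁ l))))
      (G.comp.L₁ ((G.hom A B).comp (G.comp.L₁ ((G.hom A B).id₁ k) (G.one B))
        (G.comp.R₁ (G.one A) ((G.hom A B).id₁ k))) l) = (G.hom A C).id₁ (G.comp.ob k l)
    simp

/-- In `η | a | ε` the outer quintets contribute whiskered identities, so the pasting has the same
2-cell as `a`, and the defining equation makes this an identity. -/
theorem exists_cell_eq_id₁_of_isCommutativityCell {a : G.Quintet}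
    (h : G.symConnection.IsCommutativityCell a) : ∃ z, a.cell = (G.hom _ _).id₁ z := by
  obtain ⟨@⟨A, A', B, B', f, k, k', g⟩, α, p, q⟩ := a
  have h₂ := h.cell
  have e₁ : G.sym.H₁.mul (G.symConnection.η (G.sym.H₁.src.ob ⟨⟨f, k, k', g⟩, α, p, q⟩))
      ⟨⟨f, k, k', g⟩, α, p, q⟩ = _ := Quintet.hmul_mk _ _ p q
  rw [e₁] at h₂
  have h₃ := (Quintet.hmul_mk _ _ _ _).symm.trans h₂
  rw [show G.sym.H₀.mul (G.sym.V₁.src.ob ⟨⟨f, k, k', g⟩, α, p, q⟩) (G.symConnection.star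
    (G.sym.H₁.tgt.ob ⟨⟨f, k, k', g⟩, α, p, q⟩)) = _ from arrows_mul_mk f k'] at h₃
  -- Both quintets have the same outer corners definitionally, so the heterogeneous equality of
  -- their 2-cells is an ordinary one.
  have h₄ := eq_of_heq (Quintet.mk.inj h₃).2
  change (G.hom A B').comp (G.comp.L₁ ((G.hom A B').comp
      (G.comp.L₁ ((G.hom A B).id₁ k) g) (G.comp.R₁ (G.one A) α)) (G.one B'))
    (G.comp.R₁ (G.comp.ob (G.one A) f) ((G.hom A' B').id₁ k')) =
      (G.hom A B').id₁ (G.comp.ob f k') at h₄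
  dsimp only at p q
  refine ⟨G.comp.ob f k', Eq.trans ?_ h₄⟩
  simp [TwoCat.id_comp_of_eq, TwoCat.comp_id_of_eq, p, q]

/-! ### The lax and colax structures -/

theorem isCategory_cellCat (G : TrueGrayCat.{u, v}) : G.cellCat.IsCategory where
  dom_one := by
    rintro ⟨α⟩
    simp only [Cell.map_mk, TwoCat.src_id₂]
  cod_one := by
    rintro ⟨α⟩
    simp only [Cell.map_mk, TwoCat.tgt_id₂]
  dom_comp := by
    rintro ⟨x⟩ ⟨y⟩ e
    simp only [Cell.map_mk, Cell.mk.injEq] at e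
    obtain ⟨rfl, rfl, e⟩ := e
    rw [heq_iff_eq] at e
    simp only [Cell.map_mk, Cell.lift_mk, TwoCat.src_vcomp _ _ _ e]
  cod_comp := by
    rintro ⟨x⟩ ⟨y⟩ e
    simp only [Cell.map_mk, Cell.mk.injEq] at e
    obtain ⟨rfl, rfl, e⟩ := e
    rw [heq_iff_eq] at e
    simp only [Cell.map_mk, Cell.lift_mk, TwoCat.tgt_vcomp _ _ _ e]
  one_comp := by
    rintro ⟨x⟩
    simp only [Cell.map_mk, Cell.lift_mk, TwoCat.id_vcomp]
  comp_one := by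
    rintro ⟨x⟩
    simp only [Cell.map_mk, Cell.lift_mk, TwoCat.vcomp_id]
  assoc := by
    rintro ⟨x⟩ ⟨y⟩ ⟨z⟩ e e'
    simp only [Cell.map_mk, Cell.mk.injEq] at e e'
    obtain ⟨rfl, rfl, e⟩ := e
    obtain ⟨rfl, rfl, e'⟩ := e'
    rw [heq_iff_eq] at e e'
    simp only [Cell.lift_mk, TwoCat.vcomp_assoc _ _ _ _ e e']

theorem isInternalCategory_homs (G : TrueGrayCat.{u, v}) : G.homs.IsInternalCategory where
  isCategory := isCategory_cellCat G
  assoc_eq _ _ _ := rfl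
  lunit_eq _ := rfl
  runit_eq _ := rfl
  isFunctor_src := by
    refine ⟨fun _ => rfl, ?_, ?_, ?_⟩
    · rintro ⟨x⟩
      simp only [Cell.map_mk, TwoCat.src_tgt₂]
    · rintro ⟨α⟩
      simp only [Cell.map_mk, TwoCat.src_id₂]
    · rintro ⟨x⟩ ⟨y⟩ e
      simp only [Cell.map_mk, Cell.mk.injEq] at e
      obtain ⟨rfl, rfl, e⟩ := e
      rw [heq_iff_eq] at e
      simp only [Cell.map_mk, Cell.lift_mk, TwoCat.src_vcomp _ _ _ e]
  isFunctor_tgt := by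
    refine ⟨fun _ => rfl, ?_, ?_, ?_⟩
    · rintro ⟨x⟩
      simp only [Cell.map_mk, TwoCat.tgt_tgt₂]
    · rintro ⟨α⟩
      simp only [Cell.map_mk, TwoCat.src_id₂]
    · rintro ⟨x⟩ ⟨y⟩ e
      simp only [Cell.map_mk, Cell.mk.injEq] at e
      obtain ⟨rfl, rfl, e⟩ := e
      rw [heq_iff_eq] at e
      simp only [Cell.map_mk, Cell.lift_mk, TwoCat.src_vcomp _ _ _ e]
  isFunctor_unit := by
    refine ⟨fun f => ?_, fun f => ?_, fun _ => rfl, fun f f' e => ?_⟩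
    · exact (isCategory_cellCat G).dom_one (G.homs.unit.ob f)
    · exact (isCategory_cellCat G).cod_one (G.homs.unit.ob f)
    · cases e
      exact ((isCategory_cellCat G).one_comp_one (G.homs.unit.ob f)).symm
  src_unit := by
    rintro ⟨f⟩
    simp only [Cell.map_mk, TwoCat.src_id₁]
  tgt_unit := by
    rintro ⟨f⟩
    simp only [Cell.map_mk, TwoCat.tgt_id₁]
  src_mul := by
    rintro ⟨α⟩ ⟨β⟩ e
    simp only [Cell.map_mk, Cell.mk.injEq] at e
    obtain ⟨rfl, rfl, e⟩ := e
    rw [heq_iff_eq] at e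
    simp only [Cell.map_mk, Cell.lift_mk, TwoCat.src_comp _ _ _ e]
  tgt_mul := by
    rintro ⟨α⟩ ⟨β⟩ e
    simp only [Cell.map_mk, Cell.mk.injEq] at e
    obtain ⟨rfl, rfl, e⟩ := e
    rw [heq_iff_eq] at e
    simp only [Cell.map_mk, Cell.lift_mk, TwoCat.tgt_comp _ _ _ e]
  dom_mulHom := by
    rintro ⟨x⟩ ⟨y⟩ e
    simp only [Cell.map_mk, Cell.mk.injEq] at e
    obtain ⟨rfl, rfl, e⟩ := e
    rw [heq_iff_eq] at e
    simp only [Cell.map_mk, Cell.lift_mk, TwoCat.src_hcomp _ _ _ e]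
  cod_mulHom := by
    rintro ⟨x⟩ ⟨y⟩ e
    simp only [Cell.map_mk, Cell.mk.injEq] at e
    obtain ⟨rfl, rfl, e⟩ := e
    rw [heq_iff_eq] at e
    simp only [Cell.map_mk, Cell.lift_mk, TwoCat.tgt_hcomp _ _ _ e]
  mulHom_one := by
    rintro ⟨α⟩ ⟨β⟩ e
    simp only [Cell.map_mk, Cell.mk.injEq] at e
    obtain ⟨rfl, rfl, e⟩ := e
    rw [heq_iff_eq] at e
    simp only [Cell.map_mk, Cell.lift_mk, TwoCat.hcomp_id₂ _ _ _ e]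
  mulHom_comp := by
    rintro ⟨x⟩ ⟨x'⟩ ⟨y⟩ ⟨y'⟩ e e' h h'
    simp only [Cell.map_mk, Cell.mk.injEq] at e e' h
    obtain ⟨rfl, rfl, e⟩ := e
    obtain ⟨rfl, rfl, e'⟩ := e'
    obtain ⟨rfl, rfl, h⟩ := h
    rw [heq_iff_eq] at e e' h
    simp only [Cell.lift_mk, TwoCat.interchange _ _ _ _ _ e e' h]
  mulHom_assoc := by
    rintro ⟨x⟩ ⟨y⟩ ⟨z⟩ e e'
    simp only [Cell.map_mk, Cell.mk.injEq] at e e'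
    obtain ⟨rfl, rfl, e⟩ := e
    obtain ⟨rfl, rfl, e'⟩ := e'
    rw [heq_iff_eq] at e e'
    simp only [Cell.lift_mk, TwoCat.hcomp_assoc _ _ _ _ e e']
  unit_mulHom := by
    rintro ⟨x⟩
    simp only [Cell.map_mk, Cell.lift_mk, TwoCat.id_hcomp]
  mulHom_unit := by
    rintro ⟨x⟩
    simp only [Cell.map_mk, Cell.lift_mk, TwoCat.hcomp_id]

/-- Composition operations along objects form an internal category if they are compatible with the
structure of the hom 2-categories, associative and unitary. -/
theorem isInternalCategory_across (G : TrueGrayCat.{u, v})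
    {mul : ∀ {A B C}, (G.hom A B).C1 → (G.hom B C).C1 → (G.hom A C).C1}
    {mulHom : ∀ {A B C}, (G.hom A B).C2 → (G.hom B C).C2 → (G.hom A C).C2}
    (src₂_mulHom : ∀ {A B C} (x : (G.hom A B).C2) (y : (G.hom B C).C2),
      (G.hom A C).src₂ (mulHom x y) = mul ((G.hom A B).src₂ x) ((G.hom B C).src₂ y))
    (tgt₂_mulHom : ∀ {A B C} (x : (G.hom A B).C2) (y : (G.hom B C).C2),
      (G.hom A C).tgt₂ (mulHom x y) = mul ((G.hom A B).tgt₂ x) ((G.hom B C).tgt₂ y))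
    (mulHom_id₂ : ∀ {A B C} (α : (G.hom A B).C1) (β : (G.hom B C).C1),
      mulHom ((G.hom A B).id₂ α) ((G.hom B C).id₂ β) = (G.hom A C).id₂ (mul α β))
    (mulHom_vcomp : ∀ {A B C} (x x' : (G.hom A B).C2) (y y' : (G.hom B C).C2),
      (G.hom A B).tgt₂ x = (G.hom A B).src₂ x' → (G.hom B C).tgt₂ y = (G.hom B C).src₂ y' →
      mulHom ((G.hom A B).vcomp x x') ((G.hom B C).vcomp y y') =
        (G.hom A C).vcomp (mulHom x y) (mulHom x' y'))
    (mulHom_assoc : ∀ {A B C D} (x : (G.hom A B).C2) (y : (G.hom B C).C2) (z : (G.hom C D).C2),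
      mulHom (mulHom x y) z = mulHom x (mulHom y z))
    (one_mulHom : ∀ {A B} (x : (G.hom A B).C2),
      mulHom ((G.hom A A).id₂ ((G.hom A A).id₁ (G.one A))) x = x)
    (mulHom_one : ∀ {A B} (x : (G.hom A B).C2),
      mulHom x ((G.hom B B).id₂ ((G.hom B B).id₁ (G.one B))) = x) :
    (G.across mul mulHom).IsInternalCategory where
  isCategory := isCategory_cellCat G
  assoc_eq _ _ _ := rfl
  lunit_eq _ := rfl
  runit_eq _ := rfl
  isFunctor_src := by
    refine ⟨fun _ => rfl, fun _ => rfl, fun _ => rfl, ?_⟩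
    rintro ⟨x⟩ ⟨y⟩ e
    simp only [Cell.map_mk, Cell.mk.injEq] at e
    obtain ⟨rfl, rfl, -⟩ := e
    simp only [Cell.lift_mk]
  isFunctor_tgt := by
    refine ⟨fun _ => rfl, fun _ => rfl, fun _ => rfl, ?_⟩
    rintro ⟨x⟩ ⟨y⟩ e
    simp only [Cell.map_mk, Cell.mk.injEq] at e
    obtain ⟨rfl, rfl, -⟩ := e
    simp only [Cell.lift_mk]
  isFunctor_unit := by
    refine ⟨fun A => ?_, fun A => ?_, fun _ => rfl, fun A B e => ?_⟩
    · exact (isCategory_cellCat G).dom_one ⟨(G.hom A A).id₁ (G.one A)⟩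
    · exact (isCategory_cellCat G).cod_one ⟨(G.hom A A).id₁ (G.one A)⟩
    · cases e
      exact ((isCategory_cellCat G).one_comp_one ⟨(G.hom A A).id₁ (G.one A)⟩).symm
  src_unit _ := rfl
  tgt_unit _ := rfl
  src_mul := by
    rintro ⟨α⟩ ⟨β⟩ e
    cases e
    simp only [Cell.join_mk]
  tgt_mul := by
    rintro ⟨α⟩ ⟨β⟩ e
    cases e
    simp only [Cell.join_mk]
  dom_mulHom := by
    rintro ⟨x⟩ ⟨y⟩ e
    cases e
    simp only [Cell.map_mk, Cell.join_mk, src₂_mulHom]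
  cod_mulHom := by
    rintro ⟨x⟩ ⟨y⟩ e
    cases e
    simp only [Cell.map_mk, Cell.join_mk, tgt₂_mulHom]
  mulHom_one := by
    rintro ⟨α⟩ ⟨β⟩ e
    cases e
    simp only [Cell.map_mk, Cell.join_mk, mulHom_id₂]
  mulHom_comp := by
    rintro ⟨x⟩ ⟨x'⟩ ⟨y⟩ ⟨y'⟩ e e' h h'
    simp only [Cell.map_mk, Cell.mk.injEq] at e e'
    obtain ⟨rfl, rfl, e⟩ := e
    obtain ⟨rfl, rfl, e'⟩ := e'
    cases h
    rw [heq_iff_eq] at e e'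
    simp only [Cell.lift_mk, Cell.join_mk, mulHom_vcomp _ _ _ _ e e']
  mulHom_assoc := by
    rintro ⟨x⟩ ⟨y⟩ ⟨z⟩ e e'
    cases e
    cases e'
    simp only [Cell.join_mk, mulHom_assoc]
  unit_mulHom := by
    rintro ⟨x⟩
    simp only [Cell.join_mk, one_mulHom]
  mulHom_unit := by
    rintro ⟨x⟩
    simp only [Cell.join_mk, mulHom_one]

/-- For `α : f ⟶ g`, `β : h ⟶ k` and `κ : m ⟶ n` both bracketings expand to `α h m · g β m · g k κ`.
No `γ` intervenes, since whiskering is functorial and strictly associative. -/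
theorem isInternalCategory_across_lax (G : TrueGrayCat.{u, v}) :
    (G.across laxMul laxMulHom).IsInternalCategory :=
  isInternalCategory_across G
    (fun x y => by simp [laxMul, laxMulHom])
    (fun x y => by simp [laxMul, laxMulHom])
    (fun α β => by simp [laxMul, laxMulHom, TwoCat.hcomp_id₂])
    (fun x x' y y' e e' => by
      -- Transversally composable 3-cells share their boundary 1-cells, so `x` and `x'`, and
      -- likewise `y` and `y'`, are whiskered by the same 1-cells and interchange applies.
      have h : (G.hom _ _).tgt₁ ((G.hom _ _).src₂ x') = (G.hom _ _).tgt₁ ((G.hom _ _).src₂ x) := by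
        rw [← e, TwoCat.tgt_tgt₂]
      have h' : (G.hom _ _).src₁ ((G.hom _ _).src₂ y') = (G.hom _ _).src₁ ((G.hom _ _).src₂ y) := by
        rw [← e', TwoCat.src_tgt₂]
      simp [laxMulHom, e, e', h, h', ← TwoCat.interchange])
    (fun x y z => by simp (maxDischargeDepth := 6) [laxMulHom, TwoCat.hcomp_assoc])
    (fun x => by simp [laxMulHom, TwoCat.id_hcomp_of_eq])
    (fun x => by simp [laxMulHom, TwoCat.hcomp_id_of_eq])

theorem isInternalCategory_across_colax (G : TrueGrayCat.{u, v}) :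
    (G.across colaxMul colaxMulHom).IsInternalCategory :=
  isInternalCategory_across G
    (fun x y => by simp [colaxMul, colaxMulHom])
    (fun x y => by simp [colaxMul, colaxMulHom])
    (fun α β => by simp [colaxMul, colaxMulHom, TwoCat.hcomp_id₂])
    (fun x x' y y' e e' => by
      have h : (G.hom _ _).src₁ ((G.hom _ _).src₂ x') = (G.hom _ _).src₁ ((G.hom _ _).src₂ x) := by
        rw [← e, TwoCat.src_tgt₂]
      have h' : (G.hom _ _).tgt₁ ((G.hom _ _).src₂ y') = (G.hom _ _).tgt₁ ((G.hom _ _).src₂ y) := by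
        rw [← e', TwoCat.tgt_tgt₂]
      simp [colaxMulHom, e, e', h, h', ← TwoCat.interchange])
    (fun x y z => by simp (maxDischargeDepth := 6) [colaxMulHom, TwoCat.hcomp_assoc])
    (fun x => by simp [colaxMulHom, TwoCat.hcomp_id_of_eq])
    (fun x => by simp [colaxMulHom, TwoCat.id_hcomp_of_eq])

/-! ### The lax and colax interchangers -/

theorem laxχ_eq_whisk {A B C : G.Obj} (α α' : (G.hom A B).C1) (β β' : (G.hom B C).C1) :
    laxχ α α' β β' = (G.hom A C).whisk (G.comp.L₁ α ((G.hom B C).src₁ β)) (G.comp.γ α' β)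
      (G.comp.R₁ ((G.hom A B).tgt₁ α') β') := rfl

theorem colaxχ_eq_whisk {A B C : G.Obj} (α α' : (G.hom A B).C1) (β β' : (G.hom B C).C1) :
    colaxχ α α' β β' = (G.hom A C).whisk (G.comp.R₁ ((G.hom A B).src₁ α) β) (G.comp.γ α β')
      (G.comp.L₁ α' ((G.hom B C).tgt₁ β')) := rfl

section

variable {A B C D : G.Obj} {α α' α'' : (G.hom A B).C1} {β β' β'' : (G.hom B C).C1}
  {κ κ' : (G.hom C D).C1}

theorem src₂_laxχ (hα : (G.hom A B).tgt₁ α = (G.hom A B).src₁ α')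
    (hβ : (G.hom B C).tgt₁ β = (G.hom B C).src₁ β') :
    (G.hom A C).src₂ (laxχ α α' β β') = (G.hom A C).comp (laxMul α β) (laxMul α' β') := by
  simp (maxDischargeDepth := 6) [laxχ_eq_whisk, laxMul, hα, hβ]

theorem tgt₂_laxχ (hα : (G.hom A B).tgt₁ α = (G.hom A B).src₁ α')
    (hβ : (G.hom B C).tgt₁ β = (G.hom B C).src₁ β') :
    (G.hom A C).tgt₂ (laxχ α α' β β') =
      laxMul ((G.hom A B).comp α α') ((G.hom B C).comp β β') := by
  simp (maxDischargeDepth := 6) [laxχ_eq_whisk, laxMul, hα, hβ]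

theorem src₂_colaxχ (hα : (G.hom A B).tgt₁ α = (G.hom A B).src₁ α')
    (hβ : (G.hom B C).tgt₁ β = (G.hom B C).src₁ β') :
    (G.hom A C).src₂ (colaxχ α α' β β') =
      colaxMul ((G.hom A B).comp α α') ((G.hom B C).comp β β') := by
  simp (maxDischargeDepth := 6) [colaxχ_eq_whisk, colaxMul, hα, hβ]

theorem tgt₂_colaxχ (hα : (G.hom A B).tgt₁ α = (G.hom A B).src₁ α')
    (hβ : (G.hom B C).tgt₁ β = (G.hom B C).src₁ β') :
    (G.hom A C).tgt₂ (colaxχ α α' β β') = (G.hom A C).comp (colaxMul α β) (colaxMul α' β') := by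
  simp (maxDischargeDepth := 6) [colaxχ_eq_whisk, colaxMul, hα, hβ]

/-- The lax interchanger contains `γ(α', β)`, so naturality of `γ` is used at `x'` and `y`, with `x`
and `y'` outside. In the colax case the roles are exchanged. -/
theorem laxχ_natural {x x' : (G.hom A B).C2} {y y' : (G.hom B C).C2}
    (hx : (G.hom A B).tgt₁ ((G.hom A B).src₂ x) = (G.hom A B).src₁ ((G.hom A B).src₂ x'))
    (hy : (G.hom B C).tgt₁ ((G.hom B C).src₂ y) = (G.hom B C).src₁ ((G.hom B C).src₂ y')) :
    (G.hom A C).vcomp ((G.hom A C).hcomp (laxMulHom x y) (laxMulHom x' y'))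
        (laxχ ((G.hom A B).tgt₂ x) ((G.hom A B).tgt₂ x') ((G.hom B C).tgt₂ y)
          ((G.hom B C).tgt₂ y')) =
      (G.hom A C).vcomp
        (laxχ ((G.hom A B).src₂ x) ((G.hom A B).src₂ x') ((G.hom B C).src₂ y)
          ((G.hom B C).src₂ y'))
        (laxMulHom ((G.hom A B).hcomp x x') ((G.hom B C).hcomp y y')) := by
  have := TwoCat.hcomp_whisk_natural
    (z := G.comp.L₂ x ((G.hom B C).src₁ ((G.hom B C).src₂ y)))
    (w := G.comp.R₂ ((G.hom A B).tgt₁ ((G.hom A B).src₂ x')) y')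
    (by simp [hx]) (by simp [hy]) (by simp) (by simp) (G.comp.γ_natural x' y)
  simp (maxDischargeDepth := 6) [TwoCat.hcomp_assoc, laxχ_eq_whisk, laxMulHom, hx, hy] at this ⊢
  exact this

theorem colaxχ_natural {x x' : (G.hom A B).C2} {y y' : (G.hom B C).C2}
    (hx : (G.hom A B).tgt₁ ((G.hom A B).src₂ x) = (G.hom A B).src₁ ((G.hom A B).src₂ x'))
    (hy : (G.hom B C).tgt₁ ((G.hom B C).src₂ y) = (G.hom B C).src₁ ((G.hom B C).src₂ y')) :
    (G.hom A C).vcomp (colaxMulHom ((G.hom A B).hcomp x x') ((G.hom B C).hcomp y y'))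
        (colaxχ ((G.hom A B).tgt₂ x) ((G.hom A B).tgt₂ x') ((G.hom B C).tgt₂ y)
          ((G.hom B C).tgt₂ y')) =
      (G.hom A C).vcomp
        (colaxχ ((G.hom A B).src₂ x) ((G.hom A B).src₂ x') ((G.hom B C).src₂ y)
          ((G.hom B C).src₂ y'))
        ((G.hom A C).hcomp (colaxMulHom x y) (colaxMulHom x' y')) := by
  have := TwoCat.hcomp_whisk_natural
    (z := G.comp.R₂ ((G.hom A B).src₁ ((G.hom A B).src₂ x)) y)
    (w := G.comp.L₂ x' ((G.hom B C).tgt₁ ((G.hom B C).src₂ y')))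
    (by simp [hy]) (by simp [hx]) (by simp) (by simp) (G.comp.γ_natural x y')
  simp (maxDischargeDepth := 6) [TwoCat.hcomp_assoc, colaxχ_eq_whisk, colaxMulHom, hx, hy]
    at this ⊢
  exact this

theorem laxχ_eq_id_of_left {f : (G.hom A B).C0}
    (hα : (G.hom A B).tgt₁ α = (G.hom A B).src₁ α')
    (hβ : (G.hom B C).tgt₁ β = (G.hom B C).src₁ β') (h : α' = (G.hom A B).id₁ f) :
    ∃ w, laxχ α α' β β' = (G.hom A C).id₂ w := by
  subst h
  rw [TwoCat.src_id₁] at hα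
  rw [laxχ_eq_whisk, GrayFunctor.γ_id_left, TwoCat.whisk_id]
  · exact ⟨_, rfl⟩
  · simp [hα]
  · simp [hβ]

theorem laxχ_eq_id_of_right {f : (G.hom B C).C0}
    (hα : (G.hom A B).tgt₁ α = (G.hom A B).src₁ α')
    (hβ : (G.hom B C).tgt₁ β = (G.hom B C).src₁ β') (h : β = (G.hom B C).id₁ f) :
    ∃ w, laxχ α α' β β' = (G.hom A C).id₂ w := by
  subst h
  rw [TwoCat.tgt_id₁] at hβ
  rw [laxχ_eq_whisk, GrayFunctor.γ_id_right, TwoCat.whisk_id]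
  · exact ⟨_, rfl⟩
  · simp [hα]
  · simp [hβ]

theorem colaxχ_eq_id_of_left {f : (G.hom A B).C0}
    (hα : (G.hom A B).tgt₁ α = (G.hom A B).src₁ α')
    (hβ : (G.hom B C).tgt₁ β = (G.hom B C).src₁ β') (h : α = (G.hom A B).id₁ f) :
    ∃ w, colaxχ α α' β β' = (G.hom A C).id₂ w := by
  subst h
  rw [TwoCat.tgt_id₁] at hα
  rw [colaxχ_eq_whisk, GrayFunctor.γ_id_left, TwoCat.whisk_id]
  · exact ⟨_, rfl⟩
  · simp [hβ]
  · simp [hα]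

theorem colaxχ_eq_id_of_right {f : (G.hom B C).C0}
    (hα : (G.hom A B).tgt₁ α = (G.hom A B).src₁ α')
    (hβ : (G.hom B C).tgt₁ β = (G.hom B C).src₁ β') (h : β' = (G.hom B C).id₁ f) :
    ∃ w, colaxχ α α' β β' = (G.hom A C).id₂ w := by
  subst h
  rw [TwoCat.src_id₁] at hβ
  rw [colaxχ_eq_whisk, GrayFunctor.γ_id_right, TwoCat.whisk_id]
  · exact ⟨_, rfl⟩
  · simp [hβ]
  · simp [hα]

/-- The left side expands to `γ(α', β)`, `γ(α'', β')`, `γ(α'', β)`, using composition in the second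
variable. The right side, using composition in the first variable, exchanges the first two. -/
theorem laxχ_vertical_assoc (hα : (G.hom A B).tgt₁ α = (G.hom A B).src₁ α')
    (hα' : (G.hom A B).tgt₁ α' = (G.hom A B).src₁ α'')
    (hβ : (G.hom B C).tgt₁ β = (G.hom B C).src₁ β')
    (hβ' : (G.hom B C).tgt₁ β' = (G.hom B C).src₁ β'') :
    (G.hom A C).vcomp ((G.hom A C).hcomp (laxχ α α' β β') ((G.hom A C).id₂ (laxMul α'' β'')))
        (laxχ ((G.hom A B).comp α α') α'' ((G.hom B C).comp β β') β'') =
      (G.hom A C).vcomp ((G.hom A C).hcomp ((G.hom A C).id₂ (laxMul α β)) (laxχ α' α'' β' β''))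
        (laxχ α ((G.hom A B).comp α' α'') β ((G.hom B C).comp β' β'')) := by
  have sw := TwoCat.whisk_swap (a := G.comp.L₁ α ((G.hom B C).src₁ β))
    (x := G.comp.γ α' β) (y := G.comp.γ α'' β')
    (b := G.comp.R₁ ((G.hom A B).tgt₁ α'') β'')
    (by simp [hα]) (by simp [hα', hβ]) (by simp [hβ'])
  simp (maxDischargeDepth := 6) [laxχ_eq_whisk, laxMul, hα, hα', hβ, hβ'] at sw ⊢
  rw [← TwoCat.vcomp_assoc, sw, TwoCat.vcomp_assoc]
  all_goals simp (maxDischargeDepth := 6) [hα, hα', hβ, hβ']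

/-- Both sides begin with `γ(α, β'')`; then `γ(α', β'')` and `γ(α, β')` follow on the left, and in
the opposite order on the right. -/
theorem colaxχ_horizontal_assoc (hα : (G.hom A B).tgt₁ α = (G.hom A B).src₁ α')
    (hα' : (G.hom A B).tgt₁ α' = (G.hom A B).src₁ α'')
    (hβ : (G.hom B C).tgt₁ β = (G.hom B C).src₁ β')
    (hβ' : (G.hom B C).tgt₁ β' = (G.hom B C).src₁ β'') :
    (G.hom A C).vcomp (colaxχ ((G.hom A B).comp α α') α'' ((G.hom B C).comp β β') β'')
        ((G.hom A C).hcomp (colaxχ α α' β β') ((G.hom A C).id₂ (colaxMul α'' β''))) =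
      (G.hom A C).vcomp (colaxχ α ((G.hom A B).comp α' α'') β ((G.hom B C).comp β' β''))
        ((G.hom A C).hcomp ((G.hom A C).id₂ (colaxMul α β)) (colaxχ α' α'' β' β'')) := by
  have sw := TwoCat.whisk_swap (a := G.comp.R₁ ((G.hom A B).src₁ α) β)
    (x := G.comp.γ α β') (y := G.comp.γ α' β'')
    (b := G.comp.L₁ α'' ((G.hom B C).tgt₁ β''))
    (by simp [hβ]) (by simp [hα, hβ']) (by simp [hα'])
  simp (maxDischargeDepth := 6) [colaxχ_eq_whisk, colaxMul, hα, hα', hβ, hβ'] at sw ⊢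
  rw [TwoCat.vcomp_assoc, ← sw, TwoCat.vcomp_assoc]
  all_goals simp (maxDischargeDepth := 6) [hα, hα', hβ, hβ']

/-- Write `l`, `k` for the targets of `α'`, `β` and `m` for the source of `κ`. Both sides begin with
`γ(α', k κ)`; the factors `l γ(β', κ)` and `γ(α', β m)` then come in opposite orders. Here the
composites split inside `γ` are horizontal composites of 2-cells. -/
theorem laxχ_horizontal_assoc (hα : (G.hom A B).tgt₁ α = (G.hom A B).src₁ α')
    (hβ : (G.hom B C).tgt₁ β = (G.hom B C).src₁ β')
    (hκ : (G.hom C D).tgt₁ κ = (G.hom C D).src₁ κ') :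
    (G.hom A D).vcomp (laxχ (laxMul α β) (laxMul α' β') κ κ')
        (laxMulHom (laxχ α α' β β') ((G.hom C D).id₂ ((G.hom C D).comp κ κ'))) =
      (G.hom A D).vcomp (laxχ α α' (laxMul β κ) (laxMul β' κ'))
        (laxMulHom ((G.hom A B).id₂ ((G.hom A B).comp α α')) (laxχ β β' κ κ')) := by
  have sw := TwoCat.whisk_swap
    (a := G.comp.L₁ α (G.comp.ob ((G.hom B C).src₁ β) ((G.hom C D).src₁ κ)))
    (x := G.comp.γ α' (G.comp.L₁ β ((G.hom C D).src₁ κ)))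
    (y := G.comp.R₂ ((G.hom A B).tgt₁ α') (G.comp.γ β' κ))
    (b := G.comp.R₁ ((G.hom A B).tgt₁ α') (G.comp.R₁ ((G.hom B C).tgt₁ β') κ'))
    (by simp [hα]) (by simp [hβ]) (by simp [hκ])
  simp (maxDischargeDepth := 6) [laxχ_eq_whisk, laxMul, laxMulHom, hα, hβ, hκ] at sw ⊢
  rw [TwoCat.vcomp_assoc, ← sw, TwoCat.vcomp_assoc]
  all_goals simp (maxDischargeDepth := 6) [hα, hβ, hκ]

/-- Write `f` for the source of `α`, `k` for the target of `β` and `n` for the target of `κ'`. Both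
sides end with `γ(α, k κ')`; the factors `γ(α, β' n)` and `f γ(β, κ')` before it come in opposite
orders. -/
theorem colaxχ_vertical_assoc (hα : (G.hom A B).tgt₁ α = (G.hom A B).src₁ α')
    (hβ : (G.hom B C).tgt₁ β = (G.hom B C).src₁ β')
    (hκ : (G.hom C D).tgt₁ κ = (G.hom C D).src₁ κ') :
    (G.hom A D).vcomp
        (colaxMulHom (colaxχ α α' β β') ((G.hom C D).id₂ ((G.hom C D).comp κ κ')))
        (colaxχ (colaxMul α β) (colaxMul α' β') κ κ') =
      (G.hom A D).vcomp
        (colaxMulHom ((G.hom A B).id₂ ((G.hom A B).comp α α')) (colaxχ β β' κ κ'))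
        (colaxχ α α' (colaxMul β κ) (colaxMul β' κ')) := by
  have sw := TwoCat.whisk_swap
    (a := G.comp.R₁ ((G.hom A B).src₁ α) (G.comp.R₁ ((G.hom B C).src₁ β) κ))
    (x := G.comp.R₂ ((G.hom A B).src₁ α) (G.comp.γ β κ'))
    (y := G.comp.γ α (G.comp.L₁ β' ((G.hom C D).tgt₁ κ')))
    (b := G.comp.L₁ α' (G.comp.ob ((G.hom B C).tgt₁ β') ((G.hom C D).tgt₁ κ')))
    (by simp [hκ]) (by simp [hβ]) (by simp [hα])
  simp (maxDischargeDepth := 6) [colaxχ_eq_whisk, colaxMul, colaxMulHom, hα, hβ, hκ] at sw ⊢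
  rw [← TwoCat.vcomp_assoc, ← sw, TwoCat.vcomp_assoc]
  all_goals simp (maxDischargeDepth := 6) [hα, hβ, hκ]

end

/-! ### Interchangers on identity 2-cells in the lax and colax cases -/

section

variable {a b c d : G.Cell₂}

/-- The lower left cell is the first argument of `γ` in the lax interchanger. Horizontal units are
also identity 2-cells, namely of identity 1-cells, so this covers them together with the vertical
units. -/
theorem isIdentity_laxχ_of_left (h : G.lax.Grid a b c d) {f : G.Cell₁}
    (hc : c = Cell.map (TwoCat.id₁ _) f) :
    G.cellCat.IsIdentity (Cell.quad laxχ (G.cellCat.one a) a c b d) := by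
  subst hc
  obtain ⟨α⟩ := a
  obtain ⟨β⟩ := b
  obtain ⟨f⟩ := f
  obtain ⟨β'⟩ := d
  -- Vertically adjacent cells lie in the same hom 2-category, so the condition on the bottom row
  -- follows from the one on the top row.
  obtain ⟨e₁, -, hα, hβ⟩ := h
  cases e₁
  simp only [Cell.map_mk, Cell.mk.injEq] at hα hβ
  obtain ⟨rfl, rfl, hα⟩ := hα
  obtain ⟨rfl, rfl, hβ⟩ := hβ
  rw [heq_iff_eq] at hα hβ
  obtain ⟨w, hw⟩ := laxχ_eq_id_of_left hα hβ rfl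
  exact ⟨⟨w⟩, (Cell.quad_mk _ _ _ _ _ _).trans (congrArg _ hw)⟩

theorem isIdentity_laxχ_of_right (h : G.lax.Grid a b c d) {f : G.Cell₁}
    (hb : b = Cell.map (TwoCat.id₁ _) f) :
    G.cellCat.IsIdentity (Cell.quad laxχ (G.cellCat.one a) a c b d) := by
  subst hb
  obtain ⟨α⟩ := a
  obtain ⟨f⟩ := f
  obtain ⟨α'⟩ := c
  obtain ⟨β'⟩ := d
  obtain ⟨e₁, -, hα, hβ⟩ := h
  cases e₁
  simp only [Cell.map_mk, Cell.mk.injEq] at hα hβ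
  obtain ⟨rfl, rfl, hα⟩ := hα
  obtain ⟨rfl, rfl, hβ⟩ := hβ
  rw [heq_iff_eq] at hα hβ
  obtain ⟨w, hw⟩ := laxχ_eq_id_of_right hα hβ rfl
  exact ⟨⟨w⟩, (Cell.quad_mk _ _ _ _ _ _).trans (congrArg _ hw)⟩

theorem isIdentity_colaxχ_of_left (h : G.colax.Grid a b c d) {f : G.Cell₁}
    (ha : a = Cell.map (TwoCat.id₁ _) f) :
    G.cellCat.IsIdentity (Cell.quad colaxχ (G.cellCat.one a) a b c d) := by
  subst ha
  obtain ⟨f⟩ := f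
  obtain ⟨α'⟩ := b
  obtain ⟨β⟩ := c
  obtain ⟨β'⟩ := d
  obtain ⟨hα, hβ, e₁, -⟩ := h
  cases e₁
  simp only [Cell.map_mk, Cell.mk.injEq] at hα hβ
  obtain ⟨rfl, rfl, hα⟩ := hα
  obtain ⟨rfl, rfl, hβ⟩ := hβ
  rw [heq_iff_eq] at hα hβ
  obtain ⟨w, hw⟩ := colaxχ_eq_id_of_left hα hβ rfl
  exact ⟨⟨w⟩, (Cell.quad_mk _ _ _ _ _ _).trans (congrArg _ hw)⟩

theorem isIdentity_colaxχ_of_right (h : G.colax.Grid a b c d) {f : G.Cell₁}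
    (hd : d = Cell.map (TwoCat.id₁ _) f) :
    G.cellCat.IsIdentity (Cell.quad colaxχ (G.cellCat.one a) a b c d) := by
  subst hd
  obtain ⟨α⟩ := a
  obtain ⟨α'⟩ := b
  obtain ⟨β⟩ := c
  obtain ⟨f⟩ := f
  obtain ⟨hα, hβ, e₁, -⟩ := h
  cases e₁
  simp only [Cell.map_mk, Cell.mk.injEq] at hα hβ
  obtain ⟨rfl, rfl, hα⟩ := hα
  obtain ⟨rfl, rfl, hβ⟩ := hβ
  rw [heq_iff_eq] at hα hβ
  obtain ⟨w, hw⟩ := colaxχ_eq_id_of_right hα hβ rfl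
  exact ⟨⟨w⟩, (Cell.quad_mk _ _ _ _ _ _).trans (congrArg _ hw)⟩

end

/-! ### The lax and colax intercategories -/

theorem isStrictChiral_lax (G : TrueGrayCat.{u, v}) :
    IntercatData.IsStrictChiral G.arrows (PseudoCatData.trivial G.Obj)
      (G.across laxMul laxMulHom) G.homs
      (fun a b c d => Cell.quad laxχ (G.cellCat.one a) a c b d) where
  internal_H₀ := isInternalCategory_arrows G
  internal_V₀ := PseudoCatData.isInternalCategory_trivial G.Obj
  internal_H₁ := isInternalCategory_across_lax G
  internal_V₁ := isInternalCategory_homs G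
  src_src _ := rfl
  tgt_src _ := rfl
  src_tgt _ := rfl
  tgt_tgt _ := rfl
  hsrc_unit _ := rfl
  htgt_unit _ := rfl
  vsrc_unit _ := by simp only [Cell.map_mk, TwoCat.src_id₁]
  vtgt_unit _ := by simp only [Cell.map_mk, TwoCat.tgt_id₁]
  hsrc_mul := by
    rintro ⟨α⟩ ⟨α'⟩ hα
    simp only [Cell.map_mk, Cell.mk.injEq] at hα
    obtain ⟨rfl, rfl, hα⟩ := hα
    rw [heq_iff_eq] at hα
    simp only [Cell.lift_mk]
  htgt_mul := by
    rintro ⟨α⟩ ⟨α'⟩ hα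
    simp only [Cell.map_mk, Cell.mk.injEq] at hα
    obtain ⟨rfl, rfl, hα⟩ := hα
    rw [heq_iff_eq] at hα
    simp only [Cell.lift_mk]
  vsrc_mul := by
    rintro ⟨α⟩ ⟨β⟩ e
    cases e
    simp only [Cell.map_mk, Cell.join_mk]
    simp [laxMul]
  vtgt_mul := by
    rintro ⟨α⟩ ⟨β⟩ e
    cases e
    simp only [Cell.map_mk, Cell.join_mk]
    simp [laxMul]
  mul_vunit := by
    rintro ⟨f⟩ ⟨g⟩ e
    cases e
    simp only [Cell.map_mk, Cell.join_mk]
    simp [laxMul]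
  mul_hunit := by
    rintro A B e
    cases e
    simp only [Cell.lift_mk, TwoCat.id_comp_of_eq, TwoCat.src_id₁]
  vunit_hunit _ := rfl
  dom_χ := by
    rintro ⟨α⟩ ⟨β⟩ ⟨α'⟩ ⟨β'⟩ ⟨e, -, hα, hβ⟩
    cases e
    simp only [Cell.map_mk, Cell.mk.injEq] at hα hβ
    obtain ⟨rfl, rfl, hα⟩ := hα
    obtain ⟨rfl, rfl, hβ⟩ := hβ
    rw [heq_iff_eq] at hα hβ
    simp only [Cell.map_mk, Cell.quad_mk, Cell.join_mk, Cell.lift_mk, src₂_laxχ hα hβ]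
  cod_χ := by
    rintro ⟨α⟩ ⟨β⟩ ⟨α'⟩ ⟨β'⟩ ⟨e, -, hα, hβ⟩
    cases e
    simp only [Cell.map_mk, Cell.mk.injEq] at hα hβ
    obtain ⟨rfl, rfl, hα⟩ := hα
    obtain ⟨rfl, rfl, hβ⟩ := hβ
    rw [heq_iff_eq] at hα hβ
    simp only [Cell.map_mk, Cell.quad_mk, Cell.join_mk, Cell.lift_mk, tgt₂_laxχ hα hβ]
  natural_χ := by
    rintro ⟨x⟩ ⟨y⟩ ⟨x'⟩ ⟨y'⟩ ⟨e, -, hx, hy⟩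
    cases e
    simp only [Cell.map_mk, Cell.mk.injEq] at hx hy
    obtain ⟨rfl, rfl, hx⟩ := hx
    obtain ⟨rfl, rfl, hy⟩ := hy
    rw [heq_iff_eq] at hx hy
    simp only [Cell.map_mk, Cell.quad_mk, Cell.join_mk, Cell.lift_mk, laxχ_natural hx hy]
  χ_vertical_assoc := by
    rintro ⟨α⟩ ⟨β⟩ ⟨α'⟩ ⟨β'⟩ ⟨α''⟩ ⟨β''⟩ ⟨e, -, hα, hβ⟩ ⟨-, -, hα', hβ'⟩
    cases e
    simp only [Cell.map_mk, Cell.mk.injEq] at hα hβ hα' hβ'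
    obtain ⟨rfl, rfl, hα⟩ := hα
    obtain ⟨rfl, rfl, hβ⟩ := hβ
    obtain ⟨rfl, rfl, hα'⟩ := hα'
    obtain ⟨rfl, rfl, hβ'⟩ := hβ'
    rw [heq_iff_eq] at hα hβ hα' hβ'
    simp only [Cell.map_mk, Cell.quad_mk, Cell.join_mk, Cell.lift_mk,
      laxχ_vertical_assoc hα hα' hβ hβ']
  χ_horizontal_assoc := by
    rintro ⟨α⟩ ⟨β⟩ ⟨κ⟩ ⟨α'⟩ ⟨β'⟩ ⟨κ'⟩ ⟨e, -, hα, hβ⟩ ⟨e', -, -, hκ⟩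
    cases e
    cases e'
    simp only [Cell.map_mk, Cell.mk.injEq] at hα hβ hκ
    obtain ⟨rfl, rfl, hα⟩ := hα
    obtain ⟨rfl, rfl, hβ⟩ := hβ
    obtain ⟨rfl, rfl, hκ⟩ := hκ
    rw [heq_iff_eq] at hα hβ hκ
    simp only [Cell.map_mk, Cell.quad_mk, Cell.join_mk, Cell.lift_mk,
      laxχ_horizontal_assoc hα hβ hκ]
  χ_vunit_left _ _ _ _ h := isIdentity_laxχ_of_right h rfl
  χ_vunit_right _ _ _ _ h := isIdentity_laxχ_of_left h rfl
  -- The horizontal unit on the identity vertical arrow at `w` is the identity 2-cell of the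
  -- identity 1-cell.
  χ_hunit_left _ w _ _ h := isIdentity_laxχ_of_left h (f := ⟨G.one w⟩) rfl
  χ_hunit_right v _ _ _ h := isIdentity_laxχ_of_right h (f := ⟨G.one v⟩) rfl

theorem isStrictChiral_colax (G : TrueGrayCat.{u, v}) :
    IntercatData.IsStrictChiral (PseudoCatData.trivial G.Obj) G.arrows G.homs
      (G.across colaxMul colaxMulHom)
      (fun a b c d => Cell.quad colaxχ (G.cellCat.one a) a b c d) where
  internal_H₀ := PseudoCatData.isInternalCategory_trivial G.Obj
  internal_V₀ := isInternalCategory_arrows G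
  internal_H₁ := isInternalCategory_homs G
  internal_V₁ := isInternalCategory_across_colax G
  src_src _ := rfl
  tgt_src _ := rfl
  src_tgt _ := rfl
  tgt_tgt _ := rfl
  hsrc_unit _ := by simp only [Cell.map_mk, TwoCat.src_id₁]
  htgt_unit _ := by simp only [Cell.map_mk, TwoCat.tgt_id₁]
  vsrc_unit _ := rfl
  vtgt_unit _ := rfl
  hsrc_mul := by
    rintro ⟨α⟩ ⟨β⟩ e
    cases e
    simp only [Cell.map_mk, Cell.join_mk]
    simp [colaxMul]
  htgt_mul := by
    rintro ⟨α⟩ ⟨β⟩ e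
    cases e
    simp only [Cell.map_mk, Cell.join_mk]
    simp [colaxMul]
  vsrc_mul := by
    rintro ⟨α⟩ ⟨α'⟩ hα
    simp only [Cell.map_mk, Cell.mk.injEq] at hα
    obtain ⟨rfl, rfl, hα⟩ := hα
    rw [heq_iff_eq] at hα
    simp only [Cell.lift_mk]
  vtgt_mul := by
    rintro ⟨α⟩ ⟨α'⟩ hα
    simp only [Cell.map_mk, Cell.mk.injEq] at hα
    obtain ⟨rfl, rfl, hα⟩ := hα
    rw [heq_iff_eq] at hα
    simp only [Cell.lift_mk]
  mul_vunit := by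
    rintro A B e
    cases e
    simp only [Cell.lift_mk, TwoCat.id_comp_of_eq, TwoCat.src_id₁]
  mul_hunit := by
    rintro ⟨f⟩ ⟨g⟩ e
    cases e
    simp only [Cell.map_mk, Cell.join_mk]
    simp [colaxMul]
  vunit_hunit _ := rfl
  dom_χ := by
    rintro ⟨α⟩ ⟨α'⟩ ⟨β⟩ ⟨β'⟩ ⟨hα, hβ, e, -⟩
    cases e
    simp only [Cell.map_mk, Cell.mk.injEq] at hα hβ
    obtain ⟨rfl, rfl, hα⟩ := hα
    obtain ⟨rfl, rfl, hβ⟩ := hβ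
    rw [heq_iff_eq] at hα hβ
    simp only [Cell.map_mk, Cell.quad_mk, Cell.join_mk, Cell.lift_mk, src₂_colaxχ hα hβ]
  cod_χ := by
    rintro ⟨α⟩ ⟨α'⟩ ⟨β⟩ ⟨β'⟩ ⟨hα, hβ, e, -⟩
    cases e
    simp only [Cell.map_mk, Cell.mk.injEq] at hα hβ
    obtain ⟨rfl, rfl, hα⟩ := hα
    obtain ⟨rfl, rfl, hβ⟩ := hβ
    rw [heq_iff_eq] at hα hβ
    simp only [Cell.map_mk, Cell.quad_mk, Cell.join_mk, Cell.lift_mk, tgt₂_colaxχ hα hβ]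
  natural_χ := by
    rintro ⟨x⟩ ⟨x'⟩ ⟨y⟩ ⟨y'⟩ ⟨hx, hy, e, -⟩
    cases e
    simp only [Cell.map_mk, Cell.mk.injEq] at hx hy
    obtain ⟨rfl, rfl, hx⟩ := hx
    obtain ⟨rfl, rfl, hy⟩ := hy
    rw [heq_iff_eq] at hx hy
    simp only [Cell.map_mk, Cell.quad_mk, Cell.join_mk, Cell.lift_mk, colaxχ_natural hx hy]
  χ_vertical_assoc := by
    rintro ⟨α⟩ ⟨α'⟩ ⟨β⟩ ⟨β'⟩ ⟨κ⟩ ⟨κ'⟩ ⟨hα, hβ, e, -⟩ ⟨-, hκ, e', -⟩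
    cases e
    cases e'
    simp only [Cell.map_mk, Cell.mk.injEq] at hα hβ hκ
    obtain ⟨rfl, rfl, hα⟩ := hα
    obtain ⟨rfl, rfl, hβ⟩ := hβ
    obtain ⟨rfl, rfl, hκ⟩ := hκ
    rw [heq_iff_eq] at hα hβ hκ
    simp only [Cell.map_mk, Cell.quad_mk, Cell.join_mk, Cell.lift_mk,
      colaxχ_vertical_assoc hα hβ hκ]
  χ_horizontal_assoc := by
    rintro ⟨α⟩ ⟨α'⟩ ⟨α''⟩ ⟨β⟩ ⟨β'⟩ ⟨β''⟩ ⟨hα, hβ, e, -⟩ ⟨hα', hβ', -, -⟩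
    cases e
    simp only [Cell.map_mk, Cell.mk.injEq] at hα hβ hα' hβ'
    obtain ⟨rfl, rfl, hα⟩ := hα
    obtain ⟨rfl, rfl, hβ⟩ := hβ
    obtain ⟨rfl, rfl, hα'⟩ := hα'
    obtain ⟨rfl, rfl, hβ'⟩ := hβ'
    rw [heq_iff_eq] at hα hβ hα' hβ'
    simp only [Cell.map_mk, Cell.quad_mk, Cell.join_mk, Cell.lift_mk,
      colaxχ_horizontal_assoc hα hα' hβ hβ']
  χ_vunit_left v _ _ _ h := isIdentity_colaxχ_of_left h (f := ⟨G.one v⟩) rfl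
  χ_vunit_right _ w _ _ h := isIdentity_colaxχ_of_right h (f := ⟨G.one w⟩) rfl
  χ_hunit_left _ _ _ _ h := isIdentity_colaxχ_of_left h rfl
  χ_hunit_right _ _ _ _ h := isIdentity_colaxχ_of_right h rfl

end TrueGrayCat

theorem mainTheorem4 (G : TrueGrayCat.{u, v}) :
    -- the lax case
    (G.lax.IsIntercategory ∧ G.lax.HasIdentityCells ∧ G.lax.HasStrictComposites ∧
      G.lax.IsChiral ∧
      (∀ w : G.lax.ver.Ob, ∃ A, w = G.lax.V₀.unit.ob A) ∧
      ∀ a b c d : G.lax.bas.Ob, G.lax.Grid a b c d →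
        ((∃ h, b = G.lax.V₁.unit.ob h) ∨ ∃ h, c = G.lax.V₁.unit.ob h) →
        G.lax.bas.IsIdentity (G.lax.χ a b c d)) ∧
    -- the colax case
    (G.colax.IsIntercategory ∧ G.colax.HasIdentityCells ∧ G.colax.HasStrictComposites ∧
      G.colax.IsChiral ∧
      (∀ h : G.colax.hor.Ob, ∃ A, h = G.colax.H₀.unit.ob A) ∧
      ∀ a b c d : G.colax.bas.Ob, G.colax.Grid a b c d →
        ((∃ w, a = G.colax.H₁.unit.ob w) ∨ ∃ w, d = G.colax.H₁.unit.ob w) →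
        G.colax.bas.IsIdentity (G.colax.χ a b c d)) ∧
    -- the symmetric case
    (G.sym.IsIntercategory ∧ G.sym.HasIdentityCells ∧ G.sym.HasStrictComposites ∧
      G.sym.IsChiral ∧
      G.symConnection.IsConnection ∧
      ∀ a b c d : G.sym.bas.Ob, G.sym.Grid a b c d →
        (G.symConnection.IsCommutativityCell a ∨ G.symConnection.IsCommutativityCell d) →
        G.sym.bas.IsIdentity (G.sym.χ a b c d)) := by
  -- Each of the three data is definitionally of the form `IntercatData.ofStrict`, degenerate
  -- interchangers included, so the general results apply without transport.
  refine ⟨⟨(TrueGrayCat.isStrictChiral_lax G).isIntercategory,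
      IntercatData.IsStrictChiral.hasIdentityCells,
      (TrueGrayCat.isStrictChiral_lax G).hasStrictComposites,
      IntercatData.IsStrictChiral.isChiral, fun w => ⟨w, rfl⟩, ?_⟩,
    ⟨(TrueGrayCat.isStrictChiral_colax G).isIntercategory,
      IntercatData.IsStrictChiral.hasIdentityCells,
      (TrueGrayCat.isStrictChiral_colax G).hasStrictComposites,
      IntercatData.IsStrictChiral.isChiral, fun h => ⟨h, rfl⟩, ?_⟩,
    (TrueGrayCat.isStrictChiral_sym G).isIntercategory,
      IntercatData.IsStrictChiral.hasIdentityCells,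
      (TrueGrayCat.isStrictChiral_sym G).hasStrictComposites,
      IntercatData.IsStrictChiral.isChiral, TrueGrayCat.isConnection_symConnection G, ?_⟩
  · rintro a b c d h (⟨f, hb⟩ | ⟨f, hc⟩)
    · exact TrueGrayCat.isIdentity_laxχ_of_right h hb
    · exact TrueGrayCat.isIdentity_laxχ_of_left h hc
  · rintro a b c d h (⟨f, ha⟩ | ⟨f, hd⟩)
    · exact TrueGrayCat.isIdentity_colaxχ_of_left h ha
    · exact TrueGrayCat.isIdentity_colaxχ_of_right h hd
  · rintro a b c d h (ha | hd)
    · obtain ⟨z, hz⟩ := TrueGrayCat.exists_cell_eq_id₁_of_isCommutativityCell ha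
      exact TrueGrayCat.isIdentity_χ_of_left h hz
    · obtain ⟨z, hz⟩ := TrueGrayCat.exists_cell_eq_id₁_of_isCommutativityCell hd
      exact TrueGrayCat.isIdentity_χ_of_right h hz
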